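/- Let $r\ge 3$ and let $\mathcal D=\mathbb T^2\setminus\bigcup_{l=1}^m\mathcal O_l$ be a Sinai billiard table in the flat torus $\mathbb T^2=\mathbb R^2/\mathbb Z^2$: the $\mathcal O_l$ are strongly convex open sets with pairwise disjoint closures, and $\mathcal O_l$ is bounded by a simple closed $C^r$ curve $\Gamma_l$ of positive curvature and length $\ell_l$, parametrised anticlockwise by arc length by $\gamma:\mathbb R/\ell_l\mathbb Z\to\Gamma_l$. Let $\mathcal M=\bigsqcup_{l}\mathbb R/\ell_l\mathbb Z\times[-\frac\pi2,\frac\pi2]$ be the phase space; a point $(s,\varphi)$ stands for the position $\gamma(s)$ and the outgoing unit velocity at oriented angle $\varphi$ from the normal pointing into $\mathcal D$. Let $f:\mathcal M\to\mathcal M$ be the billiard map, which sends a collision to the next collision (grazing collisions included). Assume that $\mathcal D$ has finite horizon, i.e. the free flight time is bounded on $\mathcal M$. Put $\mathcal S_0=\{|\varphi|=\frac\pi2\}=\partial\mathcal M$ (grazing collisions), $\mathcal S_{n+1}=\mathcal S_n\cup f^{-1}(\mathcal S_n)$, $\mathcal S_{-(n+1)}=\mathcal S_{-n}\cup f(\mathcal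 S_{-n})$ for $n\ge0$, $\mathcal S=\bigcup_{n\in\mathbb Z}\mathcal S_n$ (singular set) and $\mathcal M^{\mathrm{reg}}=\mathcal M\setminus\mathcal S$ (regular set). Fix lifts $B_1,\dots,B_m\subset\mathbb R^2$ of $\Gamma_1,\dots,\Gamma_m$, let $\mathcal A=\mathbb Z^2\times\{1,\dots,m\}$ and $B_{(i,j;l)}=B_l+(i,j)$. On $\Sigma=\mathcal A^{\mathbb Z}$ use the metric $\rho(a,b)=2^{-\max\{n\ge0\,:\,a_i=b_i\text{ for all }|i|\le n\}}$ for $a\ne b$ (with $\rho(a,b)=1$ if $a_0\neq b_0$) and $\rho(a,a)=0$. The coding map $\imath:\mathcal M\to\Sigma$ sends $x=(s,\varphi)$, with $s\in\mathbb R/\ell_l\mathbb Z$, to the sequence $(a_i)_{i\in\mathbb Z}$ of labels of the scatterers $B_{a_i}$ successively met, in the past and in the future, by the lifted billiard trajectory that is at time $0$ at the lift in $B_l=B_{(0,0;l)}$ of $\gamma(s)$. Let $\Sigma_{\mathcal M}=\imath(\mathcal M)$. Then $f$ is a well-defined bijection of $\mathcal M$, $\imath$ is well defined, and $\imath:\mathcal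 M\to\Sigma_{\mathcal M}$ is a bijection such that: (i) the restriction of $\imath$ to $\mathcal M^{\mathrm{reg}}$ is continuous; (ii) the inverse $(\imath|_{\mathcal M^{\mathrm{reg}}})^{-1}:\imath(\mathcal M^{\mathrm{reg}})\to\mathcal M^{\mathrm{reg}}$ is Hölder continuous (for some exponent and constant depending on the table), so that $\imath|_{\mathcal M^{\mathrm{reg}}}$ is a homeomorphism from $\mathcal M^{\mathrm{reg}}$ onto $\imath(\mathcal M^{\mathrm{reg}})$; (iii) the set of discontinuity points of $\imath:\mathcal M\to\Sigma$ is precisely the singular set $\mathcal S$ without those boundary points $x\in\mathcal S_0=\partial\mathcal M$ whose orbit has no other grazing collision, i.e. $f^k(x)\notin\mathcal S_0$ for all $k\neq0$. In particular, a point $x\in\mathcal M\setminus\partial\mathcal M$ is a discontinuity point of $\imath$ if and only if $x\in\mathcal S$. -/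

import Mathlib

namespace SinaiBilliard

/-- The vector of the lattice `ℤ² ⊆ ℝ² = ℂ` with coordinates `n`. -/
noncomputable def latticeVec (n : ℤ × ℤ) : ℂ := (n.1 : ℂ) + (n.2 : ℂ) * Complex.I

/-- A Sinai billiard table of class `C^r` with `m` obstacles in the flat torus `ℝ²/ℤ²`, given by
lifts of its obstacles to the plane `ℝ² = ℂ`. Each obstacle is a strongly convex open set bounded
by a simple closed `C^r` curve of positive curvature, parametrised anticlockwise by arc length.
The closed obstacles are pairwise disjoint in the torus, that is, all their translates by `ℤ²` are
pairwise disjoint in the plane. -/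
structure Table (r m : ℕ) where
  /-- lift of the `l`-th open obstacle to the plane -/
  obstacle : Fin m → Set ℂ
  /-- perimeter of the `l`-th obstacle -/
  perimeter : Fin m → ℝ
  /-- arc-length parametrisation of the boundary of the `l`-th obstacle -/
  curve : Fin m → ℝ → ℂ
  isOpen_obstacle : ∀ l, IsOpen (obstacle l)
  convex_obstacle : ∀ l, Convex ℝ (obstacle l)
  perimeter_pos : ∀ l, 0 < perimeter l
  contDiff_curve : ∀ l, ContDiff ℝ r (curve l)
  periodic_curve : ∀ l, Function.Periodic (curve l) (perimeter l)
  injOn_curve : ∀ l, Set.InjOn (curve l) (Set.Ico 0 (perimeter l))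
  range_curve : ∀ l, Set.range (curve l) = frontier (obstacle l)
  unit_speed : ∀ l s, ‖deriv (curve l) s‖ = 1
  /-- The signed curvature `det (γ', γ'')` is positive (so the curve turns to the left, that is,
  it is run anticlockwise and it is strongly convex). -/
  curvature_pos : ∀ l s,
    0 < ((starRingEnd ℂ) (deriv (curve l) s) * deriv (deriv (curve l)) s).im
  disjoint_obstacles : ∀ (n n' : ℤ × ℤ) (l l' : Fin m), (n, l) ≠ (n', l') →
    Disjoint ((fun z => latticeVec n + z) '' closure (obstacle l))
      ((fun z => latticeVec n' + z) '' closure (obstacle l'))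

/-- The alphabet `ℤ² × {1, …, m}` labelling the scatterers of the lifted table. -/
abbrev Alphabet (m : ℕ) := (ℤ × ℤ) × Fin m

/-- The space `Σ` of two-sided sequences of labels; its metric is defined below. -/
def Seq (m : ℕ) := ℤ → Alphabet m

namespace Seq

variable {m : ℕ}

/-- The sequences `a` and `b` have the same entries at all places `i` with `|i| ≤ n`. -/
def Agree (a b : Seq m) (n : ℕ) : Prop := ∀ i : ℤ, |i| ≤ (n : ℤ) → a i = b i

open Classical in
/-- `ρ(a, b) = 2 ^ (-max {n ≥ 0 | a i = b i for all |i| ≤ n})` for `a ≠ b`; the maximum of the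
empty set is `0` here, so that `ρ(a, b) = 1` if `a 0 ≠ b 0`. -/
noncomputable def rho (a b : Seq m) : ℝ :=
  if a = b then 0 else (1 / 2 : ℝ) ^ sSup {n : ℕ | Agree a b n}

theorem Agree.symm {a b : Seq m} {n : ℕ} (h : Agree a b n) : Agree b a n :=
  fun i hi => (h i hi).symm

theorem Agree.trans {a b c : Seq m} {n : ℕ} (h : Agree a b n) (h' : Agree b c n) :
    Agree a c n :=
  fun i hi => (h i hi).trans (h' i hi)

theorem Agree.mono {a b : Seq m} {n k : ℕ} (h : Agree a b n) (hk : k ≤ n) : Agree a b k :=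
  fun i hi => h i (hi.trans (by exact_mod_cast hk))

theorem bddAbove_agree {a b : Seq m} (hab : a ≠ b) : BddAbove {n : ℕ | Agree a b n} := by
  obtain ⟨i, hi⟩ := Function.ne_iff.mp hab
  refine ⟨i.natAbs, fun n hn => ?_⟩
  by_contra hlt
  refine hi (hn i ?_)
  push Not at hlt
  rw [Int.abs_eq_natAbs]
  exact_mod_cast hlt.le

theorem rho_self (a : Seq m) : rho a a = 0 := by simp [rho]

theorem rho_nonneg (a b : Seq m) : 0 ≤ rho a b := by
  unfold rho; split_ifs <;> positivity

theorem rho_comm (a b : Seq m) : rho a b = rho b a := by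
  have h : {n : ℕ | Agree a b n} = {n : ℕ | Agree b a n} :=
    Set.ext fun n => ⟨Agree.symm, Agree.symm⟩
  unfold rho
  rw [h]
  by_cases hab : a = b
  · rw [if_pos hab, if_pos hab.symm]
  · rw [if_neg hab, if_neg (Ne.symm hab)]

theorem rho_le_one (a b : Seq m) : rho a b ≤ 1 := by
  unfold rho
  split_ifs
  · norm_num
  · exact pow_le_one₀ (by norm_num) (by norm_num)

theorem rho_le_of_agree {a b : Seq m} {n : ℕ} (h : Agree a b n) : rho a b ≤ (1 / 2 : ℝ) ^ n := by
  unfold rho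
  split_ifs with hab
  · positivity
  · exact pow_le_pow_of_le_one (by norm_num) (by norm_num) (le_csSup (bddAbove_agree hab) h)

theorem rho_of_ne {a b : Seq m} (hab : a ≠ b) :
    rho a b = 1 ∨ ∃ n, Agree a b n ∧ rho a b = (1 / 2 : ℝ) ^ n := by
  rcases Set.eq_empty_or_nonempty {n : ℕ | Agree a b n} with h | h
  · left; simp [rho, hab, h]
  · exact Or.inr ⟨_, Nat.sSup_mem h (bddAbove_agree hab), by simp [rho, hab]⟩

theorem rho_le_max (a b c : Seq m) : rho a c ≤ max (rho a b) (rho b c) := by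
  by_cases hab : a = b
  · subst hab; exact le_max_right _ _
  by_cases hbc : b = c
  · subst hbc; exact le_max_left _ _
  rcases rho_of_ne hab with h | ⟨n, hn, h⟩
  · exact le_max_of_le_left (h ▸ rho_le_one a c)
  rcases rho_of_ne hbc with h' | ⟨k, hk, h'⟩
  · exact le_max_of_le_right (h' ▸ rho_le_one a c)
  rcases le_total n k with hnk | hkn
  · exact le_max_of_le_left (h ▸ rho_le_of_agree (hn.trans (hk.mono hnk)))
  · exact le_max_of_le_right (h' ▸ rho_le_of_agree ((hn.mono hkn).trans hk))

theorem eq_of_rho_eq_zero {a b : Seq m} (h : rho a b = 0) : a = b := by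
  by_contra hab
  rw [rho, if_neg hab] at h
  exact absurd h (by positivity)

noncomputable instance : MetricSpace (Seq m) where
  dist := rho
  dist_self := rho_self
  dist_comm := rho_comm
  dist_triangle a b c := (rho_le_max a b c).trans
    (max_le_add_of_nonneg (rho_nonneg a b) (rho_nonneg b c))
  eq_of_dist_eq_zero := eq_of_rho_eq_zero

end Seq

theorem periodic_deriv {g : ℝ → ℂ} {c : ℝ} (h : Function.Periodic g c) :
    Function.Periodic (deriv g) c := by
  intro x
  rw [← deriv_comp_add_const]
  congr 1
  exact funext h

namespace Table

variable {r m : ℕ} (D : Table r m)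

/-- The phase space `M = (⊔ₗ ℝ/ℓₗℤ) × [-π/2, π/2]` of the billiard map, written as the disjoint
union of the cylinders `ℝ/ℓₗℤ × [-π/2, π/2]`. -/
def PhaseSpace : Type :=
  Σ l : Fin m, AddCircle (D.perimeter l) × Set.Icc (-(Real.pi / 2)) (Real.pi / 2)

/-- The metric of the disjoint union: it is the product metric on each cylinder, and points of
different cylinders have distance at least `1` (and at most a constant). -/
noncomputable instance : MetricSpace D.PhaseSpace := Metric.Sigma.metricSpace

/-- The scatterer of the lifted table with label `a = (n, l)`: the translate by `n` of the boundary
curve of the `l`-th obstacle. -/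
def scatterer (a : Alphabet m) : Set ℂ :=
  (fun z => latticeVec a.1 + z) '' frontier (D.obstacle a.2)

/-- The position `γ(s)` of a point `(s, φ)` of the phase space, in the chosen lifts. -/
noncomputable def pos (x : D.PhaseSpace) : ℂ := (D.periodic_curve x.1).lift x.2.1

/-- The unit tangent vector `γ'(s)` at a point `(s, φ)` of the phase space. -/
noncomputable def tangent (x : D.PhaseSpace) : ℂ :=
  (periodic_deriv (D.periodic_curve x.1)).lift x.2.1

/-- The unit normal vector at `γ(s)` that points into the table (out of the obstacle): the unit
tangent vector turned clockwise by a right angle. -/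
noncomputable def normal (x : D.PhaseSpace) : ℂ := -Complex.I * D.tangent x

/-- The angle `φ ∈ [-π/2, π/2]` of a point `(s, φ)` of the phase space. -/
noncomputable def angle (x : D.PhaseSpace) : ℝ := x.2.2

/-- The outgoing unit velocity: the normal vector into the table turned by the oriented
angle `φ`. -/
noncomputable def vel (x : D.PhaseSpace) : ℂ :=
  D.normal x * Complex.exp (D.angle x * Complex.I)

/-- Finite horizon: the free flights that start at the points of the phase space have bounded
length. (They are bounded below by a positive constant because the closed obstacles are
disjoint.) -/
def FiniteHorizon : Prop :=
  ∃ T : ℝ, ∀ x : D.PhaseSpace, ∃ t : ℝ, 0 < t ∧ t ≤ T ∧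
    ∃ a : Alphabet m, D.pos x + t * D.vel x ∈ D.scatterer a

/-- A state of the billiard in the lifted table: the cell of the current scatterer together with
the corresponding point of the phase space. -/
abbrev LiftedState := (ℤ × ℤ) × D.PhaseSpace

/-- The position in the plane of a lifted state. -/
noncomputable def liftedPos (p : D.LiftedState) : ℂ := latticeVec p.1 + D.pos p.2

/-- The billiard map of the lifted table, as a relation: `q` is the next collision after `p`. The
particle moves from `p` on a straight line until it meets a scatterer for the first time, possibly
tangentially (grazing collisions count), and there its velocity is reflected. -/
def NextCollision (p q : D.LiftedState) : Prop :=
  (∃ t : ℝ, 0 < t ∧ D.liftedPos p + t * D.vel p.2 = D.liftedPos q ∧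
    ∀ u : ℝ, 0 < u → u < t → ∀ a : Alphabet m,
      D.liftedPos p + u * D.vel p.2 ∉ D.scatterer a) ∧
  D.vel q.2 = D.vel p.2 - ((2 * inner ℝ (D.vel p.2) (D.normal q.2) : ℝ) : ℂ) * D.normal q.2

open Classical in
/-- The billiard map `f : M → M`. (The value `x` is taken only if there is no next collision.) -/
noncomputable def billiardMap (x : D.PhaseSpace) : D.PhaseSpace :=
  if h : ∃ y : D.PhaseSpace, ∃ k : ℤ × ℤ, D.NextCollision (0, x) (k, y) then h.choose else x

/-- `a` is the sequence of labels of the scatterers met by the two-sided billiard trajectory in the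
lifted table whose collision at time `0` is the point `x`, in the cell `0`. -/
def IsCoding (x : D.PhaseSpace) (a : Seq m) : Prop :=
  ∃ z : ℤ → D.LiftedState, z 0 = (0, x) ∧ (∀ i, D.NextCollision (z i) (z (i + 1))) ∧
    ∀ i, D.liftedPos (z i) ∈ D.scatterer (a i)

open Classical in
/-- The coding map `ı : M → Σ`. (The constant sequence is taken only if there is no two-sided
trajectory.) -/
noncomputable def coding (x : D.PhaseSpace) : Seq m :=
  if h : ∃ a : Seq m, D.IsCoding x a then h.choose else fun _ => (0, x.1)

/-- The space of admissible sequences `Σ_M = ı(M)`. -/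
def admissible : Set (Seq m) := Set.range D.coding

/-- The set `S₀ = ∂M` of grazing collisions. -/
def grazing : Set D.PhaseSpace := {x | |D.angle x| = Real.pi / 2}

/-- `S₀` and `Sₙ₊₁ = Sₙ ∪ f⁻¹(Sₙ)`. -/
def singForward : ℕ → Set D.PhaseSpace
  | 0 => D.grazing
  | n + 1 => singForward n ∪ D.billiardMap ⁻¹' singForward n

/-- `S₀` and `S₋₍ₙ₊₁₎ = S₋ₙ ∪ f(S₋ₙ)`. -/
def singBackward : ℕ → Set D.PhaseSpace
  | 0 => D.grazing
  | n + 1 => singBackward n ∪ D.billiardMap '' singBackward n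

/-- The singular set `S`, the union of all `Sₙ`, `n ∈ ℤ`. -/
def singularSet : Set D.PhaseSpace := ⋃ n : ℕ, D.singForward n ∪ D.singBackward n

/-- The regular set `M^reg = M \ S`. -/
def regularSet : Set D.PhaseSpace := D.singularSetᶜ

/-- The points whose collision is grazing, while no collision in their strict future and strict
past is grazing. -/
def grazingOnlyNow : Set D.PhaseSpace :=
  {x | x ∈ D.grazing ∧ ∀ n : ℕ, 1 ≤ n →
    D.billiardMap^[n] x ∉ D.grazing ∧ x ∉ D.billiardMap^[n] '' D.grazing}

end Table

end SinaiBilliard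

/-!
The plane is `ℂ`, and `cross u w` denotes the oriented area of `u` and `w`.

*The maps are well defined.* Under finite horizon a ray meets another scatterer, and the next
collision is the first such time; it is unique, and reversing the velocities reverses it. Hence the
billiard map of the lifted table is a permutation `nextPerm` of the lifted states, conjugate to its
inverse by time reversal, and the coding is the itinerary of its orbit `traj`.

*Continuity.* If the next collision is not grazing, then the ray enters the interior of the obstacle
shortly after, and the compact piece of the ray before it stays away from all the other scatterers.
So rays nearby hit the same scatterer at about the same time (`continuousAt_next`). Thus the coding
is continuous at points without a grazing collision at times other than `0`.

*Discontinuity.* By time reversal, let the first grazing collision in the strict future be the one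
with number `n + 1`. Displacing the base point at a constant angle gives a dispersing family: because
of the positive curvature, the rays turn away from the given ray to the side to which they are
displaced (`exists_disperses`). Collisions with convex scatterers preserve this property
(`Disperses.next`). The scatterer grazed at the collision with number `n + 1` lies on one side of the
ray, so it is missed by the family of the opposite side, and the codings differ there.

*Injectivity and Hölder continuity of the inverse.* For two trajectories, let the pairing be the
inner product `⟪v - w, p - q⟫` of the differences of the outgoing velocities and of the positions.
As long as both meet the same scatterers, it does not decrease: a flight of length at least `δ` adds
at least `δ * ‖v - w‖ ^ 2` (`pairing_add_le`), and a collision adds a nonnegative amount because each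
point of impact lies on the obstacle's side of the tangent line at the other
(`inner_vin_le_pairing`). By `exists_separation`, over a fixed number of common collisions the
differences of the velocities bound the distance of the points. So the pairing grows by an amount
proportional to its absolute value and to the squared distance (`exists_expansion`). As it is bounded
while the labels agree, it is exponentially small in the length of the agreement, and so is the
distance of the points (`exists_dist_sq_le`).

*Separation.* `exists_separation` is proved by compactness. A sequence of counterexamples has two
limit trajectories with the same labels and the same velocities. If they start at the same point,
then a local estimate applies: the product of the incoming and the outgoing velocity is the squared
tangent vector, which moves with positive speed (`eventually_dist_le`). Otherwise they hit
each obstacle at two points with equal velocities, so at opposite grazing points; they are parallel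
lines, and the obstacles lie in the strip between them (`IsLimitTraj.strip`). A trajectory close to
such a one-sided line would have to touch the middle one of three consecutive obstacles at a depth
at least linear in the rotation of the tangent there, while by curvature the depth is quadratic; so
it runs along the line itself (`eventually_liftedPos_eq`). Consequently the line meets no further
scatterers for a long time, and rotating it slightly away from the strip contradicts finite horizon
(`not_oneSided`).
-/

namespace SinaiBilliard

open Filter Topology Set

/-! ### The oriented area form -/

/-- The oriented area `det (u, w)` of the parallelogram spanned by `u` and `w`; it is positive if
`w` lies to the left of `u`. -/
noncomputable def cross (u w : ℂ) : ℝ := ((starRingEnd ℂ) u * w).im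

theorem cross_eq (u w : ℂ) : cross u w = u.re * w.im - u.im * w.re := by
  simp [cross]; ring

theorem cross_add (u w w' : ℂ) : cross u (w + w') = cross u w + cross u w' := by
  simp only [cross_eq, Complex.add_re, Complex.add_im]; ring

theorem cross_sub (u w w' : ℂ) : cross u (w - w') = cross u w - cross u w' := by
  simp only [cross_eq, Complex.sub_re, Complex.sub_im]; ring

theorem cross_neg (u w : ℂ) : cross u (-w) = -cross u w := by
  simp only [cross_eq, Complex.neg_re, Complex.neg_im]; ring

theorem neg_cross (u w : ℂ) : cross (-u) w = -cross u w := by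
  simp only [cross_eq, Complex.neg_re, Complex.neg_im]; ring

theorem cross_real_mul (u w : ℂ) (a : ℝ) : cross u (a * w) = a * cross u w := by
  simp only [cross_eq, Complex.mul_re, Complex.mul_im, Complex.ofReal_re, Complex.ofReal_im]; ring

theorem cross_self (u : ℂ) : cross u u = 0 := by
  simp only [cross_eq]; ring

@[fun_prop]
theorem continuous_cross : Continuous fun p : ℂ × ℂ => cross p.1 p.2 := by
  unfold cross; fun_prop

theorem hasDerivAt_cross {g : ℝ → ℂ} {g' : ℂ} {s : ℝ} (u : ℂ) (h : HasDerivAt g g' s) :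
    HasDerivAt (fun s => cross u (g s)) (cross u g') s :=
  Complex.imCLM.hasFDerivAt.comp_hasDerivAt s (h.const_mul ((starRingEnd ℂ) u))

theorem sq_add_sq_of_norm_eq_one {z : ℂ} (h : ‖z‖ = 1) : z.re ^ 2 + z.im ^ 2 = 1 := by
  have := Complex.sq_norm z
  rw [h, Complex.normSq_apply] at this
  linarith

/-- A function that vanishes at `s` and has a positive derivative there changes its sign from
minus to plus at `s`. -/
theorem eventually_sign_of_hasDerivAt {g : ℝ → ℝ} {g' s : ℝ} (h : HasDerivAt g g' s)
    (h0 : g s = 0) (hg' : 0 < g') :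
    ∀ᶠ s' in 𝓝 s, (s < s' → 0 < g s') ∧ (s' < s → g s' < 0) := by
  have h1 := hasDerivAt_iff_tendsto_slope.mp h
  have h2 := (h1.eventually (lt_mem_nhds hg'))
  rw [eventually_nhdsWithin_iff] at h2
  filter_upwards [h2] with s' hs'
  refine ⟨fun hlt => ?_, fun hlt => ?_⟩
  · have := hs' hlt.ne'
    rw [slope_def_field, h0, sub_zero] at this
    have h3 : 0 < s' - s := sub_pos.mpr hlt
    exact (div_pos_iff_of_pos_right h3).mp this
  · have := hs' hlt.ne
    rw [slope_def_field, h0, sub_zero] at this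
    have h3 : s' - s < 0 := sub_neg.mpr hlt
    rcases div_pos_iff.mp this with h | h
    · exact absurd h.2 (not_lt.mpr h3.le)
    · exact h.1

namespace Table

variable {r m : ℕ} (D : Table r m)

instance (l : Fin m) : Fact (0 < D.perimeter l) := ⟨D.perimeter_pos l⟩

/-! ### The boundary curves -/

section Curve

variable [hr : Fact (2 ≤ r)] (l : Fin m)

theorem contDiff_two : ContDiff ℝ 2 (D.curve l) :=
  (D.contDiff_curve l).of_le (by exact_mod_cast hr.out)

theorem hasDerivAt_curve (s : ℝ) : HasDerivAt (D.curve l) (deriv (D.curve l) s) s :=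
  ((D.contDiff_two l).differentiable (by norm_num) s).hasDerivAt

theorem contDiff_deriv : ContDiff ℝ 1 (deriv (D.curve l)) := by
  have h : ContDiff ℝ (1 + 1) (D.curve l) := by
    convert D.contDiff_two l using 1
    norm_num
  exact (contDiff_succ_iff_deriv.mp h).2.2

theorem hasStrictDerivAt_deriv (s : ℝ) :
    HasStrictDerivAt (deriv (D.curve l)) (deriv (deriv (D.curve l)) s) s :=
  (D.contDiff_deriv l).contDiffAt.hasStrictDerivAt (by norm_num)

theorem hasDerivAt_deriv (s : ℝ) :
    HasDerivAt (deriv (D.curve l)) (deriv (deriv (D.curve l)) s) s :=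
  (D.hasStrictDerivAt_deriv l s).hasDerivAt

/-- Locally, the tangent vector turns strictly to the left. -/
theorem eventually_cross_deriv (s : ℝ) :
    ∀ᶠ s' in 𝓝 s, (s < s' → 0 < cross (deriv (D.curve l) s) (deriv (D.curve l) s')) ∧
      (s' < s → cross (deriv (D.curve l) s) (deriv (D.curve l) s') < 0) :=
  eventually_sign_of_hasDerivAt (hasDerivAt_cross _ (D.hasDerivAt_deriv l s)) (cross_self _)
    (D.curvature_pos l s)

/-- Locally, the curve lies strictly to the left of its tangent line. -/
theorem eventually_cross_curve_pos (s : ℝ) :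
    ∀ᶠ s' in 𝓝 s, s' ≠ s → 0 < cross (deriv (D.curve l) s) (D.curve l s' - D.curve l s) := by
  obtain ⟨ε, hε, h⟩ := Metric.eventually_nhds_iff.mp (D.eventually_cross_deriv l s)
  set T := deriv (D.curve l) s
  set g : ℝ → ℝ := fun s' => cross T (D.curve l s' - D.curve l s) with hg
  have hd : ∀ s', HasDerivAt g (cross T (deriv (D.curve l) s')) s' := fun s' =>
    hasDerivAt_cross _ ((D.hasDerivAt_curve l s').sub_const _)
  have hg0 : g s = 0 := by simp [hg, cross_eq]
  refine Metric.eventually_nhds_iff.mpr ⟨ε, hε, fun s' hs' hne => ?_⟩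
  rw [Real.dist_eq] at hs'
  -- by the mean value theorem the sign of `g s'` is that of `g'` times that of `s' - s`
  rcases lt_or_gt_of_ne hne with hlt | hlt
  · obtain ⟨c, hc, hc'⟩ := exists_hasDerivAt_eq_slope g _ hlt
      (fun x _ => (hd x).continuousAt.continuousWithinAt) (fun x _ => hd x)
    have h1 := (h (y := c) (by
      rw [Real.dist_eq, abs_lt]; rw [abs_lt] at hs'; constructor <;> linarith [hc.1, hc.2])).2 hc.2
    rw [hc', hg0, div_neg_iff] at h1
    rcases h1 with h1 | h1
    · linarith [h1.2]
    · linarith [h1.1]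
  · obtain ⟨c, hc, hc'⟩ := exists_hasDerivAt_eq_slope g _ hlt
      (fun x _ => (hd x).continuousAt.continuousWithinAt) (fun x _ => hd x)
    have h1 := (h (y := c) (by
      rw [Real.dist_eq, abs_lt]; rw [abs_lt] at hs'; constructor <;> linarith [hc.1, hc.2])).1 hc.1
    rw [hc', hg0, div_pos_iff] at h1
    rcases h1 with h1 | h1
    · linarith [h1.1]
    · linarith [h1.2]

/-! ### The curves on the circle -/

/-- The boundary curve as a map on the circle `ℝ/ℓℤ`. -/
noncomputable def circleCurve : AddCircle (D.perimeter l) → ℂ := (D.periodic_curve l).lift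

/-- The unit tangent vector as a map on the circle `ℝ/ℓℤ`. -/
noncomputable def circleTangent : AddCircle (D.perimeter l) → ℂ :=
  (periodic_deriv (D.periodic_curve l)).lift

omit hr in
@[simp] theorem circleCurve_coe (s : ℝ) : D.circleCurve l (s : AddCircle (D.perimeter l)) =
    D.curve l s := rfl

omit hr in
@[simp] theorem circleTangent_coe (s : ℝ) : D.circleTangent l (s : AddCircle (D.perimeter l)) =
    deriv (D.curve l) s := rfl

theorem continuous_circleCurve : Continuous (D.circleCurve l) :=
  QuotientAddGroup.isOpenQuotientMap_mk.isQuotientMap.continuous_iff.mpr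
    (D.contDiff_two l).continuous

theorem continuous_circleTangent : Continuous (D.circleTangent l) :=
  QuotientAddGroup.isOpenQuotientMap_mk.isQuotientMap.continuous_iff.mpr
    (D.contDiff_deriv l).continuous

omit hr in
theorem circleCurve_injective : Function.Injective (D.circleCurve l) := by
  intro θ θ' h
  obtain ⟨s, hs, rfl⟩ := AddCircle.eq_coe_Ico θ
  obtain ⟨s', hs', rfl⟩ := AddCircle.eq_coe_Ico θ'
  rw [D.injOn_curve l hs hs' h]

theorem isClosedEmbedding_circleCurve : IsClosedEmbedding (D.circleCurve l) :=
  (D.continuous_circleCurve l).isClosedEmbedding (D.circleCurve_injective l)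

omit hr in
theorem range_circleCurve : range (D.circleCurve l) = frontier (D.obstacle l) := by
  rw [← D.range_curve l]
  ext z
  constructor
  · rintro ⟨θ, rfl⟩
    obtain ⟨s, rfl⟩ := QuotientAddGroup.mk_surjective θ
    exact ⟨s, rfl⟩
  · rintro ⟨s, rfl⟩
    exact ⟨s, rfl⟩

omit hr in
theorem curve_mem_frontier (s : ℝ) : D.curve l s ∈ frontier (D.obstacle l) := by
  rw [← D.range_curve l]; exact ⟨s, rfl⟩

omit hr in
theorem eventually_circle {P : AddCircle (D.perimeter l) → Prop} {s : ℝ}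
    (h : ∀ᶠ s' : ℝ in 𝓝 s, P s') : ∀ᶠ θ in 𝓝 (s : AddCircle (D.perimeter l)), P θ := by
  have := QuotientAddGroup.isOpenMap_coe.nhds_le (f := ((↑) : ℝ → AddCircle (D.perimeter l))) s
  exact this h

/-! ### Supporting lines of the obstacles -/

omit hr in
theorem notMem_obstacle_of_mem_frontier {z : ℂ} (hz : z ∈ frontier (D.obstacle l)) :
    z ∉ D.obstacle l := by
  rw [(D.isOpen_obstacle l).frontier_eq] at hz
  exact hz.2

omit hr in
theorem obstacle_nonempty : (D.obstacle l).Nonempty := by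
  have := D.curve_mem_frontier l 0
  exact closure_nonempty_iff.mp ⟨_, frontier_subset_closure this⟩

/-- A linear functional that attains its supremum over the obstacle at `γ(s)` is a negative
multiple of `det (γ'(s), ·)`. -/
theorem supporting_functional {s : ℝ} {f : ℂ →L[ℝ] ℝ}
    (hf : ∀ z ∈ D.obstacle l, f z < f (D.curve l s)) :
    ∃ c < 0, ∀ w, f w = c * cross (deriv (D.curve l) s) w := by
  set T := deriv (D.curve l) s with hT
  have hT1 := sq_add_sq_of_norm_eq_one (D.unit_speed l s)
  rw [← hT] at hT1
  have hle : ∀ z ∈ closure (D.obstacle l), f z ≤ f (D.curve l s) := fun z hz =>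
    closure_minimal (fun z hz => (hf z hz).le) (isClosed_le f.continuous continuous_const) hz
  have h0 : f T = 0 := by
    have hmax : IsLocalMax (fun s' => f (D.curve l s')) s :=
      Eventually.of_forall fun s' => hle _ (frontier_subset_closure (D.curve_mem_frontier l s'))
    exact hmax.hasDerivAt_eq_zero (f.hasFDerivAt.comp_hasDerivAt s (D.hasDerivAt_curve l s))
  have hw : ∀ w, f w = f (Complex.I * T) * cross T w := by
    intro w
    have : w = ((T.re * w.re + T.im * w.im : ℝ)) • T + (cross T w) • (Complex.I * T) := by
      apply Complex.ext <;> simp [cross_eq]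
      · linear_combination (-w.re) * hT1
      · linear_combination (-w.im) * hT1
    conv_lhs => rw [this]
    rw [map_add, map_smul, map_smul, h0]
    simp [mul_comm]
  refine ⟨f (Complex.I * T), lt_of_le_of_ne ?_ ?_, hw⟩
  · have h1 := (D.eventually_cross_curve_pos l s)
    have h2 : ∀ᶠ s' in 𝓝[≠] s, 0 < cross T (D.curve l s' - D.curve l s) :=
      eventually_nhdsWithin_iff.mpr h1
    obtain ⟨s', hs'⟩ := h2.exists
    have h3 := hle _ (frontier_subset_closure (D.curve_mem_frontier l s'))
    rw [hw, hw (D.curve l s)] at h3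
    rw [cross_sub] at hs'
    by_contra hc
    push Not at hc
    nlinarith
  · intro hc
    obtain ⟨z, hz⟩ := D.obstacle_nonempty l
    have := hf z hz
    rw [hw, hw (D.curve l s), hc] at this
    simp at this

theorem cross_pos_of_mem_obstacle (s : ℝ) {z : ℂ} (hz : z ∈ D.obstacle l) :
    0 < cross (deriv (D.curve l) s) (z - D.curve l s) := by
  obtain ⟨f, hf⟩ := geometric_hahn_banach_open_point (D.convex_obstacle l) (D.isOpen_obstacle l)
    (D.notMem_obstacle_of_mem_frontier l (D.curve_mem_frontier l s))
  obtain ⟨c, hc, h⟩ := D.supporting_functional l hf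
  have := hf z hz
  rw [h, h (D.curve l s)] at this
  rw [cross_sub]
  nlinarith

theorem cross_nonneg_of_mem_closure (s : ℝ) {z : ℂ} (hz : z ∈ closure (D.obstacle l)) :
    0 ≤ cross (deriv (D.curve l) s) (z - D.curve l s) := by
  have hc : Continuous fun z => cross (deriv (D.curve l) s) (z - D.curve l s) :=
    continuous_cross.comp (by fun_prop : Continuous fun z => (deriv (D.curve l) s, z - D.curve l s))
  exact closure_minimal (t := {z | 0 ≤ cross (deriv (D.curve l) s) (z - D.curve l s)})
    (fun z hz => (D.cross_pos_of_mem_obstacle l s hz).le) (isClosed_le continuous_const hc) hz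

/-- Strict convexity: a closed obstacle meets its supporting line at `γ(s)` only in `γ(s)`. -/
theorem cross_pos_of_mem_closure (s : ℝ) {z : ℂ} (hz : z ∈ closure (D.obstacle l))
    (hne : z ≠ D.curve l s) : 0 < cross (deriv (D.curve l) s) (z - D.curve l s) := by
  refine lt_of_le_of_ne (D.cross_nonneg_of_mem_closure l s hz) fun h0 => ?_
  set T := deriv (D.curve l) s
  set p := D.curve l s with hp
  -- otherwise the segment from `γ(s)` to `z` lies on the boundary
  have hfr : ∀ u ∈ Ioo (0 : ℝ) 1, p + u * (z - p) ∈ frontier (D.obstacle l) := by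
    intro u hu
    rw [(D.isOpen_obstacle l).frontier_eq]
    refine ⟨?_, fun hmem => ?_⟩
    · have := (D.convex_obstacle l).closure.add_smul_sub_mem
        (frontier_subset_closure (D.curve_mem_frontier l s)) hz ⟨hu.1.le, hu.2.le⟩
      simpa using this
    · have := D.cross_pos_of_mem_obstacle l s hmem
      rw [← hp, add_sub_cancel_left, cross_real_mul, ← h0] at this
      simp at this
  have h1 : ∀ᶠ θ in 𝓝 (s : AddCircle (D.perimeter l)), D.circleCurve l θ = p ∨
      0 < cross T (D.circleCurve l θ - p) := by
    apply D.eventually_circle l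
    filter_upwards [D.eventually_cross_curve_pos l s] with s' hs'
    by_cases h : s' = s
    · left; rw [h]; rfl
    · exact Or.inr (hs' h)
  have h2 : ∀ᶠ w in 𝓝[frontier (D.obstacle l)] p, w = p ∨ 0 < cross T (w - p) := by
    rw [← D.range_circleCurve l]
    have := (D.isClosedEmbedding_circleCurve l).isInducing.map_nhds_eq
      (s : AddCircle (D.perimeter l))
    rw [circleCurve_coe, ← hp] at this
    rw [← this]
    exact h1
  have h3 : Tendsto (fun u : ℝ => p + u * (z - p)) (𝓝[>] 0) (𝓝[frontier (D.obstacle l)] p) := by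
    refine tendsto_nhdsWithin_iff.mpr ⟨?_, ?_⟩
    · have : Continuous (fun u : ℝ => p + u * (z - p)) := by fun_prop
      have h := this.tendsto 0
      simp only [Complex.ofReal_zero, zero_mul, add_zero] at h
      exact h.mono_left nhdsWithin_le_nhds
    · filter_upwards [Ioo_mem_nhdsGT (zero_lt_one (α := ℝ))] with u hu using hfr u hu
  obtain ⟨u, hu, hu0⟩ := ((h3.eventually h2).and self_mem_nhdsWithin).exists
  have hu0' : (u : ℂ) ≠ 0 := by exact_mod_cast (ne_of_gt hu0)
  rcases hu with hu | hu
  · rw [add_eq_left, mul_eq_zero, sub_eq_zero] at hu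
    exact hu.elim hu0' hne
  · rw [add_sub_cancel_left, cross_real_mul, ← h0] at hu
    simp at hu

/-- A vector that points to the left of the tangent at `γ(s)` points into the obstacle. -/
theorem eventually_mem_obstacle (s : ℝ) {d : ℂ} (hd : 0 < cross (deriv (D.curve l) s) d) :
    ∀ᶠ u : ℝ in 𝓝[>] 0, D.curve l s + u * d ∈ D.obstacle l := by
  set p := D.curve l s with hp
  have hconv := D.convex_obstacle l
  -- it is enough to find one such point
  suffices h : ∃ u : ℝ, 0 < u ∧ p + u * d ∈ D.obstacle l by
    obtain ⟨u₀, hu₀, hmem⟩ := h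
    filter_upwards [Ioo_mem_nhdsGT hu₀] with u hu
    have hcl : p ∈ closure (D.obstacle l) := frontier_subset_closure (D.curve_mem_frontier l s)
    have hint : p + u₀ * d ∈ interior (D.obstacle l) := by
      rwa [(D.isOpen_obstacle l).interior_eq]
    have := hconv.openSegment_closure_interior_subset_interior hcl hint
    rw [(D.isOpen_obstacle l).interior_eq] at this
    apply this
    rw [openSegment_eq_image']
    refine ⟨u / u₀, ⟨div_pos hu.1 hu₀, (div_lt_one hu₀).mpr hu.2⟩, ?_⟩
    have : (u₀ : ℂ) ≠ 0 := by exact_mod_cast hu₀.ne'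
    simp only [Complex.real_smul, Complex.ofReal_div]
    field_simp
    ring
  by_contra! hcon
  set R : Set ℂ := (fun u : ℝ => p + u * d) '' Ioi 0 with hR
  have hRconv : Convex ℝ R := by
    have h1 : R = (fun w => p + w) '' ((LinearMap.toSpanSingleton ℝ ℂ d) '' Ioi 0) := by
      rw [hR, image_image]; simp
    rw [h1]
    exact ((convex_Ioi 0).linear_image _).translate p
  have hdisj : Disjoint (D.obstacle l) R := by
    rw [Set.disjoint_right]
    rintro _ ⟨u, hu, rfl⟩
    exact hcon u hu
  obtain ⟨f, c, hf1, hf2⟩ := geometric_hahn_banach_open hconv (D.isOpen_obstacle l) hRconv hdisj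
  have hpc : f p = c := by
    apply le_antisymm
    · exact closure_minimal (fun z hz => (hf1 z hz).le)
        (isClosed_le f.continuous continuous_const)
        (frontier_subset_closure (D.curve_mem_frontier l s))
    · have hcont : Continuous (fun u : ℝ => f (p + u * d)) := by fun_prop
      have h := (hcont.tendsto 0).mono_left (nhdsWithin_le_nhds (s := Ioi 0))
      simp only [Complex.ofReal_zero, zero_mul, add_zero] at h
      exact ge_of_tendsto h (by
        filter_upwards [self_mem_nhdsWithin] with u hu using hf2 _ ⟨u, hu, rfl⟩)
  obtain ⟨c', hc', h⟩ := D.supporting_functional l (s := s) (f := f)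
    (fun z hz => by rw [← hp, hpc]; exact hf1 z hz)
  have h1 := hf2 _ ⟨1, mem_Ioi.mpr one_pos, rfl⟩
  simp only [Complex.ofReal_one, one_mul, map_add, hpc, h d] at h1
  nlinarith

end Curve

end Table

/-- A segment that ends in an open set and starts outside of it meets its frontier before. -/
theorem exists_mem_frontier_of_segment {U : Set ℂ} (hU : IsOpen U) {z d : ℂ} {b : ℝ} (hb : 0 ≤ b)
    (hz : z ∉ U) (hzb : z + b * d ∈ U) : ∃ u : ℝ, 0 ≤ u ∧ u < b ∧ z + u * d ∈ frontier U := by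
  have hc : Continuous fun u : ℝ => z + u * d := by fun_prop
  have hpre : IsPreconnected (Icc (0 : ℝ) b) := isPreconnected_Icc
  by_contra! hcon
  have hsub : Icc (0 : ℝ) b ⊆ ((fun u : ℝ => z + u * d) ⁻¹' U) ∪
      ((fun u : ℝ => z + u * d) ⁻¹' (closure U)ᶜ) := by
    intro u hu
    by_cases h1 : z + u * d ∈ U
    · exact Or.inl h1
    · refine Or.inr fun h2 => ?_
      have hub : u < b := lt_of_le_of_ne hu.2 (fun h => h1 (h ▸ hzb))
      exact hcon u hu.1 hub (by rw [hU.frontier_eq]; exact ⟨h2, h1⟩)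
  have h0 : (0 : ℝ) ∈ (fun u : ℝ => z + u * d) ⁻¹' (closure U)ᶜ := by
    rcases hsub (left_mem_Icc.mpr hb) with h | h
    · exact absurd (by simpa using h) hz
    · exact h
  obtain ⟨u, _, hu1, hu2⟩ := hpre _ _ (hU.preimage hc) (isClosed_closure.isOpen_compl.preimage hc)
    hsub ⟨b, right_mem_Icc.mpr hb, hzb⟩ ⟨0, left_mem_Icc.mpr hb, h0⟩
  exact hu2 (subset_closure hu1)

namespace Table

variable {r m : ℕ} (D : Table r m)

/-! ### The phase space -/

section PhaseSpace

instance : CompactSpace D.PhaseSpace :=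
  inferInstanceAs (CompactSpace
    (Σ l : Fin m, AddCircle (D.perimeter l) × Set.Icc (-(Real.pi / 2)) (Real.pi / 2)))

variable {D}

theorem continuous_phaseSpace {X : Type*} [TopologicalSpace X] {g : D.PhaseSpace → X}
    (h : ∀ l, Continuous fun y : AddCircle (D.perimeter l) × Set.Icc (-(Real.pi / 2)) (Real.pi / 2)
      => g ⟨l, y⟩) : Continuous g :=
  continuous_sigma (σ := fun l : Fin m =>
    AddCircle (D.perimeter l) × Set.Icc (-(Real.pi / 2)) (Real.pi / 2)) h

theorem continuous_mk (l : Fin m) :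
    Continuous fun y : AddCircle (D.perimeter l) × Set.Icc (-(Real.pi / 2)) (Real.pi / 2) =>
      (⟨l, y⟩ : D.PhaseSpace) :=
  continuous_sigmaMk (σ := fun l : Fin m =>
    AddCircle (D.perimeter l) × Set.Icc (-(Real.pi / 2)) (Real.pi / 2))

theorem dist_mk (l : Fin m)
    (y y' : AddCircle (D.perimeter l) × Set.Icc (-(Real.pi / 2)) (Real.pi / 2)) :
    @dist D.PhaseSpace _ ⟨l, y⟩ ⟨l, y'⟩ = dist y y' :=
  Metric.Sigma.dist_same (E := fun l : Fin m =>
    AddCircle (D.perimeter l) × Set.Icc (-(Real.pi / 2)) (Real.pi / 2)) l y y'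

theorem continuous_fst : Continuous fun x : D.PhaseSpace => x.1 :=
  continuous_phaseSpace fun _ => continuous_const

theorem exists_coe_eq (x : D.PhaseSpace) : ∃ s : ℝ, (s : AddCircle (D.perimeter x.1)) = x.2.1 :=
  QuotientAddGroup.mk_surjective x.2.1

theorem pos_mem_frontier (x : D.PhaseSpace) : D.pos x ∈ frontier (D.obstacle x.1) := by
  rw [← D.range_circleCurve]
  exact ⟨x.2.1, rfl⟩

theorem norm_tangent (x : D.PhaseSpace) : ‖D.tangent x‖ = 1 := by
  obtain ⟨s, hs⟩ := exists_coe_eq x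
  change ‖D.circleTangent x.1 x.2.1‖ = 1
  rw [← hs]
  exact D.unit_speed _ _

theorem tangent_sq (x : D.PhaseSpace) : (D.tangent x).re ^ 2 + (D.tangent x).im ^ 2 = 1 :=
  sq_add_sq_of_norm_eq_one (norm_tangent x)

theorem norm_normal (x : D.PhaseSpace) : ‖D.normal x‖ = 1 := by
  simp [normal, norm_tangent]

theorem norm_vel (x : D.PhaseSpace) : ‖D.vel x‖ = 1 := by
  simp [vel, norm_normal, Complex.norm_exp_ofReal_mul_I]

theorem vel_ne_zero (x : D.PhaseSpace) : D.vel x ≠ 0 := by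
  rw [← norm_ne_zero_iff, norm_vel]; exact one_ne_zero

theorem vel_re (x : D.PhaseSpace) : (D.vel x).re =
    (D.tangent x).im * Real.cos (D.angle x) + (D.tangent x).re * Real.sin (D.angle x) := by
  simp [vel, normal, Complex.exp_mul_I, ← Complex.ofReal_cos, ← Complex.ofReal_sin]
  ring

theorem vel_im (x : D.PhaseSpace) : (D.vel x).im =
    (D.tangent x).im * Real.sin (D.angle x) - (D.tangent x).re * Real.cos (D.angle x) := by
  simp [vel, normal, Complex.exp_mul_I, ← Complex.ofReal_cos, ← Complex.ofReal_sin]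
  ring

theorem cross_tangent_vel (x : D.PhaseSpace) :
    cross (D.tangent x) (D.vel x) = -Real.cos (D.angle x) := by
  rw [cross_eq, vel_re, vel_im]
  linear_combination (-Real.cos (D.angle x)) * tangent_sq x

theorem cross_vel_tangent (x : D.PhaseSpace) :
    cross (D.vel x) (D.tangent x) = Real.cos (D.angle x) := by
  have := cross_tangent_vel x
  rw [cross_eq] at *
  linarith

theorem cos_angle_nonneg (x : D.PhaseSpace) : 0 ≤ Real.cos (D.angle x) :=
  Real.cos_nonneg_of_mem_Icc x.2.2.2

theorem mem_grazing_iff (x : D.PhaseSpace) : x ∈ D.grazing ↔ Real.cos (D.angle x) = 0 := by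
  have hx := x.2.2.2
  change |D.angle x| = Real.pi / 2 ↔ _
  change D.angle x ∈ _ at hx
  constructor
  · intro h
    rcases (abs_eq (by positivity)).mp h with h | h <;> simp [h]
  · intro h
    by_contra hne
    have h1 : |D.angle x| < Real.pi / 2 := lt_of_le_of_ne (abs_le.mpr hx) hne
    exact (Real.cos_pos_of_mem_Ioo (abs_lt.mp h1)).ne' h

theorem cos_angle_pos {x : D.PhaseSpace} (h : x ∉ D.grazing) : 0 < Real.cos (D.angle x) :=
  lt_of_le_of_ne (cos_angle_nonneg x) fun h0 => h ((mem_grazing_iff x).mpr h0.symm)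

/-- Time reversal on the phase space, `(s, φ) ↦ (s, -φ)`. -/
def rev (x : D.PhaseSpace) : D.PhaseSpace :=
  ⟨x.1, x.2.1, ⟨-x.2.2, by
    have := x.2.2.2
    constructor <;> linarith [this.1, this.2]⟩⟩

@[simp] theorem rev_rev (x : D.PhaseSpace) : rev (rev x) = x := by
  obtain ⟨l, θ, φ⟩ := x
  simp only [rev, neg_neg]
  rfl

@[simp] theorem tangent_rev (x : D.PhaseSpace) : D.tangent (rev x) = D.tangent x := rfl

@[simp] theorem angle_rev (x : D.PhaseSpace) : D.angle (rev x) = -D.angle x := rfl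

theorem rev_mem_grazing {x : D.PhaseSpace} : rev x ∈ D.grazing ↔ x ∈ D.grazing := by
  simp [mem_grazing_iff]

theorem continuous_rev : Continuous (rev : D.PhaseSpace → D.PhaseSpace) := by
  refine continuous_phaseSpace fun l => (continuous_mk l).comp ?_
  exact _root_.continuous_fst.prodMk (Continuous.subtype_mk
    (continuous_subtype_val.comp _root_.continuous_snd).neg _)

variable (D) in
/-- The incoming unit velocity of a collision: the outgoing velocity reflected in the tangent
line. -/
noncomputable def vin (x : D.PhaseSpace) : ℂ :=
  D.tangent x ^ 2 * (starRingEnd ℂ) (D.vel x)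

theorem vel_rev (x : D.PhaseSpace) : D.vel (rev x) = -D.vin x := by
  have h := tangent_sq x
  apply Complex.ext
  · rw [vel_re]
    simp only [vin, Complex.neg_re, Complex.mul_re, Complex.conj_re, Complex.conj_im,
      vel_re, vel_im, sq, angle_rev, tangent_rev, Real.cos_neg, Real.sin_neg, Complex.mul_im]
    linear_combination (-(D.tangent x).im * Real.cos (D.angle x) +
      (D.tangent x).re * Real.sin (D.angle x)) * h
  · rw [vel_im]
    simp only [vin, Complex.neg_im, Complex.mul_re, Complex.conj_re, Complex.conj_im,
      vel_re, vel_im, sq, angle_rev, tangent_rev, Real.cos_neg, Real.sin_neg, Complex.mul_im]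
    linear_combination ((D.tangent x).re * Real.cos (D.angle x) +
      (D.tangent x).im * Real.sin (D.angle x)) * h

theorem vin_rev (x : D.PhaseSpace) : D.vin (rev x) = -D.vel x := by
  have := vel_rev (rev x)
  rw [rev_rev] at this
  rw [this, neg_neg]

theorem norm_vin (x : D.PhaseSpace) : ‖D.vin x‖ = 1 := by
  simp [vin, norm_vel, norm_tangent]

theorem vin_mul_vel (x : D.PhaseSpace) : D.vin x * D.vel x = D.tangent x ^ 2 := by
  rw [vin, mul_assoc, mul_comm ((starRingEnd ℂ) (D.vel x)), Complex.mul_conj,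
    Complex.normSq_eq_norm_sq, norm_vel]
  simp

/-- The law of reflection for the outgoing velocity, in terms of the incoming velocity; reflection
in the tangent line is an involution. -/
theorem reflect_eq_iff (x : D.PhaseSpace) (w : ℂ) :
    D.vel x = w - ((2 * inner ℝ w (D.normal x) : ℝ) : ℂ) * D.normal x ↔ D.vin x = w := by
  have h := tangent_sq x
  have h1 : w - ((2 * inner ℝ w (D.normal x) : ℝ) : ℂ) * D.normal x =
      D.tangent x ^ 2 * (starRingEnd ℂ) w := by
    rw [Complex.inner]
    apply Complex.ext
    · simp only [normal, Complex.sub_re, Complex.mul_re, Complex.mul_im, Complex.conj_re,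
        Complex.conj_im, Complex.neg_re, Complex.neg_im, Complex.I_re, Complex.I_im, sq,
        Complex.ofReal_re, Complex.ofReal_im]
      linear_combination (-w.re) * h
    · simp only [normal, Complex.sub_im, Complex.mul_re, Complex.mul_im, Complex.conj_re,
        Complex.conj_im, Complex.neg_re, Complex.neg_im, Complex.I_re, Complex.I_im, sq,
        Complex.ofReal_re, Complex.ofReal_im]
      linear_combination (-w.im) * h
  have h2 : D.tangent x ^ 2 * (starRingEnd ℂ) (D.tangent x ^ 2) = 1 := by
    rw [Complex.mul_conj, Complex.normSq_eq_norm_sq, norm_pow, norm_tangent]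
    simp
  rw [h1, vin]
  constructor
  · intro h3
    rw [h3, map_mul, Complex.conj_conj, ← mul_assoc, h2, one_mul]
  · intro h3
    rw [← h3, map_mul, Complex.conj_conj, ← mul_assoc, h2, one_mul]

theorem cross_tangent_vin (x : D.PhaseSpace) :
    cross (D.tangent x) (D.vin x) = Real.cos (D.angle x) := by
  have := cross_tangent_vel (rev x)
  rw [vel_rev, tangent_rev, angle_rev, Real.cos_neg, cross_neg] at this
  linarith

/-- Every unit vector that does not point into the obstacle at `γ(θ)` is the outgoing velocity at
some angle. -/
theorem exists_vel_eq (l : Fin m) (θ : AddCircle (D.perimeter l)) {w : ℂ} (hw : ‖w‖ = 1)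
    (h : cross (D.circleTangent l θ) w ≤ 0) :
    ∃ φ, D.vel (⟨l, θ, φ⟩ : D.PhaseSpace) = w := by
  set t := D.circleTangent l θ with ht
  set n := -Complex.I * t with hn
  have hn1 : n * (starRingEnd ℂ) n = 1 := by
    have := norm_tangent (⟨l, θ, ⟨0, by constructor <;> linarith [Real.pi_pos]⟩⟩ : D.PhaseSpace)
    change ‖t‖ = 1 at this
    rw [Complex.mul_conj, Complex.normSq_eq_norm_sq, hn, norm_mul, norm_neg, Complex.norm_I, this]
    simp
  have hnn : ‖n‖ = 1 := by
    rw [Complex.mul_conj, Complex.normSq_eq_norm_sq] at hn1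
    have h1 : ‖n‖ ^ 2 = 1 := by exact_mod_cast hn1
    nlinarith [norm_nonneg n]
  have hre : 0 ≤ ((starRingEnd ℂ) n * w).re := by
    have : ((starRingEnd ℂ) n * w).re = -cross t w := by
      simp only [hn, cross_eq, Complex.mul_re, Complex.conj_re, Complex.conj_im, Complex.neg_re,
        Complex.neg_im, Complex.I_re, Complex.I_im, Complex.mul_im]
      ring
    linarith
  refine ⟨⟨((starRingEnd ℂ) n * w).arg, abs_le.mp (Complex.abs_arg_le_pi_div_two_iff.mpr hre)⟩, ?_⟩
  change n * Complex.exp (((starRingEnd ℂ) n * w).arg * Complex.I) = w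
  have h1 := Complex.norm_mul_exp_arg_mul_I ((starRingEnd ℂ) n * w)
  rw [norm_mul, Complex.norm_conj, hnn, hw] at h1
  simp only [mul_one, Complex.ofReal_one, one_mul] at h1
  rw [h1, ← mul_assoc, hn1, one_mul]

/-- A point of the phase space is determined by its obstacle, position and velocity. -/
theorem phaseSpace_ext {x y : D.PhaseSpace} (h : x.1 = y.1) (hpos : D.pos x = D.pos y)
    (hvel : D.vel x = D.vel y) : x = y := by
  obtain ⟨l, θ, φ⟩ := x
  obtain ⟨l', θ', φ'⟩ := y
  obtain rfl : l = l' := h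
  obtain rfl : θ = θ' := D.circleCurve_injective l hpos
  have h1 : Real.sin φ = Real.sin φ' := by
    have key : ∀ ψ, ((starRingEnd ℂ) (D.circleTangent l θ) *
        D.vel (⟨l, θ, ψ⟩ : D.PhaseSpace)).re = Real.sin ψ := by
      intro ψ
      have h2 := vel_re (⟨l, θ, ψ⟩ : D.PhaseSpace)
      have h3 := vel_im (⟨l, θ, ψ⟩ : D.PhaseSpace)
      have h4 := tangent_sq (⟨l, θ, ψ⟩ : D.PhaseSpace)
      rw [Complex.mul_re, h2, h3]
      simp only [Complex.conj_re, Complex.conj_im]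
      change (D.circleTangent l θ).re ^ 2 + (D.circleTangent l θ).im ^ 2 = 1 at h4
      change (D.circleTangent l θ).re * ((D.circleTangent l θ).im * Real.cos ψ +
        (D.circleTangent l θ).re * Real.sin ψ) - -(D.circleTangent l θ).im *
        ((D.circleTangent l θ).im * Real.sin ψ - (D.circleTangent l θ).re * Real.cos ψ) = _
      linear_combination Real.sin ψ * h4
    rw [← key φ, ← key φ', hvel]
  have h2 : φ = φ' := Subtype.ext (Real.injOn_sin φ.2 φ'.2 h1)
  rw [h2]

end PhaseSpace

section Topology

variable [hr : Fact (2 ≤ r)]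

@[fun_prop]
theorem continuous_pos : Continuous D.pos :=
  continuous_phaseSpace fun l => (D.continuous_circleCurve l).comp _root_.continuous_fst

@[fun_prop]
theorem continuous_tangent : Continuous D.tangent :=
  continuous_phaseSpace fun l => (D.continuous_circleTangent l).comp _root_.continuous_fst

omit hr in
@[fun_prop]
theorem continuous_angle : Continuous D.angle :=
  continuous_phaseSpace fun _ => continuous_subtype_val.comp _root_.continuous_snd

@[fun_prop]
theorem continuous_vel : Continuous D.vel := by
  unfold vel normal; fun_prop

@[fun_prop]
theorem continuous_vin : Continuous D.vin := by
  unfold vin; fun_prop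

/-- The obstacle, the position and the velocity determine the topology of the phase space. -/
theorem isInducing_phaseSpace :
    IsInducing fun x : D.PhaseSpace => (x.1, D.pos x, D.vel x) := by
  refine (Continuous.isClosedEmbedding ?_ ?_).isInducing
  · exact continuous_fst.prodMk (by fun_prop)
  · intro x y h
    simp only [Prod.mk.injEq] at h
    exact phaseSpace_ext h.1 h.2.1 h.2.2

variable {D}

theorem cross_tangent_pos_of_mem_closure (x : D.PhaseSpace) {z : ℂ}
    (hz : z ∈ closure (D.obstacle x.1)) (hne : z ≠ D.pos x) :
    0 < cross (D.tangent x) (z - D.pos x) := by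
  obtain ⟨s, hs⟩ := exists_coe_eq x
  have h1 : D.pos x = D.curve x.1 s := by
    change D.circleCurve x.1 x.2.1 = _
    rw [← hs]; rfl
  have h2 : D.tangent x = deriv (D.curve x.1) s := by
    change D.circleTangent x.1 x.2.1 = _
    rw [← hs]; rfl
  rw [h1] at hne
  rw [h1, h2]
  exact D.cross_pos_of_mem_closure x.1 s hz hne

theorem eventually_pos_add_mem_obstacle (x : D.PhaseSpace) {d : ℂ}
    (hd : 0 < cross (D.tangent x) d) :
    ∀ᶠ u : ℝ in 𝓝[>] 0, D.pos x + u * d ∈ D.obstacle x.1 := by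
  obtain ⟨s, hs⟩ := exists_coe_eq x
  have h1 : D.pos x = D.curve x.1 s := by
    change D.circleCurve x.1 x.2.1 = _
    rw [← hs]; rfl
  have h2 : D.tangent x = deriv (D.curve x.1) s := by
    change D.circleTangent x.1 x.2.1 = _
    rw [← hs]; rfl
  rw [h2] at hd
  rw [h1]
  exact D.eventually_mem_obstacle x.1 s hd

/-- On an obstacle the tangent vector determines the point. -/
theorem pos_eq_of_tangent_eq {x y : D.PhaseSpace} (h : x.1 = y.1)
    (ht : D.tangent x = D.tangent y) : D.pos x = D.pos y := by
  by_contra hne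
  have h1 := cross_tangent_pos_of_mem_closure x (h ▸ frontier_subset_closure (pos_mem_frontier y))
    (Ne.symm hne)
  have h2 := cross_tangent_pos_of_mem_closure y
    (h ▸ frontier_subset_closure (pos_mem_frontier x)) hne
  rw [ht, ← neg_sub, cross_neg] at h1
  linarith

end Topology

end Table

/-! ### The lifted table -/

@[simp] theorem latticeVec_re (n : ℤ × ℤ) : (latticeVec n).re = n.1 := by simp [latticeVec]

@[simp] theorem latticeVec_im (n : ℤ × ℤ) : (latticeVec n).im = n.2 := by simp [latticeVec]

theorem latticeVec_add (n k : ℤ × ℤ) : latticeVec (n + k) = latticeVec n + latticeVec k := by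
  simp [latticeVec]; ring

@[simp] theorem latticeVec_zero : latticeVec 0 = 0 := by simp [latticeVec]

theorem finite_latticeVec_norm_le (R : ℝ) : {n : ℤ × ℤ | ‖latticeVec n‖ ≤ R}.Finite := by
  refine ((finite_Icc (-⌈R⌉) ⌈R⌉).prod (finite_Icc (-⌈R⌉) ⌈R⌉)).subset fun n hn => ?_
  have h1 : |(n.1 : ℝ)| ≤ R := by
    rw [← latticeVec_re]; exact (Complex.abs_re_le_norm _).trans hn
  have h2 : |(n.2 : ℝ)| ≤ R := by
    rw [← latticeVec_im]; exact (Complex.abs_im_le_norm _).trans hn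
  have key : ∀ k : ℤ, |(k : ℝ)| ≤ R → k ∈ Icc (-⌈R⌉) ⌈R⌉ := by
    intro k hk
    have : |(k : ℝ)| ≤ (⌈R⌉ : ℝ) := hk.trans (Int.le_ceil R)
    rw [mem_Icc, ← abs_le]
    exact_mod_cast this
  exact ⟨key _ h1, key _ h2⟩

namespace Table

variable {r m : ℕ} (D : Table r m)

/-- The closed scatterer of the lifted table with label `a`. -/
def closedObstacle (a : Alphabet m) : Set ℂ :=
  {z | z - latticeVec a.1 ∈ closure (D.obstacle a.2)}

variable {D}

theorem mem_scatterer {a : Alphabet m} {z : ℂ} :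
    z ∈ D.scatterer a ↔ z - latticeVec a.1 ∈ frontier (D.obstacle a.2) := by
  constructor
  · rintro ⟨w, hw, rfl⟩
    simpa using hw
  · intro h
    exact ⟨_, h, by simp⟩

theorem scatterer_subset (a : Alphabet m) : D.scatterer a ⊆ D.closedObstacle a := fun _ hz =>
  frontier_subset_closure (mem_scatterer.mp hz)

theorem eq_of_mem_closedObstacle {a b : Alphabet m} {z : ℂ} (ha : z ∈ D.closedObstacle a)
    (hb : z ∈ D.closedObstacle b) : a = b := by
  by_contra hne
  have := D.disjoint_obstacles a.1 b.1 a.2 b.2 hne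
  exact this.notMem_of_mem_left (a := z) ⟨z - latticeVec a.1, ha, by simp⟩
    ⟨z - latticeVec b.1, hb, by simp⟩

theorem mem_scatterer_add {a : Alphabet m} {k : ℤ × ℤ} {z : ℂ} :
    latticeVec k + z ∈ D.scatterer (k + a.1, a.2) ↔ z ∈ D.scatterer a := by
  rw [mem_scatterer, mem_scatterer, latticeVec_add]
  congr! 1
  ring

/-- The label of the current scatterer of a lifted state. -/
def label (p : D.LiftedState) : Alphabet m := (p.1, p.2.1)

theorem liftedPos_mem (p : D.LiftedState) : D.liftedPos p ∈ D.scatterer (label p) := by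
  rw [mem_scatterer]
  simpa [liftedPos, label] using pos_mem_frontier p.2

theorem liftedPos_mem_closedObstacle (p : D.LiftedState) :
    D.liftedPos p ∈ D.closedObstacle (label p) := scatterer_subset _ (liftedPos_mem p)

theorem liftedPos_mem_iff {p : D.LiftedState} {a : Alphabet m} :
    D.liftedPos p ∈ D.scatterer a ↔ a = label p := by
  constructor
  · intro h
    exact eq_of_mem_closedObstacle (scatterer_subset _ h) (liftedPos_mem_closedObstacle p)
  · rintro rfl
    exact liftedPos_mem p

section Scatterers

variable [hr : Fact (2 ≤ r)]

theorem exists_norm_pos_le : ∃ R : ℝ, ∀ x : D.PhaseSpace, ‖D.pos x‖ ≤ R := by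
  obtain ⟨R, hR⟩ := (isCompact_range (continuous_pos D)).isBounded.exists_norm_le
  exact ⟨R, fun x => hR _ ⟨x, rfl⟩⟩

omit hr in
theorem exists_phase_of_mem_scatterer {a : Alphabet m} {z : ℂ} (hz : z ∈ D.scatterer a) :
    ∃ x : D.PhaseSpace, x.1 = a.2 ∧ z = latticeVec a.1 + D.pos x := by
  rw [mem_scatterer, ← D.range_circleCurve] at hz
  obtain ⟨θ, hθ⟩ := hz
  refine ⟨⟨a.2, θ, ⟨0, by constructor <;> linarith [Real.pi_pos]⟩⟩, rfl, ?_⟩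
  change z = latticeVec a.1 + D.circleCurve a.2 θ
  rw [hθ]; ring

variable (D) in
theorem finite_scatterer_meets_ball (R : ℝ) :
    {a : Alphabet m | ∃ z ∈ D.scatterer a, ‖z‖ ≤ R}.Finite := by
  obtain ⟨R', hR'⟩ := exists_norm_pos_le (D := D)
  refine ((finite_latticeVec_norm_le (R + R')).prod (toFinite univ)).subset ?_
  rintro a ⟨z, hz, hzR⟩
  refine ⟨?_, mem_univ _⟩
  obtain ⟨x, -, rfl⟩ := exists_phase_of_mem_scatterer hz
  change ‖latticeVec a.1‖ ≤ R + R'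
  have := norm_sub_le (latticeVec a.1 + D.pos x) (D.pos x)
  rw [add_sub_cancel_right] at this
  linarith [hR' x]

omit hr in
theorem isClosed_scatterer (a : Alphabet m) : IsClosed (D.scatterer a) := by
  have : D.scatterer a = (fun z => z - latticeVec a.1) ⁻¹' frontier (D.obstacle a.2) := by
    ext z; exact mem_scatterer
  rw [this]
  exact isClosed_frontier.preimage (by fun_prop)

theorem isCompact_scatterer (a : Alphabet m) : IsCompact (D.scatterer a) := by
  have h : IsCompact (frontier (D.obstacle a.2)) := by
    rw [← D.range_circleCurve]
    exact isCompact_range (D.continuous_circleCurve _)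
  exact h.image (by fun_prop)

theorem isClosed_iUnion_scatterer (A : Set (Alphabet m)) :
    IsClosed (⋃ a : A, D.scatterer a) := by
  have h : LocallyFinite fun a : Alphabet m => D.scatterer a := by
    intro z
    refine ⟨Metric.ball z 1, Metric.ball_mem_nhds z one_pos, ?_⟩
    refine (finite_scatterer_meets_ball D (‖z‖ + 1)).subset ?_
    rintro a ⟨w, hw, hwz⟩
    refine ⟨w, hw, ?_⟩
    have := norm_sub_norm_le w z
    rw [Metric.mem_ball, dist_eq_norm] at hwz
    linarith
  exact (h.comp_injective Subtype.val_injective).isClosed_iUnion fun a => isClosed_scatterer _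

variable (D) in
/-- Distinct scatterers have a uniformly positive distance. -/
theorem exists_gap : ∃ δ : ℝ, 0 < δ ∧ ∀ a b : Alphabet m, a ≠ b →
    ∀ z ∈ D.scatterer a, ∀ w ∈ D.scatterer b, δ ≤ ‖z - w‖ := by
  have h : ∀ l : Fin m, ∀ᶠ δ : ℝ in 𝓝[>] 0, ∀ b : Alphabet m, ((0 : ℤ × ℤ), l) ≠ b →
      ∀ z ∈ D.scatterer (0, l), ∀ w ∈ D.scatterer b, δ ≤ ‖z - w‖ := by
    intro l
    have hdisj : Disjoint (D.scatterer (0, l)) (⋃ b : {b | ((0 : ℤ × ℤ), l) ≠ b},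
        D.scatterer b) := by
      rw [Set.disjoint_left]
      intro z hz hz'
      obtain ⟨b, hb⟩ := mem_iUnion.mp hz'
      exact b.2 (eq_of_mem_closedObstacle (scatterer_subset _ hz) (scatterer_subset _ hb))
    obtain ⟨ρ, hρ, h⟩ := Metric.exists_pos_forall_lt_edist (isCompact_scatterer (D := D) (0, l))
      (isClosed_iUnion_scatterer _) hdisj
    filter_upwards [Ioo_mem_nhdsGT (NNReal.coe_pos.mpr hρ)] with δ hδ b hb z hz w hw
    have := h z hz w (mem_iUnion.mpr ⟨⟨b, hb⟩, hw⟩)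
    rw [edist_nndist, ENNReal.coe_lt_coe] at this
    rw [← dist_eq_norm, ← coe_nndist]
    exact hδ.2.le.trans (NNReal.coe_lt_coe.mpr this).le
  obtain ⟨δ, hδ, hδ0⟩ := ((eventually_all.mpr h).and self_mem_nhdsWithin).exists
  refine ⟨δ, hδ0, fun a b hab z hz w hw => ?_⟩
  have hz' : -latticeVec a.1 + z ∈ D.scatterer (0, a.2) := by
    rw [← mem_scatterer_add (k := a.1)]; simpa using hz
  have hw' : -latticeVec a.1 + w ∈ D.scatterer (b.1 - a.1, b.2) := by
    rw [← mem_scatterer_add (k := a.1)]; simpa using hw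
  have := hδ a.2 _ (fun h => hab ?_) _ hz' _ hw'
  · simpa using this
  · rw [Prod.ext_iff] at h
    exact Prod.ext (sub_eq_zero.mp h.1.symm).symm h.2

/-! ### The next collision -/

/-- Outgoing rays do not return to their obstacle. -/
theorem ray_notMem_closedObstacle (p : D.LiftedState) {u : ℝ} (hu : 0 < u) :
    D.liftedPos p + u * D.vel p.2 ∉ D.closedObstacle (label p) := by
  intro h
  have h1 : D.pos p.2 + u * D.vel p.2 ∈ closure (D.obstacle p.2.1) := by
    have h2 : D.liftedPos p + u * D.vel p.2 - latticeVec p.1 ∈ closure (D.obstacle p.2.1) := h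
    convert h2 using 1
    simp only [liftedPos]; ring
  have hu' : (u : ℂ) ≠ 0 := by exact_mod_cast hu.ne'
  have h2 := cross_tangent_pos_of_mem_closure p.2 h1 (by
    rw [Ne, add_eq_left]
    exact mul_ne_zero hu' (vel_ne_zero p.2))
  rw [add_sub_cancel_left, cross_real_mul, cross_tangent_vel] at h2
  nlinarith [cos_angle_nonneg p.2]

omit hr in
theorem nextCollision_iff {p q : D.LiftedState} : D.NextCollision p q ↔
    (∃ t : ℝ, 0 < t ∧ D.liftedPos p + t * D.vel p.2 = D.liftedPos q ∧
      ∀ u : ℝ, 0 < u → u < t → ∀ a : Alphabet m,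
        D.liftedPos p + u * D.vel p.2 ∉ D.scatterer a) ∧ D.vin q.2 = D.vel p.2 := by
  rw [NextCollision, reflect_eq_iff]

/-- Under finite horizon a next collision exists; it is the first time at which the ray meets a
scatterer other than the current one. -/
theorem exists_nextCollision {T : ℝ} (hT : ∀ x : D.PhaseSpace, ∃ t : ℝ, 0 < t ∧ t ≤ T ∧
    ∃ a : Alphabet m, D.pos x + t * D.vel x ∈ D.scatterer a) (p : D.LiftedState) :
    ∃ q, D.NextCollision p q ∧ ‖D.liftedPos q - D.liftedPos p‖ ≤ T := by
  set v := D.vel p.2 with hv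
  set U := ⋃ b : {b | b ≠ label p}, D.scatterer b with hU
  set S := {u : ℝ | 0 ≤ u ∧ D.liftedPos p + u * v ∈ U} with hS
  have hSclosed : IsClosed S := by
    refine (isClosed_le continuous_const continuous_id).inter ?_
    exact (isClosed_iUnion_scatterer _).preimage
      (by fun_prop : Continuous fun u : ℝ => D.liftedPos p + u * v)
  have hSmem : ∀ u : ℝ, 0 < u → ∀ a, D.liftedPos p + u * v ∈ D.scatterer a → u ∈ S := by
    intro u hu a ha
    refine ⟨hu.le, mem_iUnion.mpr ⟨⟨a, fun h => ?_⟩, ha⟩⟩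
    exact ray_notMem_closedObstacle p hu (h ▸ scatterer_subset _ ha)
  obtain ⟨t₀, ht₀, ht₀T, a₀, ha₀⟩ := hT p.2
  have ht₀S : t₀ ∈ S := by
    refine hSmem t₀ ht₀ (p.1 + a₀.1, a₀.2) ?_
    rw [liftedPos, add_assoc, mem_scatterer_add]
    exact ha₀
  have hSbdd : BddBelow S := ⟨0, fun u hu => hu.1⟩
  obtain ⟨ht, htU⟩ := hSclosed.csInf_mem ⟨_, ht₀S⟩ hSbdd
  set t := sInf S
  obtain ⟨⟨b, hb⟩, hbt⟩ := mem_iUnion.mp htU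
  simp only at hbt
  have hpb : D.liftedPos p ∉ D.closedObstacle b := fun h =>
    hb (eq_of_mem_closedObstacle h (liftedPos_mem_closedObstacle p))
  have ht0 : 0 < t := by
    refine lt_of_le_of_ne ht fun h => hpb ?_
    rw [← h] at hbt
    simpa using scatterer_subset _ hbt
  have hfree : ∀ u : ℝ, 0 < u → u < t → ∀ a : Alphabet m,
      D.liftedPos p + u * v ∉ D.scatterer a := fun u hu hut a ha =>
    absurd (csInf_le hSbdd (hSmem u hu a ha)) (not_le.mpr hut)
  have hz := mem_scatterer.mp hbt
  rw [← D.range_circleCurve] at hz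
  obtain ⟨θ, hθ⟩ := hz
  obtain ⟨s, rfl⟩ := QuotientAddGroup.mk_surjective θ
  set θ : AddCircle (D.perimeter b.2) := (s : AddCircle (D.perimeter b.2))
  set W := D.circleTangent b.2 θ with hW
  -- otherwise the particle would have crossed the obstacle before
  have hin : 0 ≤ cross W v := by
    by_contra! hneg
    have h1 := D.eventually_mem_obstacle b.2 s (d := -v) (by
      rw [cross_neg]; change 0 < -cross W v; linarith)
    obtain ⟨u, hu, hu0⟩ := (h1.and (Ioo_mem_nhdsGT ht0)).exists
    have hmem : D.liftedPos p - latticeVec b.1 + ((t - u : ℝ) : ℂ) * v ∈ D.obstacle b.2 := by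
      have h2 : D.curve b.2 s = D.liftedPos p + t * v - latticeVec b.1 := hθ
      rw [h2] at hu
      convert hu using 1
      push_cast; ring
    obtain ⟨u', hu'0, hu't, hu'⟩ := exists_mem_frontier_of_segment (D.isOpen_obstacle b.2)
      (sub_nonneg.mpr hu0.2.le) (fun h => hpb (subset_closure h)) hmem
    have hu'' : D.liftedPos p + u' * v ∈ D.scatterer b := by
      rw [mem_scatterer]; convert hu' using 1; ring
    rcases hu'0.eq_or_lt with h | h
    · rw [← h] at hu''
      exact hpb (by simpa using scatterer_subset _ hu'')
    · exact hfree u' h (by linarith [hu0.1]) b hu''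
  have hW1 : W * (starRingEnd ℂ) W = 1 := by
    have : ‖W‖ = 1 := D.unit_speed _ _
    rw [Complex.mul_conj, Complex.normSq_eq_norm_sq, this]; simp
  have hWn : ‖W‖ = 1 := D.unit_speed _ _
  obtain ⟨φ, hφ⟩ := exists_vel_eq (D := D) b.2 θ (w := W ^ 2 * (starRingEnd ℂ) v)
    (by rw [norm_mul, norm_pow, hWn, Complex.norm_conj, hv, norm_vel]; simp) (by
      have : cross W (W ^ 2 * (starRingEnd ℂ) v) = -cross W v := by
        have h1 : (starRingEnd ℂ) W * (W ^ 2 * (starRingEnd ℂ) v) = W * (starRingEnd ℂ) v := by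
          linear_combination W * (starRingEnd ℂ) v * hW1
        rw [cross, h1, cross_eq]
        simp; ring
      change cross W _ ≤ 0
      linarith)
  refine ⟨(b.1, ⟨b.2, θ, φ⟩), nextCollision_iff.mpr ⟨⟨t, ht0, ?_, hfree⟩, ?_⟩, ?_⟩
  · change _ = latticeVec b.1 + D.circleCurve b.2 θ
    rw [hθ]; ring
  · change W ^ 2 * (starRingEnd ℂ) (D.vel _) = v
    rw [hφ, map_mul, map_pow, Complex.conj_conj]
    linear_combination (W * (starRingEnd ℂ) W + 1) * v * hW1
  · change ‖latticeVec b.1 + D.circleCurve b.2 θ - _‖ ≤ T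
    rw [hθ, show latticeVec b.1 + (D.liftedPos p + t * v - latticeVec b.1) - D.liftedPos p = t * v
      by ring, norm_mul, hv, norm_vel, mul_one, Complex.norm_real, Real.norm_of_nonneg ht]
    exact (csInf_le hSbdd ht₀S).trans ht₀T

omit hr in
theorem NextCollision.unique {p q q' : D.LiftedState} (h : D.NextCollision p q)
    (h' : D.NextCollision p q') : q = q' := by
  obtain ⟨⟨t, ht, hpos, hfree⟩, hvin⟩ := nextCollision_iff.mp h
  obtain ⟨⟨t', ht', hpos', hfree'⟩, hvin'⟩ := nextCollision_iff.mp h'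
  have htt : t = t' := by
    rcases lt_trichotomy t t' with hlt | heq | hlt
    · exact absurd (hpos ▸ liftedPos_mem q) (hfree' t ht hlt _)
    · exact heq
    · exact absurd (hpos' ▸ liftedPos_mem q') (hfree t' ht' hlt _)
  have hq : D.liftedPos q = D.liftedPos q' := by rw [← hpos, ← hpos', htt]
  have hl : label q = label q' := liftedPos_mem_iff.mp (hq ▸ liftedPos_mem q)
  obtain ⟨k, x⟩ := q
  obtain ⟨k', x'⟩ := q'
  simp only [label, Prod.mk.injEq] at hl
  obtain ⟨rfl, hx⟩ := hl
  have hpos : D.pos x = D.pos x' := by simpa [liftedPos] using hq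
  have : rev x = rev x' := phaseSpace_ext hx hpos (by rw [vel_rev, vel_rev, hvin, hvin'])
  rw [← rev_rev x, this, rev_rev]

/-- Time reversal on the lifted states. -/
def revLifted (p : D.LiftedState) : D.LiftedState := (p.1, rev p.2)

omit hr in
@[simp] theorem revLifted_revLifted (p : D.LiftedState) : revLifted (revLifted p) = p := by
  simp [revLifted]

omit hr in
@[simp] theorem label_revLifted (p : D.LiftedState) : label (revLifted p) = label p := rfl

omit hr in
/-- Billiard trajectories are reversible. -/
theorem NextCollision.reverse {p q : D.LiftedState} (h : D.NextCollision p q) :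
    D.NextCollision (revLifted q) (revLifted p) := by
  obtain ⟨⟨t, ht, hpos, hfree⟩, hvin⟩ := nextCollision_iff.mp h
  have hp : ∀ p : D.LiftedState, D.liftedPos (revLifted p) = D.liftedPos p := fun _ => rfl
  have hv : D.vel (revLifted q).2 = -D.vel p.2 := by
    rw [← hvin]; exact vel_rev q.2
  refine nextCollision_iff.mpr ⟨⟨t, ht, ?_, fun u hu hut a ha => ?_⟩, ?_⟩
  · rw [hp, hp, hv, ← hpos]; ring
  · refine hfree (t - u) (by linarith) (by linarith) a ?_
    convert ha using 1
    rw [hp, hv, ← hpos]; push_cast; ring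
  · rw [hv]; exact vin_rev p.2

/-- The translation of a lifted state by a lattice vector. -/
def translate (k : ℤ × ℤ) (p : D.LiftedState) : D.LiftedState := (k + p.1, p.2)

omit hr in
theorem liftedPos_translate (k : ℤ × ℤ) (p : D.LiftedState) :
    D.liftedPos (translate k p) = latticeVec k + D.liftedPos p := by
  simp [liftedPos, translate, latticeVec_add, add_assoc]

omit hr in
theorem NextCollision.translate {p q : D.LiftedState} (h : D.NextCollision p q) (k : ℤ × ℤ) :
    D.NextCollision (translate k p) (Table.translate k q) := by
  obtain ⟨⟨t, ht, hpos, hfree⟩, hvin⟩ := nextCollision_iff.mp h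
  refine nextCollision_iff.mpr ⟨⟨t, ht, ?_, fun u hu hut a ha => ?_⟩, hvin⟩
  · rw [liftedPos_translate, liftedPos_translate, ← hpos]
    simp only [Table.translate]; ring
  · refine hfree u hu hut (a.1 - k, a.2) ?_
    rw [← mem_scatterer_add (k := k)]
    rw [liftedPos_translate, add_assoc] at ha
    change _ ∈ D.scatterer (k + (a.1 - k), a.2)
    rwa [add_sub_cancel]

omit hr in
theorem NextCollision.exists_flight {p q : D.LiftedState} (h : D.NextCollision p q) :
    D.liftedPos q = D.liftedPos p + ‖D.liftedPos q - D.liftedPos p‖ * D.vel p.2 ∧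
      ∀ u : ℝ, 0 < u → u < ‖D.liftedPos q - D.liftedPos p‖ → ∀ a : Alphabet m,
        D.liftedPos p + u * D.vel p.2 ∉ D.scatterer a := by
  obtain ⟨⟨t, ht, hpos, hfree⟩, hvin⟩ := nextCollision_iff.mp h
  have : ‖D.liftedPos q - D.liftedPos p‖ = t := by
    rw [← hpos, add_sub_cancel_left, norm_mul, norm_vel, mul_one, Complex.norm_real,
      Real.norm_of_nonneg ht.le]
  rw [this]
  exact ⟨hpos.symm, hfree⟩

theorem NextCollision.label_ne {p q : D.LiftedState} (h : D.NextCollision p q) :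
    label p ≠ label q := by
  obtain ⟨⟨t, ht, hpos, hfree⟩, hvin⟩ := nextCollision_iff.mp h
  intro heq
  apply ray_notMem_closedObstacle p ht
  rw [hpos, heq]
  exact liftedPos_mem_closedObstacle q

end Scatterers

/-! ### The billiard map and the coding map -/

section Dynamics

variable [hr : Fact (2 ≤ r)] [hD : Fact D.FiniteHorizon]

theorem exists_next (p : D.LiftedState) : ∃ q, D.NextCollision p q := by
  obtain ⟨T, hT⟩ := hD.out
  obtain ⟨q, hq, -⟩ := exists_nextCollision hT p
  exact ⟨q, hq⟩

/-- The billiard map of the lifted table. -/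
noncomputable def next (p : D.LiftedState) : D.LiftedState := (exists_next p).choose

theorem nextCollision_next (p : D.LiftedState) : D.NextCollision p (next p) :=
  (exists_next p).choose_spec

theorem nextCollision_iff_next {p q : D.LiftedState} : D.NextCollision p q ↔ next p = q :=
  ⟨fun h => (nextCollision_next p).unique h, fun h => h ▸ nextCollision_next p⟩

variable (D) in
theorem exists_flight_le :
    ∃ T : ℝ, 0 < T ∧ (∀ x : D.PhaseSpace, ∃ t : ℝ, 0 < t ∧ t ≤ T ∧
      ∃ a : Alphabet m, D.pos x + t * D.vel x ∈ D.scatterer a) ∧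
      ∀ p : D.LiftedState, ‖D.liftedPos (next p) - D.liftedPos p‖ ≤ T := by
  obtain ⟨T, hT⟩ := hD.out
  refine ⟨max T 1, by positivity, fun x => ?_, fun p => ?_⟩
  · obtain ⟨t, h1, h2, h3⟩ := hT x
    exact ⟨t, h1, h2.trans (le_max_left _ _), h3⟩
  · obtain ⟨q, hq, h⟩ := exists_nextCollision hT p
    rw [nextCollision_iff_next.mp hq]
    exact h.trans (le_max_left _ _)

theorem next_revLifted_next (p : D.LiftedState) : next (revLifted (next p)) = revLifted p :=
  nextCollision_iff_next.mp (nextCollision_next p).reverse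

theorem next_translate (k : ℤ × ℤ) (p : D.LiftedState) :
    next (translate k p) = translate k (next p) :=
  nextCollision_iff_next.mp ((nextCollision_next p).translate k)

variable (D) in
/-- The billiard map of the lifted table as a permutation; its inverse is its conjugate by time
reversal. -/
noncomputable def nextPerm : Equiv.Perm D.LiftedState where
  toFun := next
  invFun p := revLifted (next (revLifted p))
  left_inv p := by
    change revLifted (next (revLifted (next p))) = p
    rw [next_revLifted_next, revLifted_revLifted]
  right_inv p := by rw [next_revLifted_next, revLifted_revLifted]

theorem nextPerm_zpow_neg (i : ℤ) (p : D.LiftedState) :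
    (nextPerm D ^ (-i)) p = revLifted ((nextPerm D ^ i) (revLifted p)) := by
  have hs : ∀ p, revLifted (nextPerm D p) = (nextPerm D)⁻¹ (revLifted p) := fun p => by
    change _ = revLifted (next (revLifted (revLifted p)))
    rw [revLifted_revLifted]; rfl
  have hs' : ∀ p, revLifted ((nextPerm D)⁻¹ p) = nextPerm D (revLifted p) := fun p => by
    change revLifted (revLifted (next (revLifted p))) = _
    rw [revLifted_revLifted]; rfl
  have key : ∀ i : ℤ, ∀ p, revLifted ((nextPerm D ^ i) p) = (nextPerm D ^ (-i)) (revLifted p) := by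
    intro i
    induction i using Int.induction_on with
    | zero => intro p; simp
    | succ n ih =>
      intro p
      rw [zpow_add_one, Equiv.Perm.mul_apply, ih, hs, neg_add, zpow_add, zpow_neg_one,
        Equiv.Perm.mul_apply]
    | pred n ih =>
      intro p
      rw [zpow_sub_one, Equiv.Perm.mul_apply, ih, hs', neg_sub, sub_eq_add_neg, add_comm, zpow_add,
        zpow_one, Equiv.Perm.mul_apply]
  rw [key, revLifted_revLifted]

variable (D) in
/-- The two-sided trajectory in the lifted table through a point of the phase space. -/
noncomputable def traj (x : D.PhaseSpace) (i : ℤ) : D.LiftedState := (nextPerm D ^ i) (0, x)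

@[simp] theorem traj_zero (x : D.PhaseSpace) : D.traj x 0 = (0, x) := rfl

theorem traj_add_one (x : D.PhaseSpace) (i : ℤ) : D.traj x (i + 1) = next (D.traj x i) := by
  rw [traj, add_comm, zpow_add, zpow_one]; rfl

theorem traj_neg (x : D.PhaseSpace) (i : ℤ) : D.traj x (-i) = revLifted (D.traj (rev x) i) :=
  nextPerm_zpow_neg i (0, x)

theorem nextPerm_zpow_translate (k : ℤ × ℤ) (i : ℤ) (p : D.LiftedState) :
    (nextPerm D ^ i) (translate k p) = translate k ((nextPerm D ^ i) p) := by
  have h : ∀ n : ℕ, ∀ p : D.LiftedState, (nextPerm D ^ n) (translate k p) =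
      translate k ((nextPerm D ^ n) p) := by
    intro n
    induction n with
    | zero => intro p; rfl
    | succ n ih =>
      intro p
      rw [pow_succ, Equiv.Perm.mul_apply, Equiv.Perm.mul_apply, ← ih]
      congr 1
      exact next_translate k p
  obtain ⟨n, rfl | rfl⟩ := i.eq_nat_or_neg
  · simpa using h n p
  · rw [nextPerm_zpow_neg, nextPerm_zpow_neg, zpow_natCast]
    rw [show revLifted (translate k p) = translate k (revLifted p) from rfl, h]
    rfl

/-- Trajectories from a later starting point. -/
theorem traj_traj (x : D.PhaseSpace) (i j : ℤ) :
    D.traj x (i + j) = translate (D.traj x i).1 (D.traj (D.traj x i).2 j) := by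
  have h : D.traj x i = translate (D.traj x i).1 (0, (D.traj x i).2) := by
    simp [translate]
  rw [traj, add_comm, zpow_add, Equiv.Perm.mul_apply]
  change (nextPerm D ^ j) (D.traj x i) = _
  conv_lhs => rw [h]
  rw [nextPerm_zpow_translate]; rfl

theorem nextCollision_traj (x : D.PhaseSpace) (i : ℤ) :
    D.NextCollision (D.traj x i) (D.traj x (i + 1)) :=
  nextCollision_iff_next.mpr (traj_add_one x i).symm

variable (D) in
/-- The sequence of labels of the scatterers met by the trajectory through `x`. -/
noncomputable def itinerary (x : D.PhaseSpace) : Seq m := fun i => label (D.traj x i)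

/-- The two-sided trajectory through `x`, hence also its coding, is unique. -/
theorem isCoding_iff {x : D.PhaseSpace} {a : Seq m} :
    D.IsCoding x a ↔ a = D.itinerary x := by
  constructor
  · rintro ⟨z, hz0, hz, ha⟩
    have hzt : ∀ i, z i = D.traj x i := by
      intro i
      induction i using Int.induction_on with
      | zero => exact hz0
      | succ n ih =>
        rw [traj_add_one, ← ih, nextCollision_iff_next.mp (hz _)]
      | pred n ih =>
        have h1 := nextCollision_iff_next.mp (hz (-n - 1))
        have h2 := traj_add_one x (-n - 1)
        rw [sub_add_cancel] at h1 h2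
        exact (nextPerm D).injective (show next _ = next _ by rw [h1, ← h2, ih])
    funext i
    rw [itinerary, ← hzt]
    exact liftedPos_mem_iff.mp (ha i)
  · rintro rfl
    exact ⟨D.traj x, rfl, nextCollision_traj x, fun i => liftedPos_mem _⟩

theorem coding_eq (x : D.PhaseSpace) : D.coding x = D.itinerary x := by
  have h : ∃ a : Seq m, D.IsCoding x a := ⟨_, isCoding_iff.mpr rfl⟩
  have h' : D.coding x = h.choose := dif_pos h
  rw [h']
  exact isCoding_iff.mp h.choose_spec

theorem coding_apply (x : D.PhaseSpace) (i : ℤ) : D.coding x i = label (D.traj x i) := by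
  rw [coding_eq]; rfl

theorem coding_eq_iff (x : D.PhaseSpace) (a : Seq m) : D.coding x = a ↔ D.IsCoding x a := by
  rw [isCoding_iff, coding_eq, eq_comm]

theorem billiardMap_eq (x : D.PhaseSpace) : D.billiardMap x = (next (0, x) : D.LiftedState).2 := by
  have h : ∃ y : D.PhaseSpace, ∃ k : ℤ × ℤ, D.NextCollision (0, x) (k, y) :=
    ⟨(next (0, x)).2, (next (0, x)).1, nextCollision_next _⟩
  rw [billiardMap, dif_pos h]
  obtain ⟨k, hk⟩ := h.choose_spec
  rw [nextCollision_iff_next.mp hk]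

theorem billiardMap_eq_iff (x y : D.PhaseSpace) :
    D.billiardMap x = y ↔ ∃ k : ℤ × ℤ, D.NextCollision (0, x) (k, y) := by
  rw [billiardMap_eq]
  constructor
  · rintro rfl
    exact ⟨(next (0, x)).1, nextCollision_next _⟩
  · rintro ⟨k, hk⟩
    rw [nextCollision_iff_next.mp hk]

theorem billiardMap_snd (p : D.LiftedState) : D.billiardMap p.2 = (next p).2 := by
  have h : p = translate p.1 (0, p.2) := by simp [translate]
  rw [billiardMap_eq]
  conv_rhs => rw [h, next_translate]
  rfl

theorem billiardMap_traj (x : D.PhaseSpace) (i : ℤ) :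
    D.billiardMap (D.traj x i).2 = (D.traj x (i + 1)).2 := by
  rw [billiardMap_snd, traj_add_one]

/-- The billiard map is invertible because trajectories are reversible. -/
theorem billiardMap_bijective : Function.Bijective D.billiardMap := by
  constructor
  · intro x y h
    rw [billiardMap_eq, billiardMap_eq] at h
    set k := (next (0, x) : D.LiftedState).1 - (next (0, y) : D.LiftedState).1 with hk
    have h1 : next (0, x) = (next (translate k (0, y)) : D.LiftedState) := by
      rw [next_translate]
      refine Prod.ext ?_ h
      simp [translate, hk]
    have h2 := (nextPerm D).injective h1
    exact congrArg Prod.snd h2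
  · intro y
    refine ⟨(D.traj y (-1)).2, ?_⟩
    rw [billiardMap_traj]; rfl

theorem iterate_billiardMap (x : D.PhaseSpace) (n : ℕ) :
    D.billiardMap^[n] x = (D.traj x n).2 := by
  induction n with
  | zero => rfl
  | succ n ih => rw [Function.iterate_succ_apply', ih, billiardMap_traj, Nat.cast_succ]

theorem mem_image_iterate_billiardMap (x : D.PhaseSpace) (n : ℕ) (A : Set D.PhaseSpace) :
    x ∈ D.billiardMap^[n] '' A ↔ (D.traj x (-n)).2 ∈ A := by
  have h : D.billiardMap^[n] (D.traj x (-n)).2 = x := by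
    rw [iterate_billiardMap]
    have := traj_traj x (-n) n
    rw [neg_add_cancel, traj_zero] at this
    exact (congrArg Prod.snd this).symm
  constructor
  · rintro ⟨y, hy, hyx⟩
    rw [← h] at hyx
    rwa [← billiardMap_bijective.injective.iterate n hyx]
  · intro hx
    exact ⟨_, hx, h⟩

/-! ### The singular set -/

theorem mem_singForward (x : D.PhaseSpace) (n : ℕ) :
    x ∈ D.singForward n ↔ ∃ k ≤ n, (D.traj x k).2 ∈ D.grazing := by
  simp_rw [← iterate_billiardMap]
  induction n generalizing x with
  | zero => simp [singForward]
  | succ n ih =>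
    rw [singForward, mem_union, mem_preimage, ih, ih]
    constructor
    · rintro (⟨k, hk, h⟩ | ⟨k, hk, h⟩)
      · exact ⟨k, by omega, h⟩
      · exact ⟨k + 1, by omega, h⟩
    · rintro ⟨k, hk, h⟩
      rcases k with _ | k
      · exact Or.inl ⟨0, by omega, h⟩
      · exact Or.inr ⟨k, by omega, h⟩

theorem mem_singBackward (x : D.PhaseSpace) (n : ℕ) :
    x ∈ D.singBackward n ↔ ∃ k ≤ n, (D.traj x (-k)).2 ∈ D.grazing := by
  simp_rw [← mem_image_iterate_billiardMap]
  induction n generalizing x with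
  | zero => simp [singBackward]
  | succ n ih =>
    rw [singBackward, mem_union, ih]
    constructor
    · rintro (⟨k, hk, h⟩ | ⟨y, hy, rfl⟩)
      · exact ⟨k, by omega, h⟩
      · obtain ⟨k, hk, z, hz, rfl⟩ := (ih y).mp hy
        exact ⟨k + 1, by omega, z, hz, Function.iterate_succ_apply' _ _ _⟩
    · rintro ⟨k, hk, z, hz, rfl⟩
      rcases k with _ | k
      · exact Or.inl ⟨0, by omega, z, hz, rfl⟩
      · refine Or.inr ⟨D.billiardMap^[k] z, (ih _).mpr ⟨k, by omega, z, hz, rfl⟩, ?_⟩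
        exact (Function.iterate_succ_apply' _ _ _).symm

theorem mem_singularSet (x : D.PhaseSpace) :
    x ∈ D.singularSet ↔ ∃ i : ℤ, (D.traj x i).2 ∈ D.grazing := by
  simp only [singularSet, mem_iUnion, mem_union, mem_singForward, mem_singBackward]
  constructor
  · rintro ⟨n, ⟨k, -, h⟩ | ⟨k, -, h⟩⟩
    · exact ⟨_, h⟩
    · exact ⟨_, h⟩
  · rintro ⟨i, hi⟩
    obtain ⟨n, rfl | rfl⟩ := i.eq_nat_or_neg
    · exact ⟨n, Or.inl ⟨n, le_rfl, hi⟩⟩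
    · exact ⟨n, Or.inr ⟨n, le_rfl, hi⟩⟩

/-- The asserted discontinuity set consists of the points with a grazing collision at a time other
than `0`. -/
theorem mem_singularSet_diff (x : D.PhaseSpace) : x ∈ D.singularSet \ D.grazingOnlyNow ↔
    ∃ i : ℤ, i ≠ 0 ∧ (D.traj x i).2 ∈ D.grazing := by
  have hG : x ∈ D.grazingOnlyNow ↔ (D.traj x 0).2 ∈ D.grazing ∧
      ∀ i : ℤ, i ≠ 0 → (D.traj x i).2 ∉ D.grazing := by
    change (x ∈ D.grazing ∧ ∀ n : ℕ, 1 ≤ n →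
      D.billiardMap^[n] x ∉ D.grazing ∧ x ∉ D.billiardMap^[n] '' D.grazing) ↔ _
    simp_rw [mem_image_iterate_billiardMap]
    simp only [iterate_billiardMap]
    refine and_congr Iff.rfl ⟨fun h i hi => ?_, fun h n hn => ⟨h _ (by omega), h _ (by omega)⟩⟩
    obtain ⟨n, rfl | rfl⟩ := i.eq_nat_or_neg
    · exact (h n (by omega)).1
    · exact (h n (by omega)).2
  rw [Set.mem_sdiff, mem_singularSet, hG]
  constructor
  · rintro ⟨⟨i, hi⟩, h⟩
    by_contra! hcon
    rcases eq_or_ne i 0 with rfl | h0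
    · exact h ⟨hi, hcon⟩
    · exact hcon i h0 hi
  · rintro ⟨i, h0, hi⟩
    exact ⟨⟨i, hi⟩, fun h => h.2 i h0 hi⟩

end Dynamics

end Table

/-! ### Continuity of the billiard map and of the coding map -/

/-- The topology of the sequence space is that of coordinatewise convergence. -/
theorem Seq.continuousAt_iff {m : ℕ} {X : Type*} [TopologicalSpace X] {g : X → Seq m} {x : X} :
    ContinuousAt g x ↔ ∀ i : ℤ, ∀ᶠ y in 𝓝 x, g y i = g x i := by
  have hd : ∀ a b : Seq m, dist a b = Seq.rho a b := fun _ _ => rfl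
  constructor
  · intro h i
    have h1 := Metric.tendsto_nhds.mp h ((1 / 2 : ℝ) ^ i.natAbs) (by positivity)
    filter_upwards [h1] with y hy
    rw [hd] at hy
    by_cases hne : g y = g x
    · rw [hne]
    rcases Seq.rho_of_ne hne with h2 | ⟨n, hn, h2⟩
    · rw [h2] at hy
      exact absurd hy (not_lt.mpr (pow_le_one₀ (by norm_num) (by norm_num)))
    · rw [h2] at hy
      have : i.natAbs < n := by
        rwa [pow_lt_pow_iff_right_of_lt_one₀ (by norm_num) (by norm_num)] at hy
      exact hn i (by rw [Int.abs_eq_natAbs]; exact_mod_cast this.le)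
  · intro h
    refine Metric.tendsto_nhds.mpr fun ε hε => ?_
    obtain ⟨n, hn⟩ := exists_pow_lt_of_lt_one hε (by norm_num : (1 / 2 : ℝ) < 1)
    have h1 : ∀ᶠ y in 𝓝 x, ∀ i ∈ Icc (-(n : ℤ)) n, g y i = g x i :=
      (eventually_all_finite (finite_Icc _ _)).mpr fun i _ => h i
    filter_upwards [h1] with y hy
    rw [hd]
    exact (Seq.rho_le_of_agree fun i hi => hy i (abs_le.mp hi)).trans_lt hn

namespace Table

variable {r m : ℕ} {D : Table r m} [hr : Fact (2 ≤ r)]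

omit hr in
theorem continuous_label : Continuous (label : D.LiftedState → Alphabet m) :=
  _root_.continuous_fst.prodMk (continuous_fst.comp _root_.continuous_snd)

omit hr in
theorem continuous_revLifted : Continuous (revLifted : D.LiftedState → D.LiftedState) :=
  _root_.continuous_fst.prodMk (continuous_rev.comp _root_.continuous_snd)

@[fun_prop]
theorem continuous_liftedPos : Continuous (D.liftedPos) := by
  have h1 : Continuous fun p : D.LiftedState => latticeVec p.1 :=
    (continuous_of_discreteTopology (f := latticeVec)).comp _root_.continuous_fst
  exact h1.add ((continuous_pos D).comp _root_.continuous_snd)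

/-- Convergence of lifted states is convergence of the labels, positions and velocities. -/
theorem tendsto_liftedState {X : Type*} {F : Filter X} {g : X → D.LiftedState} {q : D.LiftedState}
    (hl : ∀ᶠ y in F, label (g y) = label q)
    (hpos : Tendsto (fun y => D.liftedPos (g y)) F (𝓝 (D.liftedPos q)))
    (hvel : Tendsto (fun y => D.vel (g y).2) F (𝓝 (D.vel q.2))) : Tendsto g F (𝓝 q) := by
  have h1 : Tendsto (fun y => (g y).1) F (𝓝 q.1) := by
    refine tendsto_const_nhds.congr' ?_
    filter_upwards [hl] with y hy using (congrArg Prod.fst hy).symm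
  have h2 : Tendsto (fun y => (g y).2) F (𝓝 q.2) := by
    rw [(isInducing_phaseSpace D).tendsto_nhds_iff]
    refine Tendsto.prodMk_nhds ?_ (Tendsto.prodMk_nhds ?_ hvel)
    · refine tendsto_const_nhds.congr' ?_
      filter_upwards [hl] with y hy using (congrArg Prod.snd hy).symm
    · have h3 := hpos.sub_const (latticeVec q.1)
      simp only [liftedPos, add_sub_cancel_left] at h3
      refine h3.congr' ?_
      filter_upwards [hl] with y hy
      have : (g y).1 = q.1 := (Prod.ext_iff.mp hy).1
      simp [this]
  exact h1.prodMk_nhds h2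

variable [hD : Fact D.FiniteHorizon]

variable (D) in
/-- The length of the free flight. -/
noncomputable def flight (p : D.LiftedState) : ℝ := ‖D.liftedPos (next p) - D.liftedPos p‖

theorem liftedPos_next (p : D.LiftedState) :
    D.liftedPos (next p) = D.liftedPos p + D.flight p * D.vel p.2 :=
  (nextCollision_next p).exists_flight.1

theorem flight_free (p : D.LiftedState) {u : ℝ} (hu : 0 < u) (hu' : u < D.flight p)
    (a : Alphabet m) : D.liftedPos p + u * D.vel p.2 ∉ D.scatterer a :=
  (nextCollision_next p).exists_flight.2 u hu hu' a

theorem vin_next (p : D.LiftedState) : D.vin (next p).2 = D.vel p.2 :=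
  (nextCollision_iff.mp (nextCollision_next p)).2

theorem label_next_ne (p : D.LiftedState) : label p ≠ label (next p) :=
  (nextCollision_next p).label_ne

theorem flight_pos (p : D.LiftedState) : 0 < D.flight p := by
  refine lt_of_le_of_ne (norm_nonneg _) fun h => label_next_ne p ?_
  rw [← liftedPos_mem_iff, liftedPos_next, ← h]
  simpa using liftedPos_mem p

variable (D) in
theorem exists_le_flight : ∃ δ : ℝ, 0 < δ ∧ ∀ p : D.LiftedState, δ ≤ D.flight p := by
  obtain ⟨δ, hδ, h⟩ := exists_gap D
  exact ⟨δ, hδ, fun p => h _ _ (label_next_ne p).symm _ (liftedPos_mem _) _ (liftedPos_mem _)⟩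

omit hD in
/-- A ray that avoids a closed set for times in `[0, t]` is surrounded by such rays. -/
theorem eventually_ray_notMem {K : Set ℂ} (hK : IsClosed K) {p : D.LiftedState} {t : ℝ}
    (h : ∀ u ∈ Icc 0 t, D.liftedPos p + u * D.vel p.2 ∉ K) :
    ∀ᶠ y in 𝓝 p, ∀ u ∈ Icc (0 : ℝ) t, D.liftedPos y + u * D.vel y.2 ∉ K := by
  have hc : Continuous fun z : D.LiftedState × ℝ =>
      D.liftedPos z.1 + (z.2 : ℂ) * D.vel z.1.2 := by
    have h1 : Continuous fun z : D.LiftedState × ℝ => D.vel z.1.2 :=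
      (continuous_vel D).comp (_root_.continuous_snd.comp _root_.continuous_fst)
    have h2 : Continuous fun z : D.LiftedState × ℝ => D.liftedPos z.1 :=
      continuous_liftedPos.comp _root_.continuous_fst
    exact h2.add ((Complex.continuous_ofReal.comp _root_.continuous_snd).mul h1)
  refine isCompact_Icc.eventually_forall_of_forall_eventually fun u hu => ?_
  exact (hK.isOpen_compl.preimage hc).mem_nhds (x := (p, u)) (h u hu)

/-- If the next collision is not grazing, then nearby rays hit the same scatterer at about the same
time. -/
theorem eventually_next {p : D.LiftedState} (h : (next p).2 ∉ D.grazing) :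
    ∀ᶠ ε in 𝓝[>] (0 : ℝ), ∀ᶠ y in 𝓝 p, label (next y) = label (next p) ∧
      |D.flight y - D.flight p| < ε := by
  set q := next p with hq
  set t := D.flight p with ht
  have ht0 : 0 < t := flight_pos p
  set K := ⋃ c : {c | c ≠ label p ∧ c ≠ label q}, D.scatterer c with hKdef
  have hK : IsClosed K := isClosed_iUnion_scatterer _
  have hqK : D.liftedPos q ∉ K := by
    intro hmem
    obtain ⟨c, hc⟩ := mem_iUnion.mp hmem
    exact c.2.2 (liftedPos_mem_iff.mp hc)
  have hpq : D.liftedPos q = D.liftedPos p + t * D.vel p.2 := liftedPos_next p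
  have h1 : ∀ᶠ ε in 𝓝[>] (0 : ℝ), ∀ u : ℝ, u ∈ Icc 0 ε → D.liftedPos q + u * D.vel p.2 ∉ K := by
    have hc : Continuous fun u : ℝ => D.liftedPos q + u * D.vel p.2 := by fun_prop
    have h2 : ∀ᶠ u : ℝ in 𝓝 0, D.liftedPos q + u * D.vel p.2 ∉ K := by
      refine hc.continuousAt.eventually (hK.isOpen_compl.mem_nhds ?_)
      simpa using hqK
    obtain ⟨η, hη, h3⟩ := Metric.eventually_nhds_iff.mp h2
    filter_upwards [Ioo_mem_nhdsGT hη] with ε hε u hu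
    refine h3 ?_
    rw [Real.dist_eq, sub_zero, abs_of_nonneg hu.1]
    exact hu.2.trans_lt hε.2
  have h2 : ∀ᶠ ε : ℝ in 𝓝[>] 0, D.pos q.2 + ε * D.vel p.2 ∈ D.obstacle q.2.1 := by
    refine eventually_pos_add_mem_obstacle q.2 ?_
    rw [← vin_next p, ← hq, cross_tangent_vin]
    exact cos_angle_pos h
  filter_upwards [h1, h2, Ioo_mem_nhdsGT ht0] with ε hε1 hε2 hε
  have hε0 : 0 < ε := hε.1
  have hO : IsOpen {z | z - latticeVec q.1 ∈ D.obstacle q.2.1} :=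
    (D.isOpen_obstacle _).preimage (by fun_prop)
  have E1 : ∀ᶠ y in 𝓝 p, D.liftedPos y + ((t + ε : ℝ) : ℂ) * D.vel y.2 ∈
      {z | z - latticeVec q.1 ∈ D.obstacle q.2.1} := by
    have hc : Continuous fun y : D.LiftedState =>
        D.liftedPos y + ((t + ε : ℝ) : ℂ) * D.vel y.2 :=
      continuous_liftedPos.add
        (continuous_const.mul ((continuous_vel D).comp _root_.continuous_snd))
    refine hc.continuousAt.eventually (hO.mem_nhds ?_)
    change D.liftedPos p + ((t + ε : ℝ) : ℂ) * D.vel p.2 - latticeVec q.1 ∈ D.obstacle q.2.1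
    convert hε2 using 1
    have : D.pos q.2 = D.liftedPos p + t * D.vel p.2 - latticeVec q.1 := by
      rw [← hpq]; simp [liftedPos]
    rw [this]; push_cast; ring
  have E2 := eventually_ray_notMem hK (p := p) (t := t + ε) (by
    intro u hu hmem
    rcases lt_or_ge u t with hut | hut
    · rcases hu.1.eq_or_lt with h0 | h0
      · rw [← h0] at hmem
        obtain ⟨c, hc⟩ := mem_iUnion.mp hmem
        exact c.2.1 (liftedPos_mem_iff.mp (by simpa using hc))
      · obtain ⟨c, hc⟩ := mem_iUnion.mp hmem
        exact flight_free p h0 hut _ hc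
    · refine hε1 (u - t) ⟨by linarith, by linarith [hu.2]⟩ ?_
      rw [hpq]
      convert hmem using 1
      push_cast; ring)
  have E3 := eventually_ray_notMem (isClosed_scatterer (D := D) (label q)) (p := p) (t := t - ε) (by
    intro u hu hmem
    rcases hu.1.eq_or_lt with h0 | h0
    · rw [← h0] at hmem
      exact label_next_ne p (liftedPos_mem_iff.mp (by simpa using hmem)).symm
    · exact flight_free p h0 (by linarith [hu.2]) _ hmem)
  have E4 : ∀ᶠ y in 𝓝 p, label y = label p :=
    continuous_label.continuousAt.eventually ((isOpen_discrete {label p}).mem_nhds rfl)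
  filter_upwards [E1, E2, E3, E4] with y hy1 hy2 hy3 hy4
  have hyq : D.liftedPos y ∉ D.closedObstacle (label q) := fun hmem =>
    label_next_ne p (hy4 ▸ eq_of_mem_closedObstacle (liftedPos_mem_closedObstacle y) hmem)
  obtain ⟨u, hu0, hut, hu⟩ := exists_mem_frontier_of_segment (D.isOpen_obstacle q.2.1)
    (z := D.liftedPos y - latticeVec q.1) (d := D.vel y.2) (b := t + ε) (by linarith)
    (fun hmem => hyq (subset_closure hmem)) (by
      change D.liftedPos y + ((t + ε : ℝ) : ℂ) * D.vel y.2 - latticeVec q.1 ∈ _ at hy1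
      convert hy1 using 1
      ring)
  have hu' : D.liftedPos y + u * D.vel y.2 ∈ D.scatterer (label q) := by
    rw [mem_scatterer]
    change D.liftedPos y + u * D.vel y.2 - latticeVec q.1 ∈ frontier (D.obstacle q.2.1)
    convert hu using 1
    ring
  have hu0' : 0 < u := by
    refine lt_of_le_of_ne hu0 fun h0 => hyq ?_
    rw [← h0] at hu'
    simpa using scatterer_subset _ hu'
  have hflight : D.flight y ≤ u := by
    by_contra! hlt
    exact flight_free y hu0' hlt _ hu'
  have hmem := liftedPos_mem (next y)
  rw [liftedPos_next] at hmem
  have hlab : label (next y) = label q := by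
    by_contra hne
    refine hy2 (D.flight y) ⟨(flight_pos y).le, by linarith⟩ (mem_iUnion.mpr ⟨⟨_, ?_, hne⟩, hmem⟩)
    rw [← hy4]
    exact (label_next_ne y).symm
  refine ⟨hlab, abs_lt.mpr ⟨?_, by linarith⟩⟩
  by_contra! hle
  exact hy3 (D.flight y) ⟨(flight_pos y).le, by linarith⟩ (hlab ▸ hmem)

/-- The billiard map is continuous at points whose image is not grazing. -/
theorem continuousAt_next {p : D.LiftedState} (h : (next p).2 ∉ D.grazing) :
    ContinuousAt (next : D.LiftedState → D.LiftedState) p := by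
  have hev := eventually_next h
  have hvel : Tendsto (fun y : D.LiftedState => D.vel y.2) (𝓝 p) (𝓝 (D.vel p.2)) :=
    ((continuous_vel D).comp _root_.continuous_snd).continuousAt
  have hlab : ∀ᶠ y in 𝓝 p, label (next y) = label (next p) := by
    obtain ⟨ε, hε⟩ := hev.exists
    exact hε.mono fun y hy => hy.1
  have hflight : Tendsto D.flight (𝓝 p) (𝓝 (D.flight p)) := by
    refine Metric.tendsto_nhds.mpr fun ε hε => ?_
    obtain ⟨ε', h1, h2⟩ := (hev.and (Ioo_mem_nhdsGT hε)).exists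
    filter_upwards [h1] with y hy
    rw [Real.dist_eq]
    exact hy.2.trans h2.2
  have hpos : Tendsto (fun y => D.liftedPos (next y)) (𝓝 p) (𝓝 (D.liftedPos (next p))) := by
    simp_rw [liftedPos_next]
    refine Tendsto.add continuous_liftedPos.continuousAt (Tendsto.mul ?_ hvel)
    exact (Complex.continuous_ofReal.tendsto _).comp hflight
  have hrev : Tendsto (fun y => revLifted (next y)) (𝓝 p) (𝓝 (revLifted (next p))) := by
    refine tendsto_liftedState (by simpa using hlab) hpos ?_
    have h1 : ∀ y : D.LiftedState, D.vel (revLifted (next y)).2 = -D.vel y.2 := fun y => by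
      rw [← vin_next y]; exact vel_rev _
    simp_rw [h1]
    exact hvel.neg
  have := (continuous_revLifted.tendsto _).comp hrev
  simpa [Function.comp_def, ContinuousAt] using this

theorem continuousAt_traj {x : D.PhaseSpace} {n : ℕ}
    (h : ∀ k : ℕ, 1 ≤ k → k ≤ n → (D.traj x k).2 ∉ D.grazing) :
    ContinuousAt (fun y => D.traj y n) x := by
  induction n with
  | zero => exact (Continuous.prodMk_right _).continuousAt
  | succ n ih =>
    have h1 := h (n + 1) (by omega) le_rfl
    simp only [Nat.cast_succ, traj_add_one] at h1 ⊢
    exact ContinuousAt.comp (g := next) (continuousAt_next h1)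
      (ih fun k hk hkn => h k hk (by omega))

theorem eventually_coding_natCast {x : D.PhaseSpace} {n : ℕ}
    (h : ∀ k : ℕ, 1 ≤ k → k ≤ n → (D.traj x k).2 ∉ D.grazing) :
    ∀ᶠ y in 𝓝 x, D.coding y n = D.coding x n := by
  simp_rw [coding_apply]
  exact (continuous_label.continuousAt.comp (continuousAt_traj h)).eventually
    ((isOpen_discrete {label (D.traj x n)}).mem_nhds rfl)

theorem coding_rev (x : D.PhaseSpace) (i : ℤ) : D.coding (rev x) i = D.coding x (-i) := by
  rw [coding_apply, coding_apply, traj_neg, label_revLifted]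

theorem traj_rev_mem_grazing (x : D.PhaseSpace) (i : ℤ) :
    (D.traj (rev x) i).2 ∈ D.grazing ↔ (D.traj x (-i)).2 ∈ D.grazing := by
  rw [traj_neg]
  exact rev_mem_grazing.symm

/-- The coding map is continuous at points without a grazing collision in the strict future and
the strict past. -/
theorem continuousAt_coding {x : D.PhaseSpace}
    (h : ∀ i : ℤ, i ≠ 0 → (D.traj x i).2 ∉ D.grazing) : ContinuousAt D.coding x := by
  rw [Seq.continuousAt_iff]
  intro i
  obtain ⟨n, rfl | rfl⟩ := i.eq_nat_or_neg
  · exact eventually_coding_natCast fun k hk _ => h k (by omega)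
  · have h1 := eventually_coding_natCast (x := rev x) (n := n) fun k hk _ => by
      rw [traj_rev_mem_grazing]
      exact h _ (by omega)
    have h2 := (continuous_rev (D := D)).continuousAt.eventually h1
    filter_upwards [h2] with y hy
    simpa [coding_rev] using hy

end Table

namespace Table

/-! ### Discontinuity of the coding map -/

variable {r m : ℕ} {D : Table r m}

theorem vel_eq (x : D.PhaseSpace) : D.vel x = D.tangent x ^ 2 * (starRingEnd ℂ) (D.vin x) := by
  have h : D.vin (rev x) = D.tangent (rev x) ^ 2 * (starRingEnd ℂ) (D.vel (rev x)) := rfl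
  rw [vin_rev, vel_rev, tangent_rev, map_neg, mul_neg, neg_inj] at h
  exact h

theorem eq_or_eq_neg_of_cross_eq_zero {u w : ℂ} (hu : ‖u‖ = 1) (hw : ‖w‖ = 1)
    (h : cross u w = 0) : u = w ∨ u = -w := by
  have hu' := sq_add_sq_of_norm_eq_one hu
  have hw' := sq_add_sq_of_norm_eq_one hw
  rw [cross_eq] at h
  have h1 : u.re ^ 2 = w.re ^ 2 := by
    linear_combination w.re ^ 2 * hu' - u.re ^ 2 * hw' + (u.re * w.im + u.im * w.re) * h
  rcases sq_eq_sq_iff_eq_or_eq_neg.mp h1 with h2 | h2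
  · by_cases h0 : w.re = 0
    · have h3 : u.im ^ 2 = w.im ^ 2 := by nlinarith
      rcases sq_eq_sq_iff_eq_or_eq_neg.mp h3 with h4 | h4
      · exact Or.inl (Complex.ext h2 h4)
      · exact Or.inr (Complex.ext (by simp [h2, h0]) h4)
    · refine Or.inl (Complex.ext h2 ?_)
      apply mul_left_cancel₀ h0
      rw [h2] at h; linarith
  · by_cases h0 : w.re = 0
    · have h3 : u.im ^ 2 = w.im ^ 2 := by nlinarith
      rcases sq_eq_sq_iff_eq_or_eq_neg.mp h3 with h4 | h4
      · exact Or.inl (Complex.ext (by simp [h2, h0]) h4)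
      · exact Or.inr (Complex.ext h2 h4)
    · refine Or.inr (Complex.ext h2 ?_)
      apply mul_left_cancel₀ h0
      rw [h2] at h
      simp only [Complex.neg_im]; linarith

theorem eventually_mk (l : Fin m)
    (y : AddCircle (D.perimeter l) × Set.Icc (-(Real.pi / 2)) (Real.pi / 2))
    {P : D.PhaseSpace → Prop} (h : ∀ᶠ y' in 𝓝 y, P (⟨l, y'⟩ : D.PhaseSpace)) :
    ∀ᶠ x in 𝓝 (⟨l, y⟩ : D.PhaseSpace), P x := by
  have hn : 𝓝 (⟨l, y⟩ : D.PhaseSpace) = map (fun y => (⟨l, y⟩ : D.PhaseSpace)) (𝓝 y) :=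
    Sigma.nhds_mk (σ := fun l : Fin m =>
      AddCircle (D.perimeter l) × Set.Icc (-(Real.pi / 2)) (Real.pi / 2)) l y
  exact hn.le h

variable [hr : Fact (2 ≤ r)]

/-- Near a point of the boundary, the sides of a displacement along the boundary relative to the
incoming and the outgoing ray are opposite, and the tangent turns to the side of the latter. -/
theorem eventually_reflection_sides {x : D.PhaseSpace} (hx : x ∉ D.grazing) (σ : ℝ) :
    ∀ᶠ x' in 𝓝 x, 0 < σ * cross (D.vin x) (D.pos x' - D.pos x) →
      0 < -σ * cross (D.vel x) (D.pos x' - D.pos x) ∧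
        0 < -σ * cross (D.tangent x) (D.tangent x') := by
  obtain ⟨l, θ, φ⟩ := x
  obtain ⟨s, rfl⟩ := QuotientAddGroup.mk_surjective θ
  set θ : AddCircle (D.perimeter l) := (s : AddCircle (D.perimeter l))
  set x : D.PhaseSpace := ⟨l, θ, φ⟩ with hxdef
  have hcos := cos_angle_pos hx
  have hvT : cross (D.vel x) (deriv (D.curve l) s) = Real.cos (D.angle x) := cross_vel_tangent x
  have hvinT : cross (-D.vin x) (deriv (D.curve l) s) = Real.cos (D.angle x) := by
    have h1 := cross_tangent_vin x
    have h2 : D.tangent x = deriv (D.curve l) s := rfl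
    rw [neg_cross, ← h2]
    rw [cross_eq] at h1 ⊢
    linarith
  have hγ : HasDerivAt (fun s' => D.curve l s' - D.curve l s) (deriv (D.curve l) s) s :=
    (D.hasDerivAt_curve l s).sub_const _
  have E1 := eventually_sign_of_hasDerivAt (hasDerivAt_cross (D.vel x) hγ) (by simp [cross_eq])
    (by rw [hvT]; exact hcos)
  have E2 := eventually_sign_of_hasDerivAt (hasDerivAt_cross (-D.vin x) hγ) (by simp [cross_eq])
    (by rw [hvinT]; exact hcos)
  have E3 := D.eventually_cross_deriv l s
  have E : ∀ᶠ θ' in 𝓝 θ, 0 < σ * cross (D.vin x) (D.circleCurve l θ' - D.curve l s) →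
      0 < -σ * cross (D.vel x) (D.circleCurve l θ' - D.curve l s) ∧
        0 < -σ * cross (deriv (D.curve l) s) (D.circleTangent l θ') := by
    refine D.eventually_circle l ?_
    filter_upwards [E1, E2, E3] with s' h1 h2 h3 h
    rw [circleCurve_coe] at h ⊢
    rw [circleTangent_coe]
    simp only [neg_cross] at h2
    rcases lt_trichotomy s s' with hlt | heq | hlt
    · have a1 := h1.1 hlt
      have a2 := h2.1 hlt
      have a3 := h3.1 hlt
      have hσ : σ < 0 := by by_contra! hσ; nlinarith
      exact ⟨by nlinarith, by nlinarith⟩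
    · rw [← heq] at h
      simp [cross_eq] at h
    · have a1 := h1.2 hlt
      have a2 := h2.2 hlt
      have a3 := h3.2 hlt
      have hσ : 0 < σ := by by_contra! hσ; nlinarith
      exact ⟨by nlinarith, by nlinarith⟩
  refine eventually_mk l (θ, φ) ?_
  exact (_root_.continuous_fst.tendsto (θ, φ)).eventually E

variable [hD : Fact D.FiniteHorizon]

/-- A family `Q` of rays near the ray of `p` is dispersing to the side `σ` if the rays turn away
from the ray of `p` to that side, and lie on that side from time `u` on. -/
def Disperses {Y : Type*} (F : Filter Y) (p : D.LiftedState) (Q : Y → D.LiftedState)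
    (u σ : ℝ) : Prop :=
  ∀ᶠ y in F, 0 < σ * cross (D.vel p.2) (D.vel (Q y).2) ∧
    0 < σ * (cross (D.vel p.2) (D.liftedPos (Q y) - D.liftedPos p) +
      u * cross (D.vel p.2) (D.vel (Q y).2))

/-- The side of the next collision. -/
theorem cross_next_sub (p q : D.LiftedState) :
    cross (D.vel p.2) (D.liftedPos (next q) - D.liftedPos (next p)) =
      cross (D.vel p.2) (D.liftedPos q - D.liftedPos p) +
        D.flight q * cross (D.vel p.2) (D.vel q.2) := by
  rw [liftedPos_next p, liftedPos_next q]
  simp only [cross_sub, cross_add, cross_real_mul, cross_self]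
  ring

theorem Disperses.cross_next_pos {Y : Type*} {F : Filter Y} {p : D.LiftedState}
    {Q : Y → D.LiftedState} {u σ : ℝ} (h : Disperses F p Q u σ)
    (hu : ∀ p : D.LiftedState, u ≤ D.flight p) :
    ∀ᶠ y in F, 0 < σ * cross (D.vel p.2) (D.liftedPos (next (Q y)) - D.liftedPos (next p)) := by
  filter_upwards [h] with y hy
  rw [cross_next_sub]
  nlinarith [hu (Q y)]

/-- Dispersing families stay dispersing after a collision that is not grazing; the side changes. -/
theorem Disperses.next {Y : Type*} {F : Filter Y} {p : D.LiftedState} {Q : Y → D.LiftedState}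
    {u σ : ℝ} (h : Disperses F p Q u σ) (hQ : Tendsto Q F (𝓝 p)) (hu0 : 0 < u)
    (hu : ∀ p : D.LiftedState, u ≤ D.flight p) (hp : (next p).2 ∉ D.grazing) :
    Disperses F (next p) (fun y => Table.next (Q y)) u (-σ) := by
  set q := Table.next p with hq
  have hN : Tendsto (fun y => Table.next (Q y)) F (𝓝 q) := (continuousAt_next hp).tendsto.comp hQ
  have hN2 : Tendsto (fun y => (Table.next (Q y)).2) F (𝓝 q.2) :=
    (_root_.continuous_snd.tendsto _).comp hN
  have E1 := hN2.eventually (eventually_reflection_sides hp σ)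
  have E2 : ∀ᶠ y in F, label (Table.next (Q y)) = label q :=
    hN.eventually (continuous_label.continuousAt.eventually
      ((isOpen_discrete {label q}).mem_nhds rfl))
  -- the rotations of the tangent and of the incoming velocity are close to the identity
  have hT : Tendsto (fun y => (starRingEnd ℂ) (D.tangent q.2) * D.tangent (Table.next (Q y)).2) F
      (𝓝 1) := by
    have h1 : Tendsto (fun y => D.tangent (Table.next (Q y)).2) F (𝓝 (D.tangent q.2)) :=
      ((continuous_tangent D).tendsto _).comp hN2
    have h2 := h1.const_mul ((starRingEnd ℂ) (D.tangent q.2))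
    rwa [mul_comm _ (D.tangent q.2), Complex.mul_conj, Complex.normSq_eq_norm_sq, norm_tangent,
      one_pow, Complex.ofReal_one] at h2
  have hV : Tendsto (fun y => (starRingEnd ℂ) (D.vel p.2) * D.vel (Q y).2) F (𝓝 1) := by
    have h1 : Tendsto (fun y => D.vel (Q y).2) F (𝓝 (D.vel p.2)) :=
      (((continuous_vel D).comp _root_.continuous_snd).tendsto _).comp hQ
    have h2 := h1.const_mul ((starRingEnd ℂ) (D.vel p.2))
    rwa [mul_comm _ (D.vel p.2), Complex.mul_conj, Complex.normSq_eq_norm_sq, norm_vel,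
      one_pow, Complex.ofReal_one] at h2
  have hO : IsOpen {z : ℂ | 0 < z.re ∧ 0 < z.re ^ 2 - z.im ^ 2} :=
    (isOpen_lt continuous_const Complex.continuous_re).inter
      (isOpen_lt continuous_const
        ((Complex.continuous_re.pow 2).sub (Complex.continuous_im.pow 2)))
  have E3 := hT.eventually (hO.mem_nhds (by simp))
  have E4 := hV.eventually (hO.mem_nhds (by simp))
  filter_upwards [h, h.cross_next_pos hu, E1, E2, E3, E4] with y h1 h2 h3 h4 h5 h6
  have hpos : D.liftedPos (Table.next (Q y)) - D.liftedPos q =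
      D.pos (Table.next (Q y)).2 - D.pos q.2 := by
    have : (Table.next (Q y)).1 = q.1 := (Prod.ext_iff.mp h4).1
    simp [liftedPos, this]
  rw [hpos] at h2 ⊢
  rw [← vin_next p] at h2
  obtain ⟨h7, h8⟩ := h3 h2
  set A := (starRingEnd ℂ) (D.tangent q.2) * D.tangent (Table.next (Q y)).2 with hA
  set B := (starRingEnd ℂ) (D.vel p.2) * D.vel (Q y).2 with hB
  have hη : cross (D.vel q.2) (D.vel (Table.next (Q y)).2) =
      2 * A.re * A.im * B.re - (A.re ^ 2 - A.im ^ 2) * B.im := by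
    have : (starRingEnd ℂ) (D.vel q.2) * D.vel (Table.next (Q y)).2 =
        A ^ 2 * (starRingEnd ℂ) B := by
      rw [vel_eq q.2, vel_eq (Table.next (Q y)).2, vin_next, hq, vin_next, hA, hB]
      simp only [map_mul, map_pow, Complex.conj_conj]
      ring
    rw [cross, this]
    simp only [sq, Complex.mul_im, Complex.mul_re, Complex.conj_re, Complex.conj_im]
    ring
  have hAim : 0 < -σ * A.im := h8
  have hBim : 0 < σ * B.im := h1.1
  have h9 : 0 < -σ * cross (D.vel q.2) (D.vel (Table.next (Q y)).2) := by
    rw [hη]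
    have e1 : 0 < A.re * B.re * (-σ * A.im) := mul_pos (mul_pos h5.1 h6.1) hAim
    have e2 : 0 < (A.re ^ 2 - A.im ^ 2) * (σ * B.im) := mul_pos h5.2 hBim
    nlinarith
  refine ⟨h9, ?_⟩
  have : 0 < u * (-σ * cross (D.vel q.2) (D.vel (Table.next (Q y)).2)) := mul_pos hu0 h9
  nlinarith

/-- A scatterer grazed by the ray of `p` lies on one side `ρ` of this ray; hence rays that pass on
the other side miss it. -/
theorem exists_side_of_grazing {p : D.LiftedState} (hp : (next p).2 ∈ D.grazing) :
    ∃ ρ : ℝ, (ρ = 1 ∨ ρ = -1) ∧ ∀ q : D.LiftedState, label (next q) = label (next p) →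
      0 ≤ ρ * cross (D.vel p.2) (D.liftedPos (next q) - D.liftedPos (next p)) := by
  have key : ∀ q : D.LiftedState, label (next q) = label (next p) →
      0 ≤ cross (D.tangent (next p).2) (D.liftedPos (next q) - D.liftedPos (next p)) := by
    intro q hq
    by_cases hne : D.liftedPos (next q) = D.liftedPos (next p)
    · simp [hne, cross_eq]
    have h1 : D.liftedPos (next q) ∈ D.closedObstacle (label (next p)) :=
      hq ▸ liftedPos_mem_closedObstacle (next q)
    have h2 := cross_tangent_pos_of_mem_closure (next p).2 (z := D.liftedPos (next q) -
      latticeVec (next p).1) h1 (fun h => hne (by rw [← sub_add_cancel (D.liftedPos (next q))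
        (latticeVec (next p).1), h, liftedPos, add_comm]))
    have h3 : D.liftedPos (next p) = latticeVec (next p).1 + D.pos (next p).2 := rfl
    rw [h3, ← sub_sub]
    exact h2.le
  have h0 : cross (D.tangent (next p).2) (D.vel p.2) = 0 := by
    rw [← vin_next, cross_tangent_vin]
    exact (mem_grazing_iff _).mp hp
  rcases eq_or_eq_neg_of_cross_eq_zero (norm_tangent _) (norm_vel _) h0 with h | h
  · exact ⟨1, Or.inl rfl, fun q hq => by rw [one_mul, ← h]; exact key q hq⟩
  · refine ⟨-1, Or.inr rfl, fun q hq => ?_⟩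
    have := key q hq
    rw [h, neg_cross] at this
    linarith

omit hD in
/-- Displacements of the base point at a constant angle form a dispersing family. -/
theorem exists_disperses (x : D.PhaseSpace) {u σ : ℝ} (hu : 0 < u) (hσ : σ = 1 ∨ σ = -1) :
    ∃ F : Filter ℝ, F.NeBot ∧ ∃ g : ℝ → D.PhaseSpace, Tendsto g F (𝓝 x) ∧
      Disperses F ((0, x) : D.LiftedState) (fun s => (0, g s)) u σ := by
  obtain ⟨l, θ, φ⟩ := x
  obtain ⟨s, rfl⟩ := QuotientAddGroup.mk_surjective θ
  set x : D.PhaseSpace := ⟨l, (s : AddCircle (D.perimeter l)), φ⟩ with hx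
  set g : ℝ → D.PhaseSpace := fun s' => ⟨l, (s' : AddCircle (D.perimeter l)), φ⟩ with hg
  have hgc : Continuous g := (continuous_mk l).comp
    ((AddCircle.continuous_mk' _).prodMk continuous_const)
  have hvel : ∀ s', cross (D.vel x) (D.vel (g s')) =
      cross (deriv (D.curve l) s) (deriv (D.curve l) s') := by
    intro s'
    set c := -Complex.I * Complex.exp (φ * Complex.I) with hc
    have hc1 : (starRingEnd ℂ) c * c = 1 := by
      rw [mul_comm, Complex.mul_conj, Complex.normSq_eq_norm_sq, hc, norm_mul, norm_neg,
        Complex.norm_I, Complex.norm_exp_ofReal_mul_I]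
      simp
    have h1 : ∀ s', D.vel (g s') = deriv (D.curve l) s' * c := by
      intro s'
      change -Complex.I * deriv (D.curve l) s' * Complex.exp (φ * Complex.I) = _
      rw [hc]; ring
    have h2 : D.vel x = deriv (D.curve l) s * c := h1 s
    rw [h2, h1, cross, cross, map_mul]
    congr 1
    linear_combination ((starRingEnd ℂ) (deriv (D.curve l) s)) * (deriv (D.curve l) s') * hc1
  have hd : HasDerivAt (fun s' => cross (D.vel x) (D.curve l s' - D.curve l s) +
      u * cross (deriv (D.curve l) s) (deriv (D.curve l) s'))
      (cross (D.vel x) (deriv (D.curve l) s) +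
        u * cross (deriv (D.curve l) s) (deriv (deriv (D.curve l)) s)) s :=
    (hasDerivAt_cross _ ((D.hasDerivAt_curve l s).sub_const _)).add
      ((hasDerivAt_cross _ (D.hasDerivAt_deriv l s)).const_mul u)
  have E1 := eventually_sign_of_hasDerivAt hd (by simp [cross_eq]; ring_nf; simp) (by
    have h1 : cross (D.vel x) (deriv (D.curve l) s) = Real.cos (D.angle x) := cross_vel_tangent x
    rw [h1]
    have h2 : 0 < cross (deriv (D.curve l) s) (deriv (deriv (D.curve l)) s) := D.curvature_pos l s
    nlinarith [cos_angle_nonneg x, mul_pos hu h2])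
  have E2 := D.eventually_cross_deriv l s
  have hpos : ∀ s', D.liftedPos ((0, g s') : D.LiftedState) - D.liftedPos ((0, x) : D.LiftedState) =
      D.curve l s' - D.curve l s := by
    intro s'
    simp only [liftedPos, add_sub_add_left_eq_sub]
    rfl
  rcases hσ with rfl | rfl
  · refine ⟨𝓝[>] s, inferInstance, g, hgc.continuousAt.tendsto.mono_left nhdsWithin_le_nhds, ?_⟩
    filter_upwards [nhdsWithin_le_nhds E1, nhdsWithin_le_nhds E2, self_mem_nhdsWithin]
      with s' h1 h2 h3
    rw [hpos]
    simp only [hvel, one_mul]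
    exact ⟨h2.1 h3, h1.1 h3⟩
  · refine ⟨𝓝[<] s, inferInstance, g, hgc.continuousAt.tendsto.mono_left nhdsWithin_le_nhds, ?_⟩
    filter_upwards [nhdsWithin_le_nhds E1, nhdsWithin_le_nhds E2, self_mem_nhdsWithin]
      with s' h1 h2 h3
    rw [hpos]
    simp only [hvel, neg_mul, one_mul]
    exact ⟨neg_pos.mpr (h2.2 h3), neg_pos.mpr (h1.2 h3)⟩

theorem Disperses.traj {Y : Type*} {F : Filter Y} {x : D.PhaseSpace} {g : Y → D.PhaseSpace}
    {u σ : ℝ} (h : Disperses F ((0, x) : D.LiftedState) (fun y => (0, g y)) u σ)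
    (hg : Tendsto g F (𝓝 x)) (hu0 : 0 < u) (hu : ∀ p : D.LiftedState, u ≤ D.flight p) (n : ℕ)
    (hn : ∀ k : ℕ, 1 ≤ k → k ≤ n → (D.traj x k).2 ∉ D.grazing) :
    Disperses F (D.traj x n) (fun y => D.traj (g y) n) u ((-1) ^ n * σ) := by
  induction n with
  | zero => simpa using h
  | succ n ih =>
    have h1 := ih fun k hk hkn => hn k hk (by omega)
    have h2 : Tendsto (fun y => D.traj (g y) n) F (𝓝 (D.traj x n)) :=
      (continuousAt_traj fun k hk hkn => hn k hk (by omega)).tendsto.comp hg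
    have h3 := hn (n + 1) (by omega) le_rfl
    simp only [Nat.cast_succ, traj_add_one] at h3 ⊢
    have := h1.next h2 hu0 hu h3
    rwa [pow_succ, mul_neg_one, neg_mul]

/-- If the first grazing collision in the strict future is the one with number `n + 1`, then it is
missed by a dispersing family of trajectories that converges to the trajectory of `x`. -/
theorem not_continuousAt_coding_of_future {x : D.PhaseSpace} {n : ℕ}
    (hn : (D.traj x (n + 1)).2 ∈ D.grazing)
    (hmin : ∀ k : ℕ, 1 ≤ k → k ≤ n → (D.traj x k).2 ∉ D.grazing) :
    ¬ ContinuousAt D.coding x := by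
  intro hcont
  rw [Seq.continuousAt_iff] at hcont
  obtain ⟨u, hu0, hu⟩ := exists_le_flight D
  rw [traj_add_one] at hn
  obtain ⟨ρ, hρ, hside⟩ := exists_side_of_grazing hn
  -- the side at time `0` is chosen so that the rays pass the grazed scatterer on the free side
  obtain ⟨F, hF, g, hg, hdisp⟩ := exists_disperses x hu0 (σ := (-1) ^ n * -ρ) (by
    rcases neg_one_pow_eq_or ℝ n with h | h <;> rcases hρ with rfl | rfl <;> simp [h])
  have h1 := (hdisp.traj hg hu0 hu n hmin).cross_next_pos hu
  have h2 := hg.eventually (hcont (n + 1))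
  obtain ⟨y, hy1, hy2⟩ := (h1.and h2).exists
  rw [coding_apply, coding_apply, traj_add_one, traj_add_one] at hy2
  have h3 := hside _ hy2
  have h4 : (-1 : ℝ) ^ n * ((-1) ^ n * -ρ) = -ρ := by
    rw [← mul_assoc, ← mul_pow]; simp
  rw [h4] at hy1
  linarith

theorem not_continuousAt_coding {x : D.PhaseSpace}
    (h : ∃ i : ℤ, i ≠ 0 ∧ (D.traj x i).2 ∈ D.grazing) : ¬ ContinuousAt D.coding x := by
  have key : ∀ x : D.PhaseSpace, (∃ n : ℕ, (D.traj x (n + 1)).2 ∈ D.grazing) →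
      ¬ ContinuousAt D.coding x := by
    classical
    intro x hx
    refine not_continuousAt_coding_of_future (Nat.find_spec hx) fun k hk hkn => ?_
    have := Nat.find_min hx (m := k - 1) (by omega)
    rwa [Nat.cast_sub hk, Nat.cast_one, sub_add_cancel] at this
  obtain ⟨i, hi0, hi⟩ := h
  obtain ⟨n, rfl | rfl⟩ := i.eq_nat_or_neg
  · refine key x ⟨n - 1, ?_⟩
    rwa [Nat.cast_sub (by omega), Nat.cast_one, sub_add_cancel]
  · intro hcont
    refine key (rev x) ⟨n - 1, ?_⟩ ?_
    · rw [Nat.cast_sub (by omega), Nat.cast_one, sub_add_cancel, traj_rev_mem_grazing]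
      exact hi
    · rw [Seq.continuousAt_iff] at hcont ⊢
      intro i
      have h1 := hcont (-i)
      have h2 := (continuous_rev (D := D)).tendsto (rev x)
      rw [rev_rev] at h2
      filter_upwards [h2.eventually h1] with y hy
      rw [coding_rev, ← hy, coding_rev, neg_neg]

theorem not_continuousAt_coding_iff {x : D.PhaseSpace} : ¬ ContinuousAt D.coding x ↔
    x ∈ D.singularSet \ D.grazingOnlyNow := by
  rw [mem_singularSet_diff]
  refine ⟨fun h => ?_, not_continuousAt_coding⟩
  by_contra! hcon
  exact h (continuousAt_coding hcon)

end Table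

namespace Table

/-! ### Local separation of points by their velocities -/

section Separation

variable {r m : ℕ} {D : Table r m}

/-- The neighbourhoods of a point of the phase space come from the parametrisation by `ℝ` in place
of the circle. -/
theorem nhds_le_map (l : Fin m) (s : ℝ) (φ : Set.Icc (-(Real.pi / 2)) (Real.pi / 2)) :
    𝓝 (⟨l, (s : AddCircle (D.perimeter l)), φ⟩ : D.PhaseSpace) ≤
      map (fun y : ℝ × Set.Icc (-(Real.pi / 2)) (Real.pi / 2) =>
        (⟨l, (y.1 : AddCircle (D.perimeter l)), y.2⟩ : D.PhaseSpace)) (𝓝 (s, φ)) := by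
  have h1 : 𝓝 (⟨l, (s : AddCircle (D.perimeter l)), φ⟩ : D.PhaseSpace) =
      map (fun y => (⟨l, y⟩ : D.PhaseSpace)) (𝓝 ((s : AddCircle (D.perimeter l)), φ)) :=
    Sigma.nhds_mk (σ := fun l : Fin m =>
      AddCircle (D.perimeter l) × Set.Icc (-(Real.pi / 2)) (Real.pi / 2)) l _
  have h2 : 𝓝 (s : AddCircle (D.perimeter l)) ≤
      map ((↑) : ℝ → AddCircle (D.perimeter l)) (𝓝 s) :=
    QuotientAddGroup.isOpenMap_coe.nhds_le s
  have h3 : 𝓝 ((s : AddCircle (D.perimeter l)), φ) ≤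
      map (Prod.map ((↑) : ℝ → AddCircle (D.perimeter l)) id) (𝓝 (s, φ)) := by
    rw [nhds_prod_eq, nhds_prod_eq, ← Filter.prod_map_map_eq', map_id]
    exact Filter.prod_mono h2 le_rfl
  exact h1.le.trans (map_mono h3)

theorem abs_sub_le_norm_exp_sub {a b : ℝ} (h : |a - b| ≤ Real.pi) :
    |a - b| ≤ 2 * ‖Complex.exp (a * Complex.I) - Complex.exp (b * Complex.I)‖ := by
  have h1 : Complex.exp (a * Complex.I) - Complex.exp (b * Complex.I) =
      Complex.exp (b * Complex.I) * (Complex.exp (Complex.I * ((a - b : ℝ) : ℂ)) - 1) := by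
    rw [mul_sub, ← Complex.exp_add, mul_one]
    congr 2
    push_cast; ring
  have h2 := Real.mul_abs_le_abs_sin (x := (a - b) / 2) (by rw [abs_div, abs_two]; linarith)
  rw [h1, norm_mul, Complex.norm_exp_ofReal_mul_I, one_mul, Complex.norm_exp_I_mul_ofReal_sub_one,
    norm_mul, Real.norm_two, Real.norm_eq_abs]
  rw [abs_div, abs_two] at h2
  have h3 : 1 / 2 * (|a - b| / 2) ≤ 2 / Real.pi * (|a - b| / 2) := by
    apply mul_le_mul_of_nonneg_right _ (by positivity)
    rw [div_le_div_iff₀ (by norm_num) Real.pi_pos]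
    linarith [Real.pi_le_four]
  linarith

theorem norm_exp_angle_sub_le (x y : D.PhaseSpace) :
    ‖Complex.exp (D.angle x * Complex.I) - Complex.exp (D.angle y * Complex.I)‖ ≤
      ‖D.tangent x - D.tangent y‖ + ‖D.vel x - D.vel y‖ := by
  have h : ∀ x : D.PhaseSpace, Complex.exp (D.angle x * Complex.I) =
      Complex.I * (starRingEnd ℂ) (D.tangent x) * D.vel x := by
    intro x
    have h1 : D.tangent x * (starRingEnd ℂ) (D.tangent x) = 1 := by
      rw [Complex.mul_conj, Complex.normSq_eq_norm_sq, norm_tangent]; simp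
    rw [vel, normal]
    linear_combination (-Complex.exp (D.angle x * Complex.I)) * h1 +
      Complex.exp (D.angle x * Complex.I) * D.tangent x * (starRingEnd ℂ) (D.tangent x) *
        Complex.I_sq
  have h2 : Complex.exp (D.angle x * Complex.I) - Complex.exp (D.angle y * Complex.I) =
      Complex.I * (starRingEnd ℂ) (D.tangent x - D.tangent y) * D.vel x +
        Complex.I * (starRingEnd ℂ) (D.tangent y) * (D.vel x - D.vel y) := by
    rw [h, h, map_sub]; ring
  rw [h2]
  refine (norm_add_le _ _).trans ?_
  simp [norm_vel, norm_tangent, -map_sub]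

variable [hr : Fact (2 ≤ r)]

theorem norm_curve_sub_le (l : Fin m) (s s' : ℝ) :
    ‖D.curve l s - D.curve l s'‖ ≤ |s - s'| := by
  have := Convex.norm_image_sub_le_of_norm_deriv_le (f := D.curve l) (C := 1) (s := univ)
    (x := s') (y := s) (fun x _ => (D.hasDerivAt_curve l x).differentiableAt)
    (fun x _ => (D.unit_speed l x).le) convex_univ (mem_univ _) (mem_univ _)
  simpa using this

omit hr in
/-- The squared tangent vector is the product of the incoming and the outgoing velocity. -/
theorem norm_tangent_sub_mul_le (x y : D.PhaseSpace) :
    ‖D.tangent x - D.tangent y‖ * ‖D.tangent x + D.tangent y‖ ≤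
      ‖D.vin x - D.vin y‖ + ‖D.vel x - D.vel y‖ := by
  rw [← norm_mul]
  have : (D.tangent x - D.tangent y) * (D.tangent x + D.tangent y) =
      (D.vin x - D.vin y) * D.vel x + D.vin y * (D.vel x - D.vel y) := by
    linear_combination (-1 : ℂ) * vin_mul_vel x + vin_mul_vel y
  rw [this]
  refine (norm_add_le _ _).trans ?_
  simp [norm_vel, norm_vin]

/-- Near a given point, the incoming and outgoing velocities separate points in a Lipschitz way:
the squared tangent vector is the product of the two velocities, and it moves with positive
speed. -/
theorem eventually_dist_le (x : D.PhaseSpace) : ∃ C : ℝ, 0 < C ∧ ∀ᶠ z in 𝓝 x ×ˢ 𝓝 x,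
    dist z.1 z.2 + ‖D.pos z.1 - D.pos z.2‖ ≤
      C * (‖D.vin z.1 - D.vin z.2‖ + ‖D.vel z.1 - D.vel z.2‖) := by
  obtain ⟨l, θ, φ⟩ := x
  obtain ⟨s, rfl⟩ := QuotientAddGroup.mk_surjective θ
  set x : D.PhaseSpace := ⟨l, (s : AddCircle (D.perimeter l)), φ⟩ with hx
  set g : ℝ × Set.Icc (-(Real.pi / 2)) (Real.pi / 2) → D.PhaseSpace := fun y =>
    ⟨l, (y.1 : AddCircle (D.perimeter l)), y.2⟩ with hg
  set k := ‖deriv (deriv (D.curve l)) s‖ with hk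
  have hk0 : 0 < k := by
    rw [hk, norm_pos_iff]
    intro h0
    have := D.curvature_pos l s
    rw [h0] at this
    simp at this
  have E1 : ∀ᶠ p : ℝ × ℝ in 𝓝 (s, s), |p.1 - p.2| ≤
      2 / k * ‖deriv (D.curve l) p.1 - deriv (D.curve l) p.2‖ := by
    have h1 := (D.hasStrictDerivAt_deriv l s).isLittleO
    have h2 := (Asymptotics.isLittleO_iff.mp h1) (half_pos hk0)
    filter_upwards [h2] with p hp
    have h3 : ‖(p.1 - p.2) • deriv (deriv (D.curve l)) s‖ = |p.1 - p.2| * k := by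
      rw [norm_smul, Real.norm_eq_abs]
    have h4 := norm_sub_norm_le ((p.1 - p.2) • deriv (deriv (D.curve l)) s)
      (deriv (D.curve l) p.1 - deriv (D.curve l) p.2)
    rw [norm_sub_rev ((p.1 - p.2) • _) (_ - _), h3] at h4
    have h5 : |p.1 - p.2| * k - ‖deriv (D.curve l) p.1 - deriv (D.curve l) p.2‖ ≤
        k / 2 * |p.1 - p.2| := by
      refine h4.trans ?_
      simpa using hp
    rw [div_mul_eq_mul_div, le_div_iff₀ hk0]
    linarith
  have E2 : ∀ᶠ p : ℝ × ℝ in 𝓝 (s, s),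
      1 < ‖deriv (D.curve l) p.1 + deriv (D.curve l) p.2‖ := by
    have hc : Continuous fun p : ℝ × ℝ => ‖deriv (D.curve l) p.1 + deriv (D.curve l) p.2‖ := by
      have := (D.contDiff_deriv l).continuous
      fun_prop
    refine hc.continuousAt.eventually (lt_mem_nhds ?_)
    change 1 < ‖deriv (D.curve l) s + deriv (D.curve l) s‖
    rw [← two_mul, norm_mul, D.unit_speed]
    norm_num
  have E3 : ∀ᶠ y in 𝓝 (s, φ) ×ˢ 𝓝 (s, φ), (fun z : D.PhaseSpace × D.PhaseSpace =>
      dist z.1 z.2 + ‖D.pos z.1 - D.pos z.2‖ ≤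
      (2 + 2 / k * 2 + 2) * (‖D.vin z.1 - D.vin z.2‖ + ‖D.vel z.1 - D.vel z.2‖))
      (Prod.map g g y) := by
    have hc : Tendsto (fun y : (ℝ × Set.Icc (-(Real.pi / 2)) (Real.pi / 2)) ×
        (ℝ × Set.Icc (-(Real.pi / 2)) (Real.pi / 2)) => (y.1.1, y.2.1))
        (𝓝 (s, φ) ×ˢ 𝓝 (s, φ)) (𝓝 (s, s)) := by
      rw [← nhds_prod_eq]
      exact (Continuous.tendsto (by fun_prop) _)
    filter_upwards [hc.eventually E1, hc.eventually E2] with y h1 h2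
    simp only [Prod.map_fst, Prod.map_snd]
    set S := ‖D.vin (g y.1) - D.vin (g y.2)‖ + ‖D.vel (g y.1) - D.vel (g y.2)‖ with hS
    have t1 : D.tangent (g y.1) = deriv (D.curve l) y.1.1 := rfl
    have t2 : D.tangent (g y.2) = deriv (D.curve l) y.2.1 := rfl
    have h3 := norm_tangent_sub_mul_le (g y.1) (g y.2)
    rw [t1, t2] at h3
    have h4 : ‖deriv (D.curve l) y.1.1 - deriv (D.curve l) y.2.1‖ ≤ S := by
      nlinarith [norm_nonneg (deriv (D.curve l) y.1.1 - deriv (D.curve l) y.2.1)]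
    have h5 : |y.1.1 - y.2.1| ≤ 2 / k * S := h1.trans (by gcongr)
    have h6 : dist (g y.1) (g y.2) ≤ |y.1.1 - y.2.1| + |(y.1.2 : ℝ) - y.2.2| := by
      rw [hg, dist_mk, Prod.dist_eq]
      refine max_le ?_ ?_
      · refine le_add_of_le_of_nonneg ?_ (abs_nonneg _)
        rw [dist_eq_norm, ← AddCircle.coe_sub]
        exact QuotientAddGroup.norm_mk_le_norm
      · exact le_add_of_nonneg_of_le (abs_nonneg _) (le_of_eq rfl)
    have h7 : |(y.1.2 : ℝ) - y.2.2| ≤ 2 * (S + S) := by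
      have h8 : |(y.1.2 : ℝ) - y.2.2| ≤ Real.pi := by
        have a1 := y.1.2.2
        have a2 := y.2.2.2
        rw [mem_Icc] at a1 a2
        rw [abs_le]; constructor <;> linarith
      refine (abs_sub_le_norm_exp_sub h8).trans ?_
      have h9 := norm_exp_angle_sub_le (g y.1) (g y.2)
      rw [t1, t2] at h9
      have h10 : ‖D.vel (g y.1) - D.vel (g y.2)‖ ≤ S := by
        rw [hS]; linarith [norm_nonneg (D.vin (g y.1) - D.vin (g y.2))]
      have h11 : ‖Complex.exp ((y.1.2 : ℝ) * Complex.I) - Complex.exp ((y.2.2 : ℝ) * Complex.I)‖ ≤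
          ‖deriv (D.curve l) y.1.1 - deriv (D.curve l) y.2.1‖ +
            ‖D.vel (g y.1) - D.vel (g y.2)‖ := h9
      linarith
    have h8 : ‖D.pos (g y.1) - D.pos (g y.2)‖ ≤ |y.1.1 - y.2.1| := norm_curve_sub_le l _ _
    linarith
  refine ⟨2 + 2 / k * 2 + 2, by positivity, ?_⟩
  have hle : 𝓝 x ×ˢ 𝓝 x ≤ map (Prod.map g g) (𝓝 (s, φ) ×ˢ 𝓝 (s, φ)) := by
    rw [← Filter.prod_map_map_eq']
    exact Filter.prod_mono (nhds_le_map l s φ) (nhds_le_map l s φ)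
  exact hle E3

/-- Near a given point, the tangent vector turns at a rate that is linear in the displacement,
while the depth of the displacement is quadratic. -/
theorem eventually_pos_eq (x : D.PhaseSpace) (C : ℝ) : ∀ᶠ x' in 𝓝 x,
    |cross (D.tangent x) (D.tangent x')| ≤ C * cross (D.tangent x) (D.pos x' - D.pos x) →
      D.pos x' = D.pos x := by
  obtain ⟨l, θ, φ⟩ := x
  obtain ⟨s, rfl⟩ := QuotientAddGroup.mk_surjective θ
  set x : D.PhaseSpace := ⟨l, (s : AddCircle (D.perimeter l)), φ⟩ with hx
  have h1 := hasDerivAt_cross (deriv (D.curve l) s) (D.hasDerivAt_deriv l s)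
  have h2 := (hasDerivAt_cross (deriv (D.curve l) s)
    ((D.hasDerivAt_curve l s).sub_const (D.curve l s))).const_mul C
  rw [cross_self, mul_zero] at h2
  have hpos : 0 < cross (deriv (D.curve l) s) (deriv (deriv (D.curve l)) s) := D.curvature_pos l s
  have E1 := eventually_sign_of_hasDerivAt (h1.sub h2) (by simp [cross_eq]; ring_nf)
    (by simpa using hpos)
  have E2 := eventually_sign_of_hasDerivAt (h1.add h2) (by simp [cross_eq]; ring_nf)
    (by simpa using hpos)
  have E : ∀ᶠ y in 𝓝 (s, φ), (fun x' : D.PhaseSpace => |cross (D.tangent x) (D.tangent x')| ≤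
      C * cross (D.tangent x) (D.pos x' - D.pos x) → D.pos x' = D.pos x)
      (⟨l, (y.1 : AddCircle (D.perimeter l)), y.2⟩ : D.PhaseSpace) := by
    have hc := (_root_.continuous_fst (X := ℝ)
      (Y := Set.Icc (-(Real.pi / 2)) (Real.pi / 2))).tendsto (s, φ)
    filter_upwards [hc.eventually E1, hc.eventually E2] with y h3 h4 h5
    have h6 : |cross (deriv (D.curve l) s) (deriv (D.curve l) y.1)| ≤
        C * cross (deriv (D.curve l) s) (D.curve l y.1 - D.curve l s) := h5
    rw [abs_le] at h6
    rcases lt_trichotomy s y.1 with hlt | heq | hlt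
    · have := h3.1 hlt
      simp only [Pi.sub_apply] at this
      linarith
    · change D.curve l y.1 = D.curve l s
      rw [← heq]
    · have := h4.2 hlt
      simp only [Pi.add_apply] at this
      linarith
  exact nhds_le_map l s φ E

end Separation

end Table

namespace Table

/-! ### Trajectories in a strip -/

variable {r m : ℕ} {D : Table r m}

theorem vel_add_vin (x : D.PhaseSpace) :
    D.vel x + D.vin x = ((2 * Real.sin (D.angle x) : ℝ) : ℂ) * D.tangent x := by
  have h : D.vin x = -D.vel (rev x) := by rw [vel_rev, neg_neg]
  rw [h]
  apply Complex.ext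
  · simp only [Complex.add_re, Complex.neg_re, vel_re, tangent_rev, angle_rev, Real.cos_neg,
      Real.sin_neg, Complex.mul_re, Complex.ofReal_re, Complex.ofReal_im]
    ring
  · simp only [Complex.add_im, Complex.neg_im, vel_im, tangent_rev, angle_rev, Real.cos_neg,
      Real.sin_neg, Complex.mul_im, Complex.ofReal_re, Complex.ofReal_im]
    ring

theorem vel_sub_vin (x : D.PhaseSpace) :
    D.vel x - D.vin x = ((2 * Real.cos (D.angle x) : ℝ) : ℂ) * D.normal x := by
  have h : D.vin x = -D.vel (rev x) := by rw [vel_rev, neg_neg]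
  rw [h, normal]
  apply Complex.ext
  · simp [vel_re, -Complex.ofReal_cos]; ring
  · simp [vel_im, -Complex.ofReal_cos]; ring

variable [hr : Fact (2 ≤ r)]

/-- The closed scatterer of a lifted state lies on the left of the tangent line. -/
theorem cross_tangent_pos {p : D.LiftedState} {z : ℂ} (hz : z ∈ D.closedObstacle (label p))
    (hne : z ≠ D.liftedPos p) : 0 < cross (D.tangent p.2) (z - D.liftedPos p) := by
  have h1 := cross_tangent_pos_of_mem_closure p.2 (z := z - latticeVec p.1) hz
    (fun h => hne (by rw [liftedPos, ← h]; ring))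
  rwa [sub_sub] at h1

theorem cross_tangent_nonneg {p : D.LiftedState} {z : ℂ} (hz : z ∈ D.closedObstacle (label p)) :
    0 ≤ cross (D.tangent p.2) (z - D.liftedPos p) := by
  by_cases hne : z = D.liftedPos p
  · simp [hne, cross_eq]
  · exact (cross_tangent_pos hz hne).le

/-- Two different collisions with an obstacle that have the same incoming and the same outgoing
velocity are grazing, on opposite sides of the obstacle. -/
theorem tangent_eq_neg_of_vel_eq {x y : D.PhaseSpace} (hl : x.1 = y.1)
    (hvel : D.vel x = D.vel y) (hvin : D.vin x = D.vin y) (hne : D.pos x ≠ D.pos y) :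
    D.tangent y = -D.tangent x ∧ cross (D.tangent x) (D.vel x) = 0 ∧ D.vin x = D.vel x := by
  have h1 : D.tangent x ^ 2 = D.tangent y ^ 2 := by
    rw [← vin_mul_vel, ← vin_mul_vel, hvel, hvin]
  have h2 : D.tangent y = -D.tangent x := by
    rcases sq_eq_sq_iff_eq_or_eq_neg.mp h1 with h | h
    · exact absurd (pos_eq_of_tangent_eq hl h) hne
    · rw [h, neg_neg]
  have h3 := cross_tangent_vel x
  have h4 := cross_tangent_vel y
  rw [h2, neg_cross, ← hvel] at h4
  have h5 := cos_angle_nonneg x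
  have h6 := cos_angle_nonneg y
  have h7 : Real.cos (D.angle x) = 0 := by linarith
  refine ⟨h2, by linarith, ?_⟩
  have h8 := vel_sub_vin x
  rw [h7] at h8
  simp only [mul_zero, Complex.ofReal_zero, zero_mul] at h8
  exact (sub_eq_zero.mp h8).symm

/-- Limits of trajectories: they obey the law of reflection, but their flights may touch
scatterers. -/
structure IsLimitTraj (δ : ℝ) (P : ℕ → D.LiftedState) : Prop where
  le_norm : ∀ j, δ ≤ ‖D.liftedPos (P (j + 1)) - D.liftedPos (P j)‖
  flight : ∀ j, D.liftedPos (P (j + 1)) - D.liftedPos (P j) =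
    ‖D.liftedPos (P (j + 1)) - D.liftedPos (P j)‖ * D.vel (P j).2
  vin_eq : ∀ j, D.vin (P (j + 1)).2 = D.vel (P j).2

/-- Two limit trajectories with the same labels and the same velocities that start at different
points are parallel lines, and all their scatterers lie in the strip between them. -/
theorem IsLimitTraj.strip {δ : ℝ} {P Q : ℕ → D.LiftedState} {N : ℕ} (hP : IsLimitTraj δ P)
    (hQ : IsLimitTraj δ Q) (hlab : ∀ j < N, label (P j) = label (Q j))
    (hvel : ∀ j < N, D.vel (P j).2 = D.vel (Q j).2) (hvin : D.vin (P 0).2 = D.vin (Q 0).2)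
    (hne : D.liftedPos (P 0) ≠ D.liftedPos (Q 0)) : ∀ j < N,
      D.vel (P j).2 = D.vel (P 0).2 ∧ D.vin (P j).2 = D.vel (P 0).2 ∧
      D.tangent (P j).2 = D.tangent (P 0).2 ∧
      cross (D.tangent (P 0).2) (D.vel (P 0).2) = 0 := by
  suffices h : ∀ j < N, D.vel (P j).2 = D.vel (P 0).2 ∧ D.vin (P j).2 = D.vel (P 0).2 ∧
      D.tangent (P j).2 = D.tangent (P 0).2 ∧
      cross (D.tangent (P 0).2) (D.vel (P 0).2) = 0 ∧
      0 < cross (D.tangent (P 0).2) (D.liftedPos (Q j) - D.liftedPos (P j)) from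
    fun j hj => ⟨(h j hj).1, (h j hj).2.1, (h j hj).2.2.1, (h j hj).2.2.2.1⟩
  have hpos : ∀ j, label (P j) = label (Q j) → D.liftedPos (P j) ≠ D.liftedPos (Q j) →
      D.pos (P j).2 ≠ D.pos (Q j).2 := by
    intro j hj hne h
    have : (P j).1 = (Q j).1 := (Prod.ext_iff.mp hj).1
    exact hne (by rw [liftedPos, liftedPos, h, this])
  have hmem : ∀ j, label (P j) = label (Q j) →
      D.liftedPos (Q j) ∈ D.closedObstacle (label (P j)) := fun j hj =>
    hj ▸ liftedPos_mem_closedObstacle (Q j)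
  intro j
  induction j with
  | zero =>
    intro h0
    obtain ⟨-, h2, h3⟩ := tangent_eq_neg_of_vel_eq (Prod.ext_iff.mp (hlab 0 h0)).2 (hvel 0 h0) hvin
      (hpos 0 (hlab 0 h0) hne)
    exact ⟨rfl, h3, rfl, h2, cross_tangent_pos (hmem 0 (hlab 0 h0)) hne.symm⟩
  | succ j ih =>
    intro hj
    obtain ⟨i1, -, -, i4, i5⟩ := ih (by omega)
    have hvinP := hP.vin_eq j
    have hvinQ := hQ.vin_eq j
    rw [i1] at hvinP
    rw [← hvel j (by omega), i1] at hvinQ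
    -- both flights are parallel to the strip
    have h1 : 0 < cross (D.tangent (P 0).2)
        (D.liftedPos (Q (j + 1)) - D.liftedPos (P (j + 1))) := by
      have e1 := congrArg (cross (D.tangent (P 0).2)) (hP.flight j)
      have e2 := congrArg (cross (D.tangent (P 0).2)) (hQ.flight j)
      rw [cross_real_mul, i1, i4, mul_zero, cross_sub] at e1
      rw [cross_real_mul, ← hvel j (by omega), i1, i4, mul_zero, cross_sub] at e2
      rw [cross_sub] at i5 ⊢
      linarith
    have hne' : D.liftedPos (P (j + 1)) ≠ D.liftedPos (Q (j + 1)) := by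
      intro h
      rw [h, sub_self] at h1
      simp [cross_eq] at h1
    obtain ⟨-, h2, h3⟩ := tangent_eq_neg_of_vel_eq (Prod.ext_iff.mp (hlab _ hj)).2 (hvel _ hj)
      (hvinP.trans hvinQ.symm) (hpos _ (hlab _ hj) hne')
    have h4 := cross_tangent_pos (hmem _ (hlab _ hj)) hne'.symm
    rw [← h3, hvinP] at h2
    have h5 : D.tangent (P (j + 1)).2 = D.tangent (P 0).2 := by
      rcases eq_or_eq_neg_of_cross_eq_zero (norm_tangent _) (norm_vel _) h2 with h6 | h6 <;>
      rcases eq_or_eq_neg_of_cross_eq_zero (norm_tangent _) (norm_vel _) i4 with h7 | h7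
      · rw [h6, h7]
      · exfalso
        rw [h6] at h4
        rw [h7, neg_cross] at h1
        linarith
      · exfalso
        rw [h6, neg_cross] at h4
        rw [h7] at h1
        linarith
      · rw [h6, h7]
    exact ⟨h3.symm.trans hvinP, hvinP, h5, i4, h1⟩

variable [hD : Fact D.FiniteHorizon]

/-- Trajectories near a line that touches three consecutive scatterers from the same side agree
with this line at the middle one: the depth of the point at which they hit the middle scatterer is
at least linear in the rotation of the tangent there. -/
theorem eventually_liftedPos_eq {δ : ℝ} (hδ0 : 0 < δ) (hδ : ∀ p : D.LiftedState, δ ≤ D.flight p)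
    {p₀ p₁ p₂ : D.LiftedState} {t : ℂ} {e : ℂ} (ht : ‖t‖ = 1) (he : cross t e = 0)
    (ht0 : D.tangent p₀.2 = t) (ht1 : D.tangent p₁.2 = t) (ht2 : D.tangent p₂.2 = t)
    (hv : D.vel p₁.2 = e)
    (h01 : cross t (D.liftedPos p₁ - D.liftedPos p₀) = 0)
    (h12 : cross t (D.liftedPos p₂ - D.liftedPos p₁) = 0)
    {F : Filter ℕ} {Z : ℕ → D.LiftedState} (hZ0 : Tendsto Z F (𝓝 p₀))
    (hZ1 : Tendsto (fun n => next (Z n)) F (𝓝 p₁))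
    (hZ2 : Tendsto (fun n => next (next (Z n))) F (𝓝 p₂)) :
    ∀ᶠ n in F, D.liftedPos (next (Z n)) = D.liftedPos p₁ := by
  have hlab : ∀ {Z : ℕ → D.LiftedState} {p}, Tendsto Z F (𝓝 p) → ∀ᶠ n in F, label (Z n) = label p :=
    fun {Z p} hZ => hZ.eventually
      (continuous_label.continuousAt.eventually ((isOpen_discrete {label p}).mem_nhds rfl))
  have hcos : Real.cos (D.angle p₁.2) = 0 := by
    have := cross_tangent_vel p₁.2
    rw [ht1, hv, he] at this
    linarith
  have hZ12 : Tendsto (fun n => (next (Z n)).2) F (𝓝 p₁.2) :=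
    (_root_.continuous_snd.tendsto _).comp hZ1
  have E1 := hZ12.eventually (eventually_pos_eq p₁.2 (2 / δ))
  have E2 : ∀ᶠ n in F, 1 / 2 < |Real.sin (D.angle (next (Z n)).2)| := by
    have hc : Continuous fun x : D.PhaseSpace => |Real.sin (D.angle x)| := by fun_prop
    refine ((hc.tendsto _).comp hZ12).eventually (lt_mem_nhds ?_)
    have h1 := Real.sin_sq_add_cos_sq (D.angle p₁.2)
    rw [hcos] at h1
    have h2 : |Real.sin (D.angle p₁.2)| = 1 := by
      rw [← sq_eq_sq₀ (abs_nonneg _) zero_le_one, sq_abs]; linarith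
    rw [h2]; norm_num
  have E3 : ∀ᶠ n in F, cross t (D.normal (next (Z n)).2) < 0 := by
    have hc : Continuous fun x : D.PhaseSpace => cross t (D.normal x) := by
      unfold normal
      exact continuous_cross.comp (continuous_const.prodMk
        (continuous_const.mul (continuous_tangent D)))
    refine ((hc.tendsto _).comp hZ12).eventually (gt_mem_nhds ?_)
    have := sq_add_sq_of_norm_eq_one ht
    rw [normal, ht1, cross_eq]
    simp
    nlinarith
  filter_upwards [hlab hZ0, hlab hZ1, hlab hZ2, E1, E2, E3] with n l0 l1 l2 h1 h2 h3
  have d0 : 0 ≤ cross t (D.liftedPos (Z n) - D.liftedPos p₀) := by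
    rw [← ht0]; exact cross_tangent_nonneg (l0 ▸ liftedPos_mem_closedObstacle _)
  have d1 : 0 ≤ cross t (D.liftedPos (next (Z n)) - D.liftedPos p₁) := by
    rw [← ht1]; exact cross_tangent_nonneg (l1 ▸ liftedPos_mem_closedObstacle _)
  have d2 : 0 ≤ cross t (D.liftedPos (next (next (Z n))) - D.liftedPos p₂) := by
    rw [← ht2]; exact cross_tangent_nonneg (l2 ▸ liftedPos_mem_closedObstacle _)
  have hl1 : (next (Z n)).1 = p₁.1 := (Prod.ext_iff.mp l1).1
  have hdiff : D.liftedPos (next (Z n)) - D.liftedPos p₁ = D.pos (next (Z n)).2 - D.pos p₁.2 := by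
    rw [liftedPos, liftedPos, hl1]; ring
  set d := cross t (D.liftedPos (next (Z n)) - D.liftedPos p₁) with hd
  have f0 : D.flight (Z n) * cross t (D.vin (next (Z n)).2) ≤ d := by
    have h4 := congrArg (cross t) (liftedPos_next (Z n))
    rw [cross_add, cross_real_mul, ← vin_next] at h4
    simp only [cross_sub] at d0 h01 hd
    linarith
  have f1 : -d ≤ D.flight (next (Z n)) * cross t (D.vel (next (Z n)).2) := by
    have h4 := congrArg (cross t) (liftedPos_next (next (Z n)))
    rw [cross_add, cross_real_mul] at h4
    simp only [cross_sub] at d2 h12 hd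
    linarith
  have hmono : cross t (D.vel (next (Z n)).2) ≤ cross t (D.vin (next (Z n)).2) := by
    have h4 := congrArg (cross t) (vel_sub_vin (next (Z n)).2)
    rw [cross_sub, cross_real_mul] at h4
    nlinarith [cos_angle_nonneg (next (Z n)).2]
  have g0 : cross t (D.vin (next (Z n)).2) ≤ d / δ := by
    rw [le_div_iff₀ hδ0]
    rcases le_total 0 (cross t (D.vin (next (Z n)).2)) with h | h <;> nlinarith [hδ (Z n)]
  have g1 : -(d / δ) ≤ cross t (D.vel (next (Z n)).2) := by
    rw [← neg_div, div_le_iff₀ hδ0]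
    rcases le_total 0 (cross t (D.vel (next (Z n)).2)) with h | h <;> nlinarith [hδ (next (Z n))]
  have hsum : |2 * Real.sin (D.angle (next (Z n)).2) * cross t (D.tangent (next (Z n)).2)| ≤
      2 * (d / δ) := by
    rw [← cross_real_mul, ← vel_add_vin, cross_add, abs_le]
    constructor <;> linarith
  have hfin : |cross (D.tangent p₁.2) (D.tangent (next (Z n)).2)| ≤
      2 / δ * cross (D.tangent p₁.2) (D.pos (next (Z n)).2 - D.pos p₁.2) := by
    rw [ht1, ← hdiff, ← hd]
    rw [abs_mul, abs_mul, abs_two] at hsum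
    have : 2 / δ * d = 2 * (d / δ) := by ring
    rw [this]
    nlinarith [abs_nonneg (cross t (D.tangent (next (Z n)).2))]
  rw [liftedPos, liftedPos, hl1, h1 hfin]

omit hD in
/-- A line that touches all the scatterers it meets during the time `T` from the same side gives
arbitrarily long flights after a small rotation, contrary to finite horizon. -/
theorem not_oneSided {T : ℝ} (hT : ∀ x : D.PhaseSpace, ∃ t : ℝ, 0 < t ∧ t ≤ T ∧
      ∃ a : Alphabet m, D.pos x + t * D.vel x ∈ D.scatterer a)
    (p : D.LiftedState) (hp : cross (D.tangent p.2) (D.vel p.2) = 0)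
    (hside : ∀ t : ℝ, 0 ≤ t → t ≤ T → ∀ a, D.liftedPos p + t * D.vel p.2 ∈ D.scatterer a →
      ∀ z ∈ D.closedObstacle a, 0 ≤ cross (D.tangent p.2) (z - D.liftedPos p)) : False := by
  set e := D.vel p.2 with he
  set τ := D.tangent p.2 with hτ
  have hτ1 := sq_add_sq_of_norm_eq_one (norm_tangent p.2)
  rw [← hτ] at hτ1
  -- the ray is rotated away from the obstacle by a small angle `ε`
  set w : ℝ → ℂ := fun ε => Real.cos ε * e - Real.sin ε * (Complex.I * τ) with hw
  have hcw : ∀ ε, cross τ (w ε) = -Real.sin ε := by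
    intro ε
    simp only [hw]
    rw [cross_sub, cross_real_mul, cross_real_mul, hp, cross_eq]
    simp only [Complex.mul_re, Complex.mul_im, Complex.I_re, Complex.I_im]
    linear_combination (-Real.sin ε) * hτ1
  have hwn : ∀ ε, ‖w ε‖ = 1 := by
    intro ε
    have h1 : w ε = (Real.cos ε - Real.sin ε * Complex.I) * e ∨
        w ε = (Real.cos ε + Real.sin ε * Complex.I) * e := by
      rcases eq_or_eq_neg_of_cross_eq_zero (norm_tangent p.2) (norm_vel p.2) hp with h | h
      · left; simp only [hw]; rw [hτ, h, ← he]; ring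
      · right; simp only [hw]; rw [hτ, h, ← he]; ring
    have h2 : ‖(Real.cos ε + Real.sin ε * Complex.I : ℂ)‖ = 1 := by
      rw [Complex.ofReal_cos, Complex.ofReal_sin, ← Complex.exp_mul_I]
      exact Complex.norm_exp_ofReal_mul_I ε
    rcases h1 with h | h
    · rw [h, norm_mul, he, norm_vel, mul_one, ← h2, ← Complex.norm_conj]
      simp [-Complex.ofReal_cos, -Complex.ofReal_sin, sub_eq_add_neg]
    · rw [h, norm_mul, he, norm_vel, mul_one, h2]
  have hex : ∀ ε : ℝ, ∃ t : ℝ, ∃ a : Alphabet m, 0 ≤ Real.sin ε → 0 < t ∧ t ≤ T ∧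
      D.liftedPos p + t * w ε ∈ D.scatterer a := by
    intro ε
    by_cases hε : 0 ≤ Real.sin ε
    · obtain ⟨φ, hφ⟩ := exists_vel_eq (D := D) p.2.1 p.2.2.1 (hwn ε)
        (by have := hcw ε; change cross τ (w ε) ≤ 0; linarith)
      obtain ⟨t, ht0, htT, a, ha⟩ := hT ⟨p.2.1, p.2.2.1, φ⟩
      rw [hφ] at ha
      refine ⟨t, (p.1 + a.1, a.2), fun _ => ⟨ht0, htT, ?_⟩⟩
      rw [liftedPos, add_assoc, mem_scatterer_add]
      exact ha
    · exact ⟨0, label p, fun h => absurd h hε⟩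
  choose t a hta using hex
  set U : Ultrafilter ℝ := Ultrafilter.of (𝓝[>] (0 : ℝ)) with hU
  have hUle : (U : Filter ℝ) ≤ 𝓝[>] 0 := Ultrafilter.of_le _
  have hsin : ∀ᶠ ε in (U : Filter ℝ), 0 < Real.sin ε := by
    refine hUle ?_
    filter_upwards [Ioo_mem_nhdsGT Real.pi_pos] with ε hε using Real.sin_pos_of_mem_Ioo hε
  have hgood := hsin.mono fun ε hε => hta ε hε.le
  obtain ⟨t₀, ht₀, htt₀⟩ : ∃ t₀ ∈ Icc 0 T, Tendsto t U (𝓝 t₀) :=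
    isCompact_Icc.ultrafilter_le_nhds (U.map t) (by
      rw [le_principal_iff]
      change ∀ᶠ ε in (U : Filter ℝ), t ε ∈ Icc 0 T
      filter_upwards [hgood] with ε hε using ⟨hε.1.le, hε.2.1⟩)
  have hfin := finite_scatterer_meets_ball D (‖D.liftedPos p‖ + T)
  obtain ⟨b, -, hb⟩ : ∃ b ∈ {a : Alphabet m | ∃ z ∈ D.scatterer a, ‖z‖ ≤ ‖D.liftedPos p‖ + T},
      Tendsto a U (𝓝 b) := hfin.isCompact.ultrafilter_le_nhds (U.map a) (by
    rw [le_principal_iff]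
    change ∀ᶠ ε in (U : Filter ℝ), ∃ z ∈ D.scatterer (a ε), ‖z‖ ≤ ‖D.liftedPos p‖ + T
    filter_upwards [hgood] with ε hε
    refine ⟨_, hε.2.2, (norm_add_le _ _).trans ?_⟩
    rw [norm_mul, hwn, Complex.norm_real, Real.norm_of_nonneg hε.1.le]
    linarith [hε.2.1])
  rw [nhds_discrete, tendsto_pure] at hb
  have hwlim : Tendsto w U (𝓝 e) := by
    have hc : Continuous w := by fun_prop
    have h := (hc.tendsto 0).mono_left (hUle.trans nhdsWithin_le_nhds)
    simpa [hw] using h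
  have hlim : Tendsto (fun ε => D.liftedPos p + t ε * w ε) U (𝓝 (D.liftedPos p + t₀ * e)) :=
    tendsto_const_nhds.add (((Complex.continuous_ofReal.tendsto _).comp htt₀).mul hwlim)
  have hmem : D.liftedPos p + t₀ * e ∈ D.scatterer b := by
    refine (isClosed_scatterer b).mem_of_tendsto hlim ?_
    filter_upwards [hgood, hb] with ε h1 h2 using h2 ▸ h1.2.2
  obtain ⟨ε, h1, h2, h3⟩ := (hgood.and (hb.and hsin)).exists
  have h4 := hside t₀ ht₀.1 ht₀.2 b hmem _ (scatterer_subset _ (h2 ▸ h1.2.2))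
  rw [add_sub_cancel_left, cross_real_mul, hcw] at h4
  nlinarith [h1.1]

end Table

namespace Table

/-! ### Uniform separation of trajectories with the same labels -/

variable {r m : ℕ} {D : Table r m} [hr : Fact (2 ≤ r)] [hD : Fact D.FiniteHorizon]

/-- Along an ultrafilter, the collisions with a given number have a limit. -/
theorem exists_tendsto_traj (x : ℕ → D.PhaseSpace) (U : Ultrafilter ℕ) (j : ℕ) :
    ∃ P : D.LiftedState, Tendsto (fun n => D.traj (x n) j) U (𝓝 P) := by
  obtain ⟨R, hR⟩ := exists_norm_pos_le (D := D)
  obtain ⟨T, hT0, -, hT⟩ := exists_flight_le D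
  have hbound : ∀ x : D.PhaseSpace, ‖D.liftedPos (D.traj x j)‖ ≤ R + j * T := by
    intro x
    induction j with
    | zero => simpa [liftedPos] using hR x
    | succ j ih =>
      rw [Nat.cast_succ, traj_add_one]
      have h1 := norm_sub_norm_le (D.liftedPos (next (D.traj x j))) (D.liftedPos (D.traj x j))
      have h2 := hT (D.traj x j)
      push_cast
      linarith
  have hK : IsCompact ({k : ℤ × ℤ | ‖latticeVec k‖ ≤ R + j * T + R} ×ˢ
      (univ : Set D.PhaseSpace)) := (finite_latticeVec_norm_le _).isCompact.prod isCompact_univ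
  obtain ⟨P, -, hP⟩ := hK.ultrafilter_le_nhds (U.map fun n => D.traj (x n) j) (by
    rw [le_principal_iff]
    refine Eventually.of_forall (f := (U : Filter ℕ)) fun n => ⟨?_, mem_univ _⟩
    have h1 := hbound (x n)
    have h2 := norm_sub_le (D.liftedPos (D.traj (x n) j)) (D.pos (D.traj (x n) j).2)
    have h3 := hR (D.traj (x n) j).2
    rw [liftedPos, add_sub_cancel_right, ← liftedPos] at h2
    exact h2.trans (add_le_add h1 h3))
  exact ⟨P, hP⟩

theorem isLimitTraj_of_tendsto {δ : ℝ} (hδ : ∀ p : D.LiftedState, δ ≤ D.flight p)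
    {x : ℕ → D.PhaseSpace} {F : Filter ℕ} [F.NeBot] {P : ℕ → D.LiftedState}
    (h : ∀ j : ℕ, Tendsto (fun n => D.traj (x n) j) F (𝓝 (P j))) : IsLimitTraj δ P := by
  have hpos : ∀ j : ℕ, Tendsto (fun n => D.liftedPos (D.traj (x n) j)) F
      (𝓝 (D.liftedPos (P j))) := fun j => (continuous_liftedPos.tendsto _).comp (h j)
  have hvel : ∀ j : ℕ, Tendsto (fun n => D.vel (D.traj (x n) j).2) F (𝓝 (D.vel (P j).2)) :=
    fun j => (((continuous_vel D).comp _root_.continuous_snd).tendsto _).comp (h j)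
  have hvin : ∀ j : ℕ, Tendsto (fun n => D.vin (D.traj (x n) j).2) F (𝓝 (D.vin (P j).2)) :=
    fun j => (((continuous_vin D).comp _root_.continuous_snd).tendsto _).comp (h j)
  have hdiff := fun j => (hpos (j + 1)).sub (hpos j)
  have hnext : ∀ (n j : ℕ), D.traj (x n) ((j + 1 : ℕ) : ℤ) = next (D.traj (x n) j) := fun n j => by
    rw [Nat.cast_succ, traj_add_one]
  refine ⟨fun j => ?_, fun j => ?_, fun j => ?_⟩
  · refine ge_of_tendsto (hdiff j).norm (Eventually.of_forall fun n => ?_)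
    rw [hnext]; exact hδ _
  · refine tendsto_nhds_unique (hdiff j) ?_
    refine (((Complex.continuous_ofReal.tendsto _).comp (hdiff j).norm).mul (hvel j)).congr
      fun n => ?_
    have := liftedPos_next (D.traj (x n) j)
    simp only [Function.comp_apply]
    rw [hnext, this, add_sub_cancel_left, norm_mul, norm_vel, mul_one, Complex.norm_real,
      Real.norm_of_nonneg (flight_pos _).le]
  · refine tendsto_nhds_unique (hvin (j + 1)) ((hvel j).congr fun n => ?_)
    rw [hnext, vin_next]

/-- Two trajectories with the same labels whose limits are parallel lines at a positive distance
cannot exist under finite horizon. -/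
theorem IsLimitTraj.false_of_strip {δ T : ℝ} (hδ0 : 0 < δ)
    (hδ : ∀ p : D.LiftedState, δ ≤ D.flight p)
    (hT : ∀ x : D.PhaseSpace, ∃ t : ℝ, 0 < t ∧ t ≤ T ∧
      ∃ a : Alphabet m, D.pos x + t * D.vel x ∈ D.scatterer a) {k : ℕ} (hk : T ≤ k * δ)
    {P : ℕ → D.LiftedState} (hP : IsLimitTraj δ P)
    (hstrip : ∀ j < k + 3, D.vel (P j).2 = D.vel (P 0).2 ∧ D.vin (P j).2 = D.vel (P 0).2 ∧
      D.tangent (P j).2 = D.tangent (P 0).2 ∧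
      cross (D.tangent (P 0).2) (D.vel (P 0).2) = 0)
    {x : ℕ → D.PhaseSpace} {F : Filter ℕ} [F.NeBot]
    (hx : ∀ j : ℕ, Tendsto (fun n => D.traj (x n) j) F (𝓝 (P j))) : False := by
  set t := D.tangent (P 0).2 with ht
  set e := D.vel (P 0).2 with he
  have hte : cross t e = 0 := (hstrip 0 (by omega)).2.2.2
  have hflight : ∀ j < k + 3, D.liftedPos (P (j + 1)) = D.liftedPos (P j) +
      ‖D.liftedPos (P (j + 1)) - D.liftedPos (P j)‖ * e := by
    intro j hj
    rw [← (hstrip j hj).1, ← hP.flight j]; ring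
  have hline : ∀ j < k + 3, cross t (D.liftedPos (P (j + 1)) - D.liftedPos (P j)) = 0 := by
    intro j hj
    rw [hP.flight j, (hstrip j hj).1, cross_real_mul, hte, mul_zero]
  -- nearby trajectories follow the limit line exactly
  have hexact : ∀ᶠ n in F, ∀ j ∈ Icc 1 (k + 1), D.liftedPos (D.traj (x n) j) =
      D.liftedPos (P j) := by
    refine (eventually_all_finite (finite_Icc _ _)).mpr fun j hj => ?_
    obtain ⟨i, rfl⟩ : ∃ i, j = i + 1 := ⟨j - 1, by have := hj.1; omega⟩
    have hi : i + 2 < k + 3 := by have := hj.2; omega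
    have h1 := hx (i + 1)
    have h2 := hx (i + 2)
    have e1 : ∀ n, D.traj (x n) ((i + 1 : ℕ) : ℤ) = next (D.traj (x n) i) := fun n => by
      rw [Nat.cast_succ, traj_add_one]
    have e2 : ∀ n, D.traj (x n) ((i + 2 : ℕ) : ℤ) = next (next (D.traj (x n) i)) := fun n => by
      rw [← e1, ← traj_add_one]; push_cast; congr 1
    simp only [e1] at h1 ⊢
    simp only [e2] at h2
    exact eventually_liftedPos_eq hδ0 hδ (norm_tangent _) hte
      (hstrip i (by omega)).2.2.1 (hstrip (i + 1) (by omega)).2.2.1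
      (hstrip (i + 2) (by omega)).2.2.1 (hstrip (i + 1) (by omega)).1
      (hline i (by omega)) (hline (i + 1) (by omega)) (hx i) h1 h2
  obtain ⟨n, hn⟩ := hexact.exists
  have hfree : ∀ j, 1 ≤ j → j + 1 ≤ k + 1 → ∀ u : ℝ, 0 < u →
      u < ‖D.liftedPos (P (j + 1)) - D.liftedPos (P j)‖ → ∀ a : Alphabet m,
        D.liftedPos (P j) + u * e ∉ D.scatterer a := by
    intro j hj1 hj2 u hu0 hu a
    have h1 := hn j ⟨hj1, by omega⟩
    have h2 := hn (j + 1) ⟨by omega, hj2⟩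
    rw [Nat.cast_succ, traj_add_one] at h2
    have h3 : D.flight (D.traj (x n) j) = ‖D.liftedPos (P (j + 1)) - D.liftedPos (P j)‖ := by
      rw [Table.flight, h1, h2]
    have h4 := liftedPos_next (D.traj (x n) j)
    rw [h1, h2, h3, hflight j (by omega), add_right_inj] at h4
    have h5 : ((‖D.liftedPos (P (j + 1)) - D.liftedPos (P j)‖ : ℝ) : ℂ) ≠ 0 := by
      exact_mod_cast (hδ0.trans_le (hP.le_norm j)).ne'
    rw [← hflight j (by omega)] at h4
    have h6 := mul_left_cancel₀ h5 h4
    have h7 := flight_free (D.traj (x n) j) hu0 (by rwa [h3]) a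
    rwa [h1, ← h6] at h7
  have hhit : ∀ i j : ℕ, 1 ≤ j → j + i ≤ k + 1 → ∀ u : ℝ, 0 ≤ u → u ≤ i * δ → ∀ a : Alphabet m,
      D.liftedPos (P j) + u * e ∈ D.scatterer a → ∃ j' ≤ k + 1, a = label (P j') := by
    intro i
    induction i with
    | zero =>
      intro j hj1 hj2 u hu0 hu a ha
      have : u = 0 := le_antisymm (by simpa using hu) hu0
      rw [this] at ha
      exact ⟨j, by omega, liftedPos_mem_iff.mp (by simpa using ha)⟩
    | succ i ih =>
      intro j hj1 hj2 u hu0 hu a ha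
      rcases hu0.eq_or_lt with h0 | h0
      · rw [← h0] at ha
        exact ⟨j, by omega, liftedPos_mem_iff.mp (by simpa using ha)⟩
      have h1 : ‖D.liftedPos (P (j + 1)) - D.liftedPos (P j)‖ ≤ u := by
        by_contra! hlt
        exact hfree j hj1 (by omega) u h0 hlt a ha
      refine ih (j + 1) (by omega) (by omega)
        (u - ‖D.liftedPos (P (j + 1)) - D.liftedPos (P j)‖) (by linarith) ?_ a ?_
      · have := hP.le_norm j
        push_cast at hu
        linarith
      · rw [hflight j (by omega)]
        rw [← hflight j (by omega)]
        convert ha using 1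
        push_cast
        linear_combination hflight j (by omega)
  have hbase : ∀ j < k + 3, cross t (D.liftedPos (P j) - D.liftedPos (P 0)) = 0 := by
    intro j
    induction j with
    | zero => intro _; simp [cross_eq]
    | succ j ih =>
      intro hj
      have h1 := ih (by omega)
      have h2 := hline j (by omega)
      rw [cross_sub] at *
      linarith
  have h1 := hstrip 1 (by omega)
  refine not_oneSided hT (P 1) (by rw [h1.2.2.1, h1.1]; exact hte) ?_
  rw [h1.2.2.1, h1.1]
  intro u hu0 hu a ha z hz
  obtain ⟨j, hj, rfl⟩ := hhit k 1 le_rfl (by omega) u hu0 (hu.trans hk) a ha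
  have h2 := cross_tangent_nonneg hz
  rw [(hstrip j (by omega)).2.2.1] at h2
  have h3 := hbase j (by omega)
  have h4 := hbase 1 (by omega)
  rw [cross_sub] at *
  linarith

/-- Trajectories that meet the same scatterers for a while are separated by their velocities, up
to a constant. Otherwise, there are two sequences of trajectories along which the velocities become
equal. If their limits start at the same point, then the local separation at this point is violated;
if not, then the limits are parallel lines that bound a strip, which is impossible under finite
horizon. -/
theorem exists_separation (D : Table r m) [hD : Fact D.FiniteHorizon] :
    ∃ N : ℕ, 0 < N ∧ ∃ c : ℝ, 0 < c ∧ ∀ x y : D.PhaseSpace,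
      (∀ j < N, label (D.traj x (j : ℕ)) = label (D.traj y (j : ℕ))) →
      c * (dist x y + ‖D.pos x - D.pos y‖) ≤ ‖D.vin x - D.vin y‖ +
        ∑ j ∈ Finset.range N, ‖D.vel (D.traj x (j : ℕ)).2 - D.vel (D.traj y (j : ℕ)).2‖ := by
  obtain ⟨δ, hδ0, hδ⟩ := exists_le_flight D
  obtain ⟨T, hT0, hT, -⟩ := exists_flight_le D
  obtain ⟨R, hR⟩ := exists_norm_pos_le (D := D)
  set k := ⌈T / δ⌉₊ with hk
  have hkT : T ≤ k * δ := by
    rw [← div_le_iff₀ hδ0]; exact Nat.le_ceil _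
  refine ⟨k + 3, by omega, ?_⟩
  by_contra! hcon
  have hcon' := fun n : ℕ => hcon (1 / ((n : ℝ) + 1)) (by positivity)
  choose x y hlab hlt using hcon'
  set E : ℕ → ℝ := fun n => dist (x n) (y n) + ‖D.pos (x n) - D.pos (y n)‖ with hE
  set S : ℕ → ℝ := fun n => ‖D.vin (x n) - D.vin (y n)‖ + ∑ j ∈ Finset.range (k + 3),
    ‖D.vel (D.traj (x n) (j : ℕ)).2 - D.vel (D.traj (y n) (j : ℕ)).2‖ with hS
  set M := Metric.diam (univ : Set D.PhaseSpace) + 2 * R with hM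
  have hEM : ∀ n, E n ≤ M := by
    intro n
    have h1 : dist (x n) (y n) ≤ Metric.diam (univ : Set D.PhaseSpace) :=
      Metric.dist_le_diam_of_mem isCompact_univ.isBounded (mem_univ _) (mem_univ _)
    have h2 := norm_sub_le (D.pos (x n)) (D.pos (y n))
    simp only [hE, hM]
    linarith [hR (x n), hR (y n)]
  have hSle : ∀ n, S n ≤ M * (1 / ((n : ℝ) + 1)) := by
    intro n
    refine (hlt n).le.trans ?_
    rw [mul_comm]
    exact mul_le_mul_of_nonneg_right (hEM n) (by positivity)
  set U := hyperfilter ℕ with hU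
  have hUle : (U : Filter ℕ) ≤ atTop := by
    rw [hU, ← Nat.cofinite_eq_atTop]; exact hyperfilter_le_cofinite
  have hS0 : Tendsto (fun n : ℕ => M * (1 / ((n : ℝ) + 1))) U (𝓝 0) := by
    have := tendsto_one_div_add_atTop_nhds_zero_nat (𝕜 := ℝ)
    simpa using (this.const_mul M).mono_left hUle
  choose P hP using exists_tendsto_traj x U
  choose Q hQ using exists_tendsto_traj y U
  have hPlim := isLimitTraj_of_tendsto hδ hP
  have hQlim := isLimitTraj_of_tendsto hδ hQ
  have hlabPQ : ∀ j < k + 3, label (P j) = label (Q j) := by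
    intro j hj
    have h1 := ((continuous_label (D := D)).tendsto _).comp (hP j)
    have h2 := ((continuous_label (D := D)).tendsto _).comp (hQ j)
    exact tendsto_nhds_unique h1 (h2.congr fun n => (hlab n j hj).symm)
  have hsmall : ∀ {f : D.PhaseSpace → ℂ}, Continuous f → ∀ j, (∀ n,
      ‖f (D.traj (x n) (j : ℕ)).2 - f (D.traj (y n) (j : ℕ)).2‖ ≤ S n) →
      f (P j).2 = f (Q j).2 := by
    intro f hf j hle
    have h1 := ((hf.comp _root_.continuous_snd).tendsto _).comp (hP j)
    have h2 := ((hf.comp _root_.continuous_snd).tendsto _).comp (hQ j)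
    have h3 := le_of_tendsto_of_tendsto' (h1.sub h2).norm hS0 fun n => (hle n).trans (hSle n)
    exact sub_eq_zero.mp (norm_le_zero_iff.mp h3)
  have hvel : ∀ j < k + 3, D.vel (P j).2 = D.vel (Q j).2 := by
    intro j hj
    refine hsmall (continuous_vel D) j fun n => ?_
    refine le_add_of_nonneg_of_le (norm_nonneg _) ?_
    exact Finset.single_le_sum (f := fun j : ℕ =>
      ‖D.vel (D.traj (x n) (j : ℕ)).2 - D.vel (D.traj (y n) (j : ℕ)).2‖)
      (fun i _ => norm_nonneg _) (Finset.mem_range.mpr hj)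
  have hvin : D.vin (P 0).2 = D.vin (Q 0).2 := by
    refine hsmall (continuous_vin D) 0 fun n => ?_
    rw [Nat.cast_zero, traj_zero, traj_zero]
    exact le_add_of_le_of_nonneg (le_of_eq rfl) (Finset.sum_nonneg fun i _ => norm_nonneg _)
  by_cases hne : D.liftedPos (P 0) = D.liftedPos (Q 0)
  · -- both trajectories have the same limit
    have hfst : (P 0).1 = (Q 0).1 := (Prod.ext_iff.mp (hlabPQ 0 (by omega))).1
    have hPQ : (P 0).2 = (Q 0).2 := by
      refine phaseSpace_ext (Prod.ext_iff.mp (hlabPQ 0 (by omega))).2 ?_ (hvel 0 (by omega))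
      rw [liftedPos, liftedPos, hfst] at hne
      exact add_left_cancel hne
    have hP0 := hP 0
    have hQ0 := hQ 0
    simp only [Nat.cast_zero, traj_zero] at hP0 hQ0
    have hxlim : Tendsto x U (𝓝 (P 0).2) := (_root_.continuous_snd.tendsto _).comp hP0
    have hylim : Tendsto y U (𝓝 (P 0).2) := by
      rw [hPQ]; exact (_root_.continuous_snd.tendsto _).comp hQ0
    obtain ⟨C, hC0, hC⟩ := eventually_dist_le (P 0).2
    have h1 := (hxlim.prodMk hylim).eventually hC
    have h2 : ∀ᶠ n : ℕ in U, C ≤ n := hUle (by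
      filter_upwards [eventually_ge_atTop ⌈C⌉₊] with n hn
      exact (Nat.le_ceil C).trans (by exact_mod_cast hn))
    obtain ⟨n, h3, h4⟩ := (h1.and h2).exists
    have h5 : E n ≤ C * S n := by
      refine h3.trans (mul_le_mul_of_nonneg_left ?_ hC0.le)
      refine add_le_add le_rfl ?_
      have h8 := Finset.single_le_sum (f := fun j : ℕ =>
        ‖D.vel (D.traj (x n) (j : ℕ)).2 - D.vel (D.traj (y n) (j : ℕ)).2‖)
        (fun i _ => norm_nonneg _) (Finset.mem_range.mpr (by omega : 0 < k + 3))
      simpa only [Nat.cast_zero, traj_zero] using h8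
    have h6 : S n < 1 / ((n : ℝ) + 1) * E n := hlt n
    have h7 : 0 ≤ S n := by
      simp only [hS]; positivity
    rw [one_div, inv_mul_eq_div, lt_div_iff₀ (by positivity)] at h6
    nlinarith
  · exact hPlim.false_of_strip hδ0 hδ hT hkT (hPlim.strip hQlim hlabPQ hvel hvin hne) hP

end Table

namespace Table

/-! ### Expansion -/

variable {r m : ℕ} {D : Table r m}

variable (D) in
/-- The pairing of the differences of the velocities and of the positions of two lifted states.
If both follow the same scatterers, it does not decrease in time: it is the derivative of the
convex length functional of broken lines through the scatterers. -/
noncomputable def pairing (p q : D.LiftedState) : ℝ :=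
  inner ℝ (D.vel p.2 - D.vel q.2) (D.liftedPos p - D.liftedPos q)

theorem inner_vel_sub_vin (x : D.PhaseSpace) (z : ℂ) :
    inner ℝ (D.vel x - D.vin x) z = -(2 * Real.cos (D.angle x) * cross (D.tangent x) z) := by
  rw [vel_sub_vin, Complex.inner, normal, cross_eq]
  simp only [map_mul, map_neg, Complex.conj_I, Complex.conj_ofReal, Complex.mul_re, Complex.mul_im,
    Complex.ofReal_re, Complex.ofReal_im, Complex.conj_re, Complex.conj_im, Complex.I_re,
    Complex.I_im, Complex.neg_re, Complex.neg_im]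
  ring

theorem abs_pairing_le (p q : D.LiftedState) : |D.pairing p q| ≤
    ‖D.vel p.2 - D.vel q.2‖ * ‖D.liftedPos p - D.liftedPos q‖ := abs_real_inner_le_norm _ _

theorem norm_liftedPos_sub {p q : D.LiftedState} (h : label p = label q) :
    ‖D.liftedPos p - D.liftedPos q‖ = ‖D.pos p.2 - D.pos q.2‖ := by
  have : p.1 = q.1 := (Prod.ext_iff.mp h).1
  rw [liftedPos, liftedPos, this, add_sub_add_left_eq_sub]

variable [hr : Fact (2 ≤ r)]

/-- Collisions with the same convex scatterer do not decrease the pairing. -/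
theorem inner_vin_le_pairing {p q : D.LiftedState} (h : label p = label q) :
    inner ℝ (D.vin p.2 - D.vin q.2) (D.liftedPos p - D.liftedPos q) ≤ D.pairing p q := by
  have hp := cross_tangent_nonneg (p := p) (h ▸ liftedPos_mem_closedObstacle q)
  have hq := cross_tangent_nonneg (p := q) (h ▸ liftedPos_mem_closedObstacle p)
  have h1 := inner_vel_sub_vin p.2 (D.liftedPos p - D.liftedPos q)
  have h2 := inner_vel_sub_vin q.2 (D.liftedPos p - D.liftedPos q)
  have h3 : D.pairing p q = inner ℝ (D.vin p.2 - D.vin q.2) (D.liftedPos p - D.liftedPos q) +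
      inner ℝ (D.vel p.2 - D.vin p.2) (D.liftedPos p - D.liftedPos q) -
      inner ℝ (D.vel q.2 - D.vin q.2) (D.liftedPos p - D.liftedPos q) := by
    rw [pairing, ← inner_add_left, ← inner_sub_left]
    congr 1
    ring
  rw [h3, h1, h2]
  rw [← neg_sub, cross_neg] at hp
  have a1 := mul_nonneg (cos_angle_nonneg p.2) hp
  have a2 := mul_nonneg (cos_angle_nonneg q.2) hq
  linarith

variable [hD : Fact D.FiniteHorizon]

/-- Free flights increase the pairing if the velocities differ. -/
theorem pairing_add_le {δ : ℝ} (hδ : ∀ p : D.LiftedState, δ ≤ D.flight p) {p q : D.LiftedState}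
    (h : label (next p) = label (next q)) :
    D.pairing p q + δ * ‖D.vel p.2 - D.vel q.2‖ ^ 2 ≤ D.pairing (next p) (next q) := by
  refine le_trans ?_ (inner_vin_le_pairing h)
  rw [vin_next, vin_next, liftedPos_next p, liftedPos_next q]
  set v := D.vel p.2
  set w := D.vel q.2
  have hvv : inner ℝ v v = 1 := by rw [real_inner_self_eq_norm_sq, norm_vel]; norm_num
  have hww : inner ℝ w w = 1 := by rw [real_inner_self_eq_norm_sq, norm_vel]; norm_num
  have hn : ‖v - w‖ ^ 2 = 2 * (1 - inner ℝ v w) := by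
    rw [norm_sub_sq_real, norm_vel, norm_vel]; ring
  have h1 : D.liftedPos p + D.flight p * v - (D.liftedPos q + D.flight q * w) =
      (D.liftedPos p - D.liftedPos q) + ((D.flight p) • v - (D.flight q) • w) := by
    simp only [Complex.real_smul]; ring
  rw [h1, inner_add_right]
  have h2 : inner ℝ (v - w) ((D.flight p) • v - (D.flight q) • w) =
      (D.flight p + D.flight q) * (1 - inner ℝ v w) := by
    rw [inner_sub_left, inner_sub_right, inner_sub_right, inner_smul_right, inner_smul_right,
      inner_smul_right, inner_smul_right, hvv, hww, real_inner_comm v w]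
    ring
  rw [h2, hn, pairing]
  have h3 : 0 ≤ 1 - inner ℝ v w := by nlinarith [sq_nonneg ‖v - w‖]
  nlinarith [hδ p, hδ q]

theorem label_traj_eq {x y : D.PhaseSpace} {n : ℕ} (h : Seq.Agree (D.coding x) (D.coding y) n)
    {i : ℤ} (h1 : -(n : ℤ) ≤ i) (h2 : i ≤ n) : label (D.traj x i) = label (D.traj y i) := by
  rw [← coding_apply, ← coding_apply]
  exact h i (abs_le.mpr ⟨h1, h2⟩)

/-- The increments of the pairing along trajectories with the same labels. The initial time may be
the one before the first common label. -/
theorem pairing_traj_mono {δ : ℝ} (hδ : ∀ p : D.LiftedState, δ ≤ D.flight p) {x y : D.PhaseSpace}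
    {n : ℕ} (h : Seq.Agree (D.coding x) (D.coding y) n) {i : ℤ} (hi : -(n : ℤ) - 1 ≤ i) (k : ℕ)
    (hk : i + k ≤ n) : D.pairing (D.traj x i) (D.traj y i) +
      δ * ∑ j ∈ Finset.range k, ‖D.vel (D.traj x (i + j)).2 - D.vel (D.traj y (i + j)).2‖ ^ 2 ≤
      D.pairing (D.traj x (i + k)) (D.traj y (i + k)) := by
  induction k with
  | zero => simp
  | succ k ih =>
    have h1 := ih (by push_cast at hk; linarith)
    have h2 := pairing_add_le hδ (p := D.traj x (i + k)) (q := D.traj y (i + k)) (by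
      rw [← traj_add_one, ← traj_add_one]
      push_cast at hk
      exact label_traj_eq h (by linarith) (by linarith))
    rw [Finset.sum_range_succ, Nat.cast_succ, ← add_assoc, traj_add_one, traj_add_one]
    linarith

/-- Over a block of collisions with the same scatterers, the pairing increases at least
proportionally to its absolute value, and to the squared distance of the points. -/
theorem exists_expansion (D : Table r m) [hD : Fact D.FiniteHorizon] :
    ∃ N : ℕ, ∃ c : ℝ, 0 < c ∧ ∀ (x y : D.PhaseSpace) (n : ℕ),
      Seq.Agree (D.coding x) (D.coding y) n → ∀ i : ℤ, -(n : ℤ) ≤ i → i + N ≤ n →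
      c * |D.pairing (D.traj x i) (D.traj y i)| ≤
        D.pairing (D.traj x (i + N)) (D.traj y (i + N)) -
          D.pairing (D.traj x (i - 1)) (D.traj y (i - 1)) ∧
      c * dist (D.traj x i).2 (D.traj y i).2 ^ 2 ≤
        D.pairing (D.traj x (i + N)) (D.traj y (i + N)) -
          D.pairing (D.traj x (i - 1)) (D.traj y (i - 1)) ∧
      D.pairing (D.traj x (i - 1)) (D.traj y (i - 1)) ≤ D.pairing (D.traj x i) (D.traj y i) ∧
      D.pairing (D.traj x i) (D.traj y i) ≤
        D.pairing (D.traj x (i + N)) (D.traj y (i + N)) := by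
  obtain ⟨N, hN, c, hc, hsep⟩ := exists_separation D
  obtain ⟨δ, hδ0, hδ⟩ := exists_le_flight D
  set κ := δ / (N + 1) with hκ
  have hκ0 : 0 < κ := by positivity
  refine ⟨N, min (κ * c) (κ * c ^ 2), by positivity, fun x y n h i hi hiN => ?_⟩
  have hlab : ∀ j : ℤ, i ≤ j → j ≤ i + N → label (D.traj x j) = label (D.traj y j) :=
    fun j hj1 hj2 => label_traj_eq h (by linarith) (by linarith)
  have hi0 := hlab i le_rfl (by linarith)
  set X := (D.traj x i).2 with hX
  set Y := (D.traj y i).2 with hY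
  have htx : ∀ j : ℤ, D.traj x (i + j) = translate (D.traj x i).1 (D.traj X j) := traj_traj x i
  have hty : ∀ j : ℤ, D.traj y (i + j) = translate (D.traj x i).1 (D.traj Y j) := fun j => by
    have hfst : (D.traj x i).1 = (D.traj y i).1 := (Prod.ext_iff.mp hi0).1
    rw [traj_traj y i, ← hfst]
  have hS := hsep X Y (fun j hj => by
    have h1 := hlab (i + j) (by linarith) (by
      have : (j : ℤ) < N := by exact_mod_cast hj
      linarith)
    rw [htx, hty] at h1
    simp only [label, translate, Prod.mk.injEq, add_right_inj] at h1
    exact Prod.ext h1.1 h1.2)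
  set S := ‖D.vin X - D.vin Y‖ + ∑ j ∈ Finset.range N,
    ‖D.vel (D.traj X (j : ℕ)).2 - D.vel (D.traj Y (j : ℕ)).2‖ with hSdef
  set f : ℕ → ℝ := fun j => ‖D.vel (D.traj x (i - 1 + j)).2 - D.vel (D.traj y (i - 1 + j)).2‖
    with hf
  have hsum : ∑ j ∈ Finset.range (N + 1), f j = S := by
    rw [Finset.sum_range_succ', hSdef, add_comm]
    congr 1
    · simp only [hf]
      rw [Nat.cast_zero, add_zero, ← vin_next, ← vin_next, ← traj_add_one, ← traj_add_one,
        sub_add_cancel]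
    · refine Finset.sum_congr rfl fun j _ => ?_
      simp only [hf]
      have : i - 1 + ((j + 1 : ℕ) : ℤ) = i + j := by push_cast; ring
      rw [this, htx, hty]
      rfl
  have hincr : κ * S ^ 2 ≤ D.pairing (D.traj x (i + N)) (D.traj y (i + N)) -
      D.pairing (D.traj x (i - 1)) (D.traj y (i - 1)) := by
    have h1 := pairing_traj_mono hδ h (i := i - 1) (by linarith) (N + 1) (by push_cast; linarith)
    have h2 : i - 1 + ((N + 1 : ℕ) : ℤ) = i + N := by push_cast; ring
    rw [h2] at h1
    have h3 := sq_sum_le_card_mul_sum_sq (s := Finset.range (N + 1)) (f := f)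
    rw [hsum, Finset.card_range] at h3
    have h4 : κ * S ^ 2 ≤ δ * ∑ j ∈ Finset.range (N + 1), f j ^ 2 := by
      rw [hκ, div_mul_eq_mul_div, div_le_iff₀ (by positivity)]
      push_cast at h3
      nlinarith
    linarith
  have hdist : c * dist X Y ≤ S := by
    nlinarith [norm_nonneg (D.pos X - D.pos Y)]
  have hpos : c * ‖D.pos X - D.pos Y‖ ≤ S := by
    nlinarith [dist_nonneg (x := X) (y := Y)]
  have hvel : ‖D.vel X - D.vel Y‖ ≤ S := by
    have h1 := Finset.single_le_sum (f := fun j : ℕ =>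
      ‖D.vel (D.traj X (j : ℕ)).2 - D.vel (D.traj Y (j : ℕ)).2‖)
      (fun i _ => norm_nonneg _) (Finset.mem_range.mpr hN)
    simp only [Nat.cast_zero, traj_zero] at h1
    rw [hSdef]
    linarith [norm_nonneg (D.vin X - D.vin Y)]
  have hS0 : 0 ≤ S := (norm_nonneg _).trans hvel
  refine ⟨?_, ?_, ?_, ?_⟩
  · refine le_trans ?_ hincr
    have h1 := abs_pairing_le (D.traj x i) (D.traj y i)
    rw [norm_liftedPos_sub hi0] at h1
    have h2 : c * (‖D.vel X - D.vel Y‖ * ‖D.pos X - D.pos Y‖) ≤ S ^ 2 := by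
      nlinarith [norm_nonneg (D.vel X - D.vel Y), norm_nonneg (D.pos X - D.pos Y)]
    calc min (κ * c) (κ * c ^ 2) * |D.pairing (D.traj x i) (D.traj y i)|
        ≤ (κ * c) * (‖D.vel X - D.vel Y‖ * ‖D.pos X - D.pos Y‖) := by
          gcongr
          exact min_le_left _ _
      _ = κ * (c * (‖D.vel X - D.vel Y‖ * ‖D.pos X - D.pos Y‖)) := by ring
      _ ≤ κ * S ^ 2 := by gcongr
  · refine le_trans ?_ hincr
    calc min (κ * c) (κ * c ^ 2) * dist X Y ^ 2 ≤ (κ * c ^ 2) * dist X Y ^ 2 := by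
          gcongr
          exact min_le_right _ _
      _ = κ * (c * dist X Y) ^ 2 := by ring
      _ ≤ κ * S ^ 2 := by gcongr
  · have h1 := pairing_traj_mono hδ h (i := i - 1) (by linarith) 1 (by push_cast; linarith)
    rw [Nat.cast_one, sub_add_cancel] at h1
    refine le_trans (le_add_of_nonneg_right ?_) h1
    positivity
  · have h1 := pairing_traj_mono hδ h (i := i) (by linarith) N hiN
    refine le_trans (le_add_of_nonneg_right ?_) h1
    positivity

theorem geometric_le {B : ℕ → ℝ} {μ : ℝ} (hμ : 0 < μ) {J : ℕ}
    (h : ∀ j < J, μ * B j ≤ B (j + 1)) : B 0 ≤ (μ⁻¹) ^ J * B J := by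
  induction J with
  | zero => simp
  | succ J ih =>
    have h1 := ih fun j hj => h j (by omega)
    have h2 := h J (by omega)
    have h3 : B J ≤ μ⁻¹ * B (J + 1) := by
      rw [inv_mul_eq_div, le_div_iff₀ hμ]; linarith
    calc B 0 ≤ (μ⁻¹) ^ J * B J := h1
      _ ≤ (μ⁻¹) ^ J * (μ⁻¹ * B (J + 1)) := by gcongr
      _ = (μ⁻¹) ^ (J + 1) * B (J + 1) := by ring

/-- Points whose codings agree at the places `|i| ≤ n` are exponentially close in `n`: the bounded
pairing grows exponentially in the future if it is positive, and in the past if it is negative. -/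
theorem exists_dist_sq_le (D : Table r m) [hD : Fact D.FiniteHorizon] :
    ∃ K : ℕ, 0 < K ∧ ∃ ν C : ℝ, 0 < ν ∧ ν < 1 ∧ 0 < C ∧ ∀ (x y : D.PhaseSpace) (n : ℕ),
      Seq.Agree (D.coding x) (D.coding y) n → dist x y ^ 2 ≤ C * ν ^ (n / K) := by
  obtain ⟨N, c, hc, hexp⟩ := exists_expansion D
  obtain ⟨R, hR⟩ := exists_norm_pos_le (D := D)
  set d := Metric.diam (univ : Set D.PhaseSpace) with hd
  have hd0 : 0 ≤ d := Metric.diam_nonneg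
  have hdist : ∀ x y : D.PhaseSpace, dist x y ≤ d := fun x y =>
    Metric.dist_le_diam_of_mem isCompact_univ.isBounded (mem_univ _) (mem_univ _)
  set R' := |R| with hR'
  have hM : ∀ p q : D.LiftedState, label p = label q → |D.pairing p q| ≤ 4 * R' := by
    intro p q hpq
    refine (abs_pairing_le p q).trans ?_
    rw [norm_liftedPos_sub hpq]
    have h1 := norm_sub_le (D.vel p.2) (D.vel q.2)
    have h2 := norm_sub_le (D.pos p.2) (D.pos q.2)
    rw [norm_vel, norm_vel] at h1
    have h3 := (hR p.2).trans (le_abs_self R)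
    have h4 := (hR q.2).trans (le_abs_self R)
    nlinarith [norm_nonneg (D.vel p.2 - D.vel q.2), norm_nonneg (D.pos p.2 - D.pos q.2)]
  set μ := 1 + c with hμ
  have hμ0 : 0 < μ := by positivity
  have hν1 : μ⁻¹ < 1 := inv_lt_one_of_one_lt₀ (by linarith)
  set K := N + 1 with hK
  -- the summand `d ^ 2` of the constant is for the case `n < K`
  refine ⟨K, by omega, μ⁻¹, d ^ 2 + 1 + 8 * R' * μ / c, by positivity, hν1, by positivity,
    fun x y n h => ?_⟩
  set a : ℤ → ℝ := fun i => D.pairing (D.traj x i) (D.traj y i) with ha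
  rcases hJ : n / K with _ | J
  · rw [pow_zero, mul_one]
    have h1 := hdist x y
    have h2 : 0 ≤ 8 * R' * μ / c := by positivity
    nlinarith [dist_nonneg (x := x) (y := y)]
  have hJn : (J + 1) * K ≤ n := by
    rw [← hJ]; exact Nat.div_mul_le_self n K
  have hJn' : ((J : ℤ) + 1) * K ≤ n := by exact_mod_cast hJn
  have hKc : (K : ℤ) = N + 1 := by rw [hK]; push_cast; ring
  have hK1 : (1 : ℤ) ≤ K := by omega
  have hN0 : (0 : ℤ) ≤ N := by positivity
  -- towards the future, `a` grows by the factor `μ` over each block of `K` collisions if positive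
  have hfut : a N ≤ (μ⁻¹) ^ J * (4 * R') := by
    have h1 := geometric_le (B := fun j : ℕ => a (((j : ℤ) + 1) * K - 1)) hμ0 (J := J)
      (fun j hj => by
        have hj' : (j : ℤ) + 1 ≤ J := by exact_mod_cast hj
        have h2 : ((j : ℤ) + 1 + 1) * K ≤ n := le_trans (by gcongr) hJn'
        have h3 : (0 : ℤ) ≤ ((j : ℤ) + 1) * K := by positivity
        have h4 : ((j : ℤ) + 1 + 1) * K = ((j : ℤ) + 1) * K + K := by ring
        obtain ⟨e1, -, e2, -⟩ := hexp x y n h (((j : ℤ) + 1) * K) (by linarith) (by linarith)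
        have e3 : ((j : ℤ) + 1) * K + N = (((j + 1 : ℕ) : ℤ) + 1) * K - 1 := by
          push_cast; linarith
        rw [e3] at e1
        have e4 := mul_le_mul_of_nonneg_left
          (e2.trans (le_abs_self (a (((j : ℤ) + 1) * K)))) hc.le
        simp only [hμ, ha] at e1 e2 e4 ⊢
        linarith)
    have e0 : (((0 : ℕ) : ℤ) + 1) * K - 1 = N := by push_cast; linarith
    simp only [e0] at h1
    refine h1.trans (mul_le_mul_of_nonneg_left ?_ (by positivity))
    have h3 : (0 : ℤ) ≤ (J : ℤ) * K := by positivity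
    have h4 : ((J : ℤ) + 1) * K = (J : ℤ) * K + K := by ring
    exact (le_abs_self _).trans (hM _ _ (label_traj_eq h (by linarith) (by linarith)))
  -- towards the past, `-a` grows by the factor `μ` over each block of `K` collisions if positive
  have hpast : -a (-1) ≤ (μ⁻¹) ^ J * (4 * R') := by
    have h1 := geometric_le (B := fun j : ℕ => -a (-((j : ℤ) * K) - 1)) hμ0 (J := J)
      (fun j hj => by
        have hj' : (j : ℤ) + 1 ≤ J + 1 := by
          have : (j : ℤ) + 1 ≤ J := by exact_mod_cast hj
          linarith
        have h2 : ((j : ℤ) + 1) * K ≤ n := le_trans (by gcongr) hJn'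
        have h3 : (0 : ℤ) ≤ (j : ℤ) * K := by positivity
        have h4 : ((j : ℤ) + 1) * K = (j : ℤ) * K + K := by ring
        obtain ⟨e1, -, -, e2⟩ := hexp x y n h (-(((j : ℤ) + 1) * K)) (by linarith) (by linarith)
        have e3 : -(((j : ℤ) + 1) * K) + N = -((j : ℤ) * K) - 1 := by linarith
        rw [e3] at e1 e2
        have e4 := mul_le_mul_of_nonneg_left
          ((neg_le_neg e2).trans (neg_le_abs (a (-(((j : ℤ) + 1) * K))))) hc.le
        have e5 : (-(((j + 1 : ℕ) : ℤ) * K) - 1 : ℤ) = -(((j : ℤ) + 1) * K) - 1 := by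
          push_cast; ring
        simp only [e5]
        simp only [hμ, ha] at e1 e2 e4 ⊢
        linarith)
    have e0 : -(((0 : ℕ) : ℤ) * K) - 1 = -1 := by push_cast; ring
    simp only [e0] at h1
    refine h1.trans (mul_le_mul_of_nonneg_left ?_ (by positivity))
    have h3 : (0 : ℤ) ≤ (J : ℤ) * K := by positivity
    have h4 : ((J : ℤ) + 1) * K = (J : ℤ) * K + K := by ring
    exact (neg_le_abs _).trans (hM _ _ (label_traj_eq h (by linarith) (by linarith)))
  have h3 : (0 : ℤ) ≤ (J : ℤ) * K := by positivity
  have h4 : ((J : ℤ) + 1) * K = (J : ℤ) * K + K := by ring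
  obtain ⟨-, e1, -, -⟩ := hexp x y n h 0 (by linarith) (by linarith)
  simp only [traj_zero, zero_add, zero_sub] at e1
  change c * dist x y ^ 2 ≤ a N - a (-1) at e1
  have e2 : dist x y ^ 2 ≤ 8 * R' * μ / c * (μ⁻¹) ^ (J + 1) := by
    have e3 : 8 * R' * μ / c * (μ⁻¹) ^ (J + 1) = ((μ⁻¹) ^ J * (4 * R') * 2) / c := by
      rw [pow_succ]
      field_simp
      ring
    rw [e3, le_div_iff₀ hc]
    linarith
  refine e2.trans (mul_le_mul_of_nonneg_right ?_ (by positivity))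
  nlinarith [sq_nonneg d]

/-- The inverse of the coding map is Hölder continuous on the whole space of admissible
sequences. -/
theorem exists_dist_le_rho (D : Table r m) [hD : Fact D.FiniteHorizon] :
    ∃ C α : ℝ, 0 ≤ C ∧ 0 < α ∧ ∀ x y : D.PhaseSpace,
      dist x y ≤ C * dist (D.coding x) (D.coding y) ^ α := by
  obtain ⟨K, hK, ν, C, hν0, hν1, hC, h⟩ := exists_dist_sq_le D
  -- the rate per collision; distances, as opposed to their squares, decay with exponent `1 / 2`
  set β := ν ^ ((1 : ℝ) / (2 * K : ℕ)) with hβ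
  have hβ0 : 0 < β := Real.rpow_pos_of_pos hν0 _
  have hβ1 : β < 1 := Real.rpow_lt_one hν0.le hν1 (by positivity)
  have hβK : β ^ (2 * K) = ν := by
    rw [hβ, one_div]
    exact Real.rpow_inv_natCast_pow hν0.le (by omega)
  have hexp : ∀ x y n, Seq.Agree (D.coding x) (D.coding y) n → dist x y ≤ √(C / ν) * β ^ n := by
    intro x y n hn
    have h1 := h x y n hn
    refine abs_le_of_sq_le_sq' ?_ (by positivity) |>.2
    rw [mul_pow, Real.sq_sqrt (by positivity)]
    refine h1.trans ?_
    rw [div_mul_eq_mul_div, le_div_iff₀ hν0, mul_assoc, ← pow_succ, ← hβK, ← pow_mul, ← pow_mul]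
    refine mul_le_mul_of_nonneg_left ?_ hC.le
    refine pow_le_pow_of_le_one hβ0.le hβ1.le ?_
    have := Nat.div_add_mod n K
    have h2 := Nat.mod_lt n hK
    nlinarith
  set d := Metric.diam (univ : Set D.PhaseSpace) with hd
  set α := Real.logb (1 / 2) β with hα
  have hα0 : 0 < α := Real.logb_pos_of_base_lt_one (by norm_num) (by norm_num) hβ0 hβ1
  have hαβ : (1 / 2 : ℝ) ^ α = β := Real.rpow_logb (by norm_num) (by norm_num) hβ0
  refine ⟨max √(C / ν) d, α, le_max_of_le_left (Real.sqrt_nonneg _), hα0, fun x y => ?_⟩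
  by_cases heq : D.coding x = D.coding y
  · have h1 : dist x y ≤ 0 := by
      have hlim : Tendsto (fun n : ℕ => √(C / ν) * β ^ n) atTop (𝓝 (√(C / ν) * 0)) :=
        (tendsto_pow_atTop_nhds_zero_of_lt_one hβ0.le hβ1).const_mul _
      rw [mul_zero] at hlim
      exact ge_of_tendsto' hlim fun n => hexp x y n fun i _ => by rw [heq]
    refine h1.trans ?_
    positivity
  · have hrho : dist (D.coding x) (D.coding y) = Seq.rho (D.coding x) (D.coding y) := rfl
    rcases Seq.rho_of_ne heq with h1 | ⟨n, hn, h1⟩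
    · rw [hrho, h1, Real.one_rpow, mul_one]
      exact le_max_of_le_right
        (Metric.dist_le_diam_of_mem isCompact_univ.isBounded (mem_univ _) (mem_univ _))
    · rw [hrho, h1, ← Real.rpow_natCast, ← Real.rpow_mul (by norm_num), mul_comm (n : ℝ),
        Real.rpow_mul (by norm_num), hαβ, Real.rpow_natCast]
      refine (hexp x y n hn).trans ?_
      gcongr
      exact le_max_left _ _

theorem coding_injective : Function.Injective D.coding := by
  obtain ⟨C, α, hC, hα, h⟩ := exists_dist_le_rho D
  intro x y hxy
  have h1 := h x y
  rw [hxy, dist_self, Real.zero_rpow hα.ne', mul_zero] at h1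
  exact dist_le_zero.mp h1

end Table

end SinaiBilliard

theorem mainTheorem11 (r m : ℕ) (hr : 3 ≤ r) (D : SinaiBilliard.Table r m)
    (hD : D.FiniteHorizon) :
    -- the billiard map and the coding map are well defined
    (Function.Bijective D.billiardMap ∧
      (∀ x y, D.billiardMap x = y ↔ ∃ k : ℤ × ℤ, D.NextCollision (0, x) (k, y)) ∧
      (∀ x a, D.coding x = a ↔ D.IsCoding x a)) ∧
    -- the coding map is a bijection onto the space of admissible sequences
    Set.BijOn D.coding Set.univ D.admissible ∧
    -- its restriction to the regular set is continuous
    ContinuousOn D.coding D.regularSet ∧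
    -- this restriction is a homeomorphism onto its image, with Hölder continuous inverse
    (∃ h : D.regularSet ≃ₜ (D.coding '' D.regularSet),
      (∀ x : D.regularSet, (h x : SinaiBilliard.Seq m) = D.coding x) ∧
      ∃ C α : NNReal, 0 < α ∧ HolderWith C α h.symm) ∧
    -- the discontinuity set of the coding map
    {x | ¬ ContinuousAt D.coding x} = D.singularSet \ D.grazingOnlyNow := by
  have : Fact (2 ≤ r) := ⟨by omega⟩
  have : Fact D.FiniteHorizon := ⟨hD⟩
  have hinj := SinaiBilliard.Table.coding_injective (D := D)
  have hcont : ContinuousOn D.coding D.regularSet := by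
    intro x hx
    refine ContinuousAt.continuousWithinAt ?_
    by_contra h
    exact hx (SinaiBilliard.Table.not_continuousAt_coding_iff.mp h).1
  refine ⟨⟨SinaiBilliard.Table.billiardMap_bijective, SinaiBilliard.Table.billiardMap_eq_iff,
    SinaiBilliard.Table.coding_eq_iff⟩, ?_, hcont, ?_, ?_⟩
  · refine ⟨fun x _ => Set.mem_range_self x, hinj.injOn, ?_⟩
    rintro _ ⟨x, rfl⟩
    exact ⟨x, Set.mem_univ x, rfl⟩
  · obtain ⟨C, α, hC, hα, hle⟩ := SinaiBilliard.Table.exists_dist_le_rho D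
    lift C to NNReal using hC
    lift α to NNReal using hα.le
    set e : D.regularSet ≃ (D.coding '' D.regularSet) := Equiv.Set.image D.coding D.regularSet hinj
     
    have hHolder : HolderWith C α e.symm := by
      intro a b
      obtain ⟨x, rfl⟩ := e.surjective a
      obtain ⟨y, rfl⟩ := e.surjective b
      rw [Equiv.symm_apply_apply, Equiv.symm_apply_apply, edist_nndist, edist_nndist,
        ← ENNReal.coe_rpow_of_nonneg _ α.coe_nonneg, ← ENNReal.coe_mul, ENNReal.coe_le_coe,
        ← NNReal.coe_le_coe]
      exact hle x y
    refine ⟨⟨e, ?_, ?_⟩, fun x => rfl, C, α, NNReal.coe_pos.mp hα, hHolder⟩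
    · exact Continuous.subtype_mk hcont.domRestrict _
    · exact hHolder.continuous (NNReal.coe_pos.mp hα)
  · ext x
    exact SinaiBilliard.Table.not_continuousAt_coding_iff
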